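/- Consider a continuous-time open quantum walk on $\mathbb Z$ with internal space $\mathbb C^d$ and nearest-neighbour jumps: uniformly bounded $d\times d$ complex matrices $H_n=H_n^*$ (Hamiltonians) and $A_n,B_n,C_n$ (jump operators $n\to n+1$, $n\to n$, $n\to n-1$), $n\in\mathbb Z$. Put $\lceil X\rceil=X\otimes\overline X$, $G_n=-iH_n-\tfrac12(A_n^*A_n+B_n^*B_n+C_n^*C_n)$ and $D_n=G_n\otimes I+I\otimes\overline{G_n}+\lceil B_n\rceil$. The generator is represented by the block tridiagonal matrix $\mathcal L$ on $\mathbb Z$ with $\mathcal L_{n+1,n}=\lceil A_n\rceil$, $\mathcal L_{n,n}=D_n$, $\mathcal L_{n-1,n}=\lceil C_n\rceil$; let $\Lambda_{ji}(t)=\sum_{k\ge0}\frac{t^k}{k!}(\mathcal L^k)_{ji}$ be the blocks of $e^{t\mathcal L}$. Assume that $A_n$ $(n\ge0)$ and $C_n$ $(n\le-1)$ are nonsingular, and that there are nonsingular $d^2\times d^2$ matrices $R_n$ and Hermitian $E_n$ $(n\in\mathbb Z)$ with $$\lceil A_n\rceil^*R_{n+1}^*R_{n+1}=R_n^*R_n\lceil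 C_{n+1}\rceil,\qquad R_{-n-1}^*R_{-n-1}\lceil C_{-n}\rceil=\lceil A_{-n-1}\rceil^*R_{-n}^*R_{-n}\quad(n\ge0),\qquad R_nD_n=E_nR_n\quad(n\in\mathbb Z).$$ Put $\Pi_n=(R_n^*R_n)^{-1}$. Let $Q^\alpha_n$ $(\alpha=1,2,\ n\in\mathbb Z)$ be the matrix polynomials with $Q^1_0=Q^2_{-1}=I$, $Q^2_0=Q^1_{-1}=0$ and $$-xQ^\alpha_n(x)=Q^\alpha_{n+1}(x)\lceil A_n\rceil+Q^\alpha_n(x)D_n+Q^\alpha_{n-1}(x)\lceil C_n\rceil .$$ A spectral block matrix of the walk is a positive semidefinite $2\times2$ block matrix-valued measure $W=(W_{\alpha\beta})$ on $\mathbb R$ with blocks of order $d^2$ such that $$\Lambda_{ji}(t)=\sum_{\alpha,\beta=1}^2\Pi_j\int_{\mathbb R}e^{-xt}\,Q^\alpha_j(x)^*\,dW_{\alpha\beta}(x)\,Q^\beta_i(x)\qquad(i,j\in\mathbb Z,\ t\ge0).$$ Let $\mathcal L^+$, $\mathcal L^-$ be the restrictions of $\mathcal L$ to the sites $0,1,2,\dots$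 and to the sites $-1,-2,-3,\dots$ (in this order). A weight matrix of $\mathcal L^\pm$ is a positive semidefinite $d^2\times d^2$ matrix-valued measure $W_\pm$ on $\mathbb R$ with respect to which the polynomials $Q_n$ $(n\ge 0)$ defined by $Q_0=I$ and $-x\,(Q_0,Q_1,\dots)=(Q_0,Q_1,\dots)\mathcal L^\pm$ are orthogonal, that is, $\int Q_j^*\,dW_\pm\,Q_i=0$ for $j\ne i$ and $\int Q_i^*\,dW_\pm\,Q_i$ is nonsingular. Put $\Pi_0^+=\big(\int dW_+\big)^{-1}$, $\Pi_{-1}^-=\big(\int dW_-\big)^{-1}$, and let $B(z;V)=\int_{\mathbb R}\frac{dV(x)}{x-z}$ denote the Stieltjes transform. Then a spectral block matrix $W$ and weight matrices $W_+$ of $\mathcal L^+$ and $W_-$ of $\mathcal L^-$ exist. For all such $W,W_+,W_-$ and every $z\in\mathbb C\setminus[0,\infty)$, the transforms and inverses below exist and $$\begin{aligned} \Pi_0B(z;W_{11})&=\Pi_0^+B(z;W_+)\big(I-\lceil A_{-1}\rceil\Pi_{-1}^-B(z;W_-)\lceil C_0\rceil\Pi_0^+B(z;W_+)\big)^{-1},\\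 \Pi_{-1}B(z;W_{22})&=\Pi_{-1}^-B(z;W_-)\big(I-\lceil C_0\rceil\Pi_0^+B(z;W_+)\lceil A_{-1}\rceil\Pi_{-1}^-B(z;W_-)\big)^{-1},\\ \Pi_0B(z;W_{12})&=\Pi_0^+B(z;W_+)\big(I-\lceil A_{-1}\rceil\Pi_{-1}^-B(z;W_-)\lceil C_0\rceil\Pi_0^+B(z;W_+)\big)^{-1}\lceil A_{-1}\rceil\Pi_{-1}^-B(z;W_-),\\ \Pi_{-1}B(z;W_{21})&=\Pi_{-1}^-B(z;W_-)\big(I-\lceil C_0\rceil\Pi_0^+B(z;W_+)\lceil A_{-1}\rceil\Pi_{-1}^-B(z;W_-)\big)^{-1}\lceil C_0\rceil\Pi_0^+B(z;W_+). \end{aligned}$$ With the opposite sign convention $B(z;V)=\int\frac{dV(x)}{z-x}$, the first two identities hold unchanged and the last two hold with a minus sign in front of the right-hand side. In particular, if $\Pi_0=\Pi_{-1}=\Pi_0^+=\Pi_{-1}^-=I$, then, with $B(z;V)=\int\frac{dV(x)}{x-z}$, $$\begin{aligned} B(z;W_{11})&=B(z;W_+)\big(I-\lceil A_{-1}\rceil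 B(z;W_-)\lceil C_0\rceil B(z;W_+)\big)^{-1},\\ B(z;W_{22})&=B(z;W_-)\big(I-\lceil C_0\rceil B(z;W_+)\lceil A_{-1}\rceil B(z;W_-)\big)^{-1},\\ B(z;W_{12})&=B(z;W_+)\big(I-\lceil A_{-1}\rceil B(z;W_-)\lceil C_0\rceil B(z;W_+)\big)^{-1}\lceil A_{-1}\rceil B(z;W_-),\\ B(z;W_{21})&=B(z;W_-)\big(I-\lceil C_0\rceil B(z;W_+)\lceil A_{-1}\rceil B(z;W_-)\big)^{-1}\lceil C_0\rceil B(z;W_+). \end{aligned}$$ -/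

import Mathlib

open MeasureTheory
open scoped Matrix Kronecker ComplexOrder

noncomputable section

/-! ### Nearest-neighbour continuous-time open quantum walks on the integers -/

/-- The data of a continuous-time open quantum walk on `ℤ` with nearest-neighbour jumps and
internal space `ℂ^d`: `H n` is the local Hamiltonian at site `n`, and `A n`, `B n`, `C n` are the
jump operators `n → n + 1`, `n → n`, `n → n - 1`. The uniform bound says that `H = ⊕ H n` is a
bounded operator and that the sum of all `S* S` over the jump operators `S` converges strongly
to a bounded operator (it is the direct sum of the `A n* A n + B n* B n + C n* C n`). -/
structure TridiagonalCTOQW (d : ℕ) where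
  H : ℤ → Matrix (Fin d) (Fin d) ℂ
  A : ℤ → Matrix (Fin d) (Fin d) ℂ
  B : ℤ → Matrix (Fin d) (Fin d) ℂ
  C : ℤ → Matrix (Fin d) (Fin d) ℂ
  isHermitian_H : ∀ n, (H n).IsHermitian
  bounded : ∃ K : ℝ, ∀ n a b, ‖H n a b‖ ≤ K ∧ ‖A n a b‖ ≤ K ∧ ‖B n a b‖ ≤ K ∧ ‖C n a b‖ ≤ K

/-- `⌈X⌉ = X ⊗ conj X`, the matrix of `ρ ↦ X ρ X*` on row-stacked matrices. -/
def rep {d : ℕ} (X : Matrix (Fin d) (Fin d) ℂ) : Matrix (Fin d × Fin d) (Fin d × Fin d) ℂ :=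
  X ⊗ₖ X.map star

/-- `X ⊗ 1 + 1 ⊗ conj X`, the matrix of `ρ ↦ X ρ + ρ X*` on row-stacked matrices. -/
def repAdd {d : ℕ} (X : Matrix (Fin d) (Fin d) ℂ) : Matrix (Fin d × Fin d) (Fin d × Fin d) ℂ :=
  X ⊗ₖ (1 : Matrix (Fin d) (Fin d) ℂ) + (1 : Matrix (Fin d) (Fin d) ℂ) ⊗ₖ X.map star

/-- Row stacking. -/
def rowVec {d : ℕ} (X : Matrix (Fin d) (Fin d) ℂ) : Fin d × Fin d → ℂ := fun p => X p.1 p.2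

theorem rep_mulVec {d : ℕ} (X ρ : Matrix (Fin d) (Fin d) ℂ) :
    rep X *ᵥ rowVec ρ = rowVec (X * ρ * Xᴴ) := by
  ext ⟨a, b⟩
  simp only [rep, rowVec, Matrix.mulVec, dotProduct, Fintype.sum_prod_type, Matrix.mul_apply,
    Matrix.kroneckerMap_apply, Matrix.map_apply, Matrix.conjTranspose_apply, Finset.sum_mul]
  rw [Finset.sum_comm]
  refine Finset.sum_congr rfl fun _ _ => Finset.sum_congr rfl fun _ _ => by ring

theorem repAdd_mulVec {d : ℕ} (X ρ : Matrix (Fin d) (Fin d) ℂ) :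
    repAdd X *ᵥ rowVec ρ = rowVec (X * ρ + ρ * Xᴴ) := by
  ext ⟨a, b⟩
  simp [repAdd, rowVec, Matrix.mulVec, dotProduct, Fintype.sum_prod_type, Matrix.mul_apply,
    Matrix.kroneckerMap_apply, Matrix.one_apply, mul_add, Finset.sum_add_distrib, mul_comm]

namespace TridiagonalCTOQW

variable {d : ℕ} (w : TridiagonalCTOQW d)

/-- `G n = - i H n - (1/2) (A n* A n + B n* B n + C n* C n)`. -/
def G (n : ℤ) : Matrix (Fin d) (Fin d) ℂ :=
  -(Complex.I • w.H n)
    - (1 / 2 : ℂ) • ((w.A n)ᴴ * w.A n + (w.B n)ᴴ * w.B n + (w.C n)ᴴ * w.C n)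

/-- The Lindblad generator on block-diagonal operators `ρ = ⊕ ρ n`. -/
def lindblad (ρ : ℤ → Matrix (Fin d) (Fin d) ℂ) (n : ℤ) : Matrix (Fin d) (Fin d) ℂ :=
  w.G n * ρ n + ρ n * (w.G n)ᴴ
    + (w.A (n - 1) * ρ (n - 1) * (w.A (n - 1))ᴴ + w.B n * ρ n * (w.B n)ᴴ
      + w.C (n + 1) * ρ (n + 1) * (w.C (n + 1))ᴴ)

/-- The diagonal block of the block-tridiagonal matrix representation of the generator. -/
def diag (n : ℤ) : Matrix (Fin d × Fin d) (Fin d × Fin d) ℂ := repAdd (w.G n) + rep (w.B n)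

/-- The block-tridiagonal matrix with entries `⌈A (n-1)⌉`, `diag n`, `⌈C (n+1)⌉` in row `n` and
columns `n - 1`, `n`, `n + 1` represents the generator. -/
theorem rowVec_lindblad (ρ : ℤ → Matrix (Fin d) (Fin d) ℂ) (n : ℤ) :
    rowVec (w.lindblad ρ n) = rep (w.A (n - 1)) *ᵥ rowVec (ρ (n - 1)) + w.diag n *ᵥ rowVec (ρ n)
      + rep (w.C (n + 1)) *ᵥ rowVec (ρ (n + 1)) := by
  rw [diag, Matrix.add_mulVec, repAdd_mulVec, rep_mulVec, rep_mulVec, rep_mulVec]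
  ext p
  simp only [rowVec, lindblad, Matrix.add_apply, Pi.add_apply]
  ring

/-- The block `(j, i)` of the `k`-th power of the block-tridiagonal generator. -/
def blockPow : ℕ → ℤ → ℤ → Matrix (Fin d × Fin d) (Fin d × Fin d) ℂ
  | 0, j, i => if j = i then 1 else 0
  | k + 1, j, i => rep (w.A (j - 1)) * blockPow k (j - 1) i + w.diag j * blockPow k j i
      + rep (w.C (j + 1)) * blockPow k (j + 1) i

/-- The block `Λ_{ji}(t)` of the semigroup `exp (t L)` generated by the walk. -/
def semigroupBlock (t : ℝ) (j i : ℤ) : Matrix (Fin d × Fin d) (Fin d × Fin d) ℂ :=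
  ∑' k : ℕ, ((t : ℂ) ^ k / (k.factorial : ℂ)) • w.blockPow k j i

/-- The symmetrizability conditions: Hermitian `E n` and nonsingular `R n` which conjugate the
block-tridiagonal generator to a Hermitian one. -/
structure Symmetrizable (R E : ℤ → Matrix (Fin d × Fin d) (Fin d × Fin d) ℂ) : Prop where
  isHermitian_E : ∀ n, (E n).IsHermitian
  isUnit_R : ∀ n, IsUnit (R n)
  right : ∀ n : ℤ, 0 ≤ n →
    (rep (w.A n))ᴴ * ((R (n + 1))ᴴ * R (n + 1)) = (R n)ᴴ * R n * rep (w.C (n + 1))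
  left : ∀ n : ℤ, 0 ≤ n →
    (R (-n - 1))ᴴ * R (-n - 1) * rep (w.C (-n)) = (rep (w.A (-n - 1)))ᴴ * ((R (-n))ᴴ * R (-n))
  diagonal : ∀ n, R n * w.diag n = E n * R n

end TridiagonalCTOQW

/-! ### Matrix polynomials defined by a three-term recurrence -/

/-- Values at `x` of the solution of
`-x Q n = Q (n+1) * a n + Q n * b n + Q (n-1) * c n` for `n ≥ 0`, with `Q (-1) = p`, `Q 0 = q`
(for nonsingular `a n`). -/
def threeTerm {ι : Type*} [Fintype ι] [DecidableEq ι] (a b c : ℕ → Matrix ι ι ℂ)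
    (p q : Matrix ι ι ℂ) (x : ℝ) : ℕ → Matrix ι ι ℂ
  | 0 => q
  | 1 => (-((x : ℂ) • q) - q * b 0 - p * c 0) * (a 0)⁻¹
  | n + 2 => (-((x : ℂ) • threeTerm a b c p q x (n + 1)) - threeTerm a b c p q x (n + 1) * b (n + 1)
      - threeTerm a b c p q x n * c (n + 1)) * (a (n + 1))⁻¹

namespace TridiagonalCTOQW

variable {d : ℕ} (w : TridiagonalCTOQW d)

/-- The solution on `n ≥ 0` with prescribed values `p` at `-1` and `q` at `0`. -/
def rightPoly (p q : Matrix (Fin d × Fin d) (Fin d × Fin d) ℂ) (x : ℝ) (n : ℕ) :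
    Matrix (Fin d × Fin d) (Fin d × Fin d) ℂ :=
  threeTerm (fun k : ℕ => rep (w.A k)) (fun k : ℕ => w.diag k) (fun k : ℕ => rep (w.C k)) p q x n

/-- The solution on the sites `-1, -2, …` (the site `-n-1` has index `n`) with prescribed values
`p` at `0` and `q` at `-1`. -/
def leftPoly (p q : Matrix (Fin d × Fin d) (Fin d × Fin d) ℂ) (x : ℝ) (n : ℕ) :
    Matrix (Fin d × Fin d) (Fin d × Fin d) ℂ :=
  threeTerm (fun k : ℕ => rep (w.C (-k - 1))) (fun k : ℕ => w.diag (-k - 1))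
    (fun k : ℕ => rep (w.A (-k - 1))) p q x n

/-- The two families of matrix polynomials on `ℤ`: the family `α = 0` has the value `1` at the
site `0` and `0` at the site `-1`, the family `α = 1` has the value `0` at `0` and `1` at `-1`. -/
def poly (α : Fin 2) (n : ℤ) (x : ℝ) : Matrix (Fin d × Fin d) (Fin d × Fin d) ℂ :=
  match n with
  | Int.ofNat k => w.rightPoly (if α = 0 then 0 else 1) (if α = 0 then 1 else 0) x k
  | Int.negSucc k => w.leftPoly (if α = 0 then 1 else 0) (if α = 0 then 0 else 1) x k

end TridiagonalCTOQW

/-! ### Matrix-valued measures -/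

/-- A matrix-valued measure on `ℝ` with finite complex entries, given by an integrable density
with respect to a finite scalar measure (for instance its total variation). -/
structure MatrixMeasure (ι : Type*) where
  base : Measure ℝ
  isFinite : IsFiniteMeasure base
  density : ℝ → Matrix ι ι ℂ
  measurable : ∀ p q, Measurable fun x => density x p q
  integrable : ∀ p q, Integrable (fun x => density x p q) base

namespace MatrixMeasure

variable {ι : Type*}

/-- Positive matrix-valued measures, that is, weight matrices. -/
def IsPositive [Fintype ι] (W : MatrixMeasure ι) : Prop := ∀ x, (W.density x).PosSemidef

/-- Existence of `∫ f(x) P(x)* dW(x) Q(x)`. -/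
def PairIntegrable [Fintype ι] (W : MatrixMeasure ι) (f : ℝ → ℂ) (P Q : ℝ → Matrix ι ι ℂ) : Prop :=
  ∀ p q, Integrable (fun x => (f x • ((P x)ᴴ * W.density x * Q x)) p q) W.base

/-- The matrix `∫ f(x) P(x)* dW(x) Q(x)`. -/
def pair [Fintype ι] (W : MatrixMeasure ι) (f : ℝ → ℂ) (P Q : ℝ → Matrix ι ι ℂ) : Matrix ι ι ℂ :=
  Matrix.of fun p q => ∫ x, (f x • ((P x)ᴴ * W.density x * Q x)) p q ∂W.base

/-- The total mass `∫ dW(x)`. -/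
def mass (W : MatrixMeasure ι) : Matrix ι ι ℂ :=
  Matrix.of fun p q => ∫ x, W.density x p q ∂W.base

/-- Convergence of the Stieltjes transform at `z`. -/
def StieltjesIntegrable (W : MatrixMeasure ι) (z : ℂ) : Prop :=
  ∀ p q, Integrable (fun x : ℝ => W.density x p q / ((x : ℂ) - z)) W.base

/-- The Stieltjes transform `∫ dW(x) / (x - z)`. -/
def stieltjes (W : MatrixMeasure ι) (z : ℂ) : Matrix ι ι ℂ :=
  Matrix.of fun p q => ∫ x : ℝ, W.density x p q / ((x : ℂ) - z) ∂W.base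

/-- The Stieltjes transform with the opposite sign convention, `∫ dW(x) / (z - x)`. -/
def stieltjesOpp (W : MatrixMeasure ι) (z : ℂ) : Matrix ι ι ℂ :=
  Matrix.of fun p q => ∫ x : ℝ, W.density x p q / (z - (x : ℂ)) ∂W.base

/-- The blocks of a `2 × 2` block matrix measure. -/
def block (W : MatrixMeasure (Fin 2 × ι)) (α β : Fin 2) : MatrixMeasure ι where
  base := W.base
  isFinite := W.isFinite
  density x := Matrix.of fun p q => W.density x (α, p) (β, q)
  measurable p q := W.measurable (α, p) (β, q)
  integrable p q := W.integrable (α, p) (β, q)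

/-- `W` is a weight matrix with respect to which the matrix polynomials `Q n` are orthogonal:
`∫ Q j* dW Q i = 0` for `j ≠ i`, and `∫ Q i* dW Q i` is nonsingular. -/
structure IsOrthogonalityWeight [Fintype ι] [DecidableEq ι] (W : MatrixMeasure ι)
    (Q : ℝ → ℕ → Matrix ι ι ℂ) : Prop where
  isPositive : W.IsPositive
  integrable : ∀ j i, W.PairIntegrable (fun _ => 1) (fun x => Q x j) (fun x => Q x i)
  orthogonal : ∀ j i, j ≠ i → W.pair (fun _ => 1) (fun x => Q x j) (fun x => Q x i) = 0
  nonsingular : ∀ i, IsUnit (W.pair (fun _ => 1) (fun x => Q x i) (fun x => Q x i))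

end MatrixMeasure

namespace TridiagonalCTOQW

variable {d : ℕ} (w : TridiagonalCTOQW d)

/-- The normalization `Π n = (R n* R n)⁻¹`. -/
def normalization (R : ℤ → Matrix (Fin d × Fin d) (Fin d × Fin d) ℂ) (n : ℤ) :
    Matrix (Fin d × Fin d) (Fin d × Fin d) ℂ := ((R n)ᴴ * R n)⁻¹

/-- `W` is a spectral block matrix of the walk: a positive `2 × 2` block matrix measure for which
the Karlin-McGregor formula
`Λ_{ji}(t) = ∑_{α,β} Π j ∫ exp(-x t) Q^α_j(x)* dW_{αβ}(x) Q^β_i(x)` holds. -/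
structure IsSpectralBlockMatrix (R : ℤ → Matrix (Fin d × Fin d) (Fin d × Fin d) ℂ)
    (W : MatrixMeasure (Fin 2 × (Fin d × Fin d))) : Prop where
  isPositive : W.IsPositive
  integrable : ∀ (j i : ℤ) (t : ℝ), 0 ≤ t → ∀ α β : Fin 2, (W.block α β).PairIntegrable
    (fun x => (Real.exp (-x * t) : ℂ)) (w.poly α j) (w.poly β i)
  karlinMcGregor : ∀ (j i : ℤ) (t : ℝ), 0 ≤ t → w.semigroupBlock t j i =
    ∑ α : Fin 2, ∑ β : Fin 2, normalization R j * (W.block α β).pair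
      (fun x => (Real.exp (-x * t) : ℂ)) (w.poly α j) (w.poly β i)

/-- `W` is a weight matrix of the walk restricted to the sites `0, 1, 2, …`. -/
def IsRightWeight (W : MatrixMeasure (Fin d × Fin d)) : Prop :=
  W.IsOrthogonalityWeight (w.rightPoly 0 1)

/-- `W` is a weight matrix of the walk restricted to the sites `-1, -2, -3, …`. -/
def IsLeftWeight (W : MatrixMeasure (Fin d × Fin d)) : Prop :=
  W.IsOrthogonalityWeight (w.leftPoly 0 1)

end TridiagonalCTOQW

end

/-!
# Stieltjes transforms of the spectral block matrix of an open quantum walk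

Let `L` be the block tridiagonal generator, and let `L₀` be `L` without the two blocks `⌈A (-1)⌉`
and `⌈C 0⌉` which join the sites `-1` and `0`. Then `L₀` is the direct sum of the generators of
the two half-lines. The identities are the second resolvent identity
`(w - L)⁻¹ = (w - L₀)⁻¹ + (w - L₀)⁻¹ (L - L₀) (w - L)⁻¹`
at the sites `0` and `-1`: there it is a linear system for the four blocks of `(w - L)⁻¹`, which `isUnit_and_eq_of_coupled` solves by algebra. What has to be shown is
that the blocks of the resolvents are the Stieltjes transforms at `-w` of the measures. All
operators are bounded, so blocks of powers of `L` are finite sums of paths (`triPow`), and for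
large `|w|` blocks of the resolvent are Neumann series (`resolventBlock`), for which the resolvent
identity (`resolventBlock_eq_cutAt`) is a decomposition of paths.

*Existence of the measures.* By symmetrizability `-L` is symmetric for the inner product
`∑ φ n* (R n* R n) ψ n` on finitely supported vectors, and its moments grow at most exponentially. Hence
it is bounded, and the functional calculus on the completion together with the
Riesz-Markov-Kakutani theorem gives a positive matrix measure of compact support with the right
moments (`LinearMap.IsSymmetric.exists_matrix_spectral_measure`). Pairing finitely supported
vectors with the polynomials turns `L` into multiplication by `-x`, and the vectors at the sites
`0` and `-1` generate all others because the `A n`, `n ≥ 0`, and `C n`, `n < 0`, are nonsingular.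
So the measure represents all blocks of all powers of `L` (`IsSymmetrizer.exists_weight`). The
same argument for `L₀` gives the weight matrices of the half-lines.

*Arbitrary measures.* Orthogonality determines the moments of a weight matrix from its total mass
(`MatrixMeasure.moments_of_orthogonal`), their growth shows that it has compact support, and so
its Laplace transform is `∫ dW` times a block of `exp (t L₀)`. For a spectral block matrix the
Laplace transform is given by the Karlin-McGregor formula at the sites `0` and `-1`, where the
polynomials are constant. Two facts turn this into the Stieltjes transform
(`MatrixMeasure.IsPositive.stieltjes_of_laplace`):

* The Laplace transforms are bounded on `t ≥ 0`, so that the measures live on `[0, ∞)`, by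
  positivity. The bound holds because in the Heisenberg picture the generator is dissipative for
  the supremum of the operator norms at the sites: to first order the evolution is a completely
  positive map with Kraus operators `1 + ε G`, `√ε A`, `√ε B`, `√ε C`, which is contractive up to
  `O(ε²)` (`norm_add_smul_heisenbergFun_le`). This also covers `L₀`, where jumps have been removed
  (`exists_norm_tsum_triPow_le`).
* `∫ dW(x) / (x + r)` is the Laplace transform in `t`, at `r`, of the Laplace transform of `W`,
  and so it is a Neumann series for large real `r`.

This proves the identities at `z = -r` for large `r`. Both sides of the system of resolvent
equations are holomorphic on `ℂ \ [0, ∞)`, so it holds there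
(`TridiagonalCTOQW.coupled_stieltjes`), and it implies both the existence of the inverses and the
formulas.
-/

noncomputable section

open scoped InnerProductSpace CompactlySupported

/-! ### Spectral measures of symmetric operators -/

/-- The spectral measure of `T` at `v` is the measure which represents the positive functional
`f ↦ ⟪v, f(T) v⟫`, by the Riesz-Markov-Kakutani theorem. -/
theorem IsSelfAdjoint.exists_scalar_spectral_measure {H : Type*} [NormedAddCommGroup H]
    [InnerProductSpace ℂ H] [CompleteSpace H] {T : H →L[ℂ] H} (hT : IsSelfAdjoint T) (v : H) :
    ∃ μ : Measure ℝ, IsFiniteMeasure μ ∧ (∀ᵐ x ∂μ, |x| ≤ ‖T‖) ∧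
      ∀ f : ℝ → ℝ, Continuous f → ∫ x, f x ∂μ = (⟪v, cfc f T v⟫_ℂ).re := by
  have hlin : ∀ (c : ℝ) (S : H →L[ℂ] H), (c • S) v = (c : ℂ) • S v := fun c S => by simp
  let Λ₀ : C_c(spectrum ℝ T, ℝ) →ₗ[ℝ] ℝ :=
    { toFun := fun f => (⟪v, cfcHom hT f.toContinuousMap v⟫_ℂ).re
      map_add' := fun f g => by
        have : (f + g).toContinuousMap = f.toContinuousMap + g.toContinuousMap := rfl
        simp [this]
      map_smul' := fun c f => by
        have : (c • f).toContinuousMap = c • f.toContinuousMap := rfl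
        rw [this, map_smul, hlin, inner_smul_right]
        simp }
  let Λ : C_c(spectrum ℝ T, ℝ) →ₚ[ℝ] ℝ := PositiveLinearMap.mk₀ Λ₀ (by
    intro f hf
    have h0 : 0 ≤ cfcHom hT f.toContinuousMap := by
      rw [cfcHom_nonneg_iff]
      exact fun x => hf x
    have h1 := (ContinuousLinearMap.nonneg_iff_isPositive _).1 h0
    exact h1.re_inner_nonneg_right v)
  have hfin : IsFiniteMeasure (RealRMK.rieszMeasure Λ) := inferInstance
  refine ⟨(RealRMK.rieszMeasure Λ).map Subtype.val, inferInstance, ?_, ?_⟩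
  · rw [ae_map_iff measurable_subtype_coe.aemeasurable
      (measurableSet_le (by fun_prop) measurable_const)]
    refine Filter.Eventually.of_forall fun x => ?_
    have h := spectrum.norm_le_norm_mul_of_mem x.2
    exact h.trans (mul_le_of_le_one_right (norm_nonneg _) ContinuousLinearMap.norm_id_le)
  · intro f hf
    rw [integral_map measurable_subtype_coe.aemeasurable hf.aestronglyMeasurable]
    let g : C_c(spectrum ℝ T, ℝ) :=
      ⟨⟨fun x => f x, by fun_prop⟩, HasCompactSupport.of_compactSpace _⟩
    have h := RealRMK.integral_rieszMeasure Λ g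
    rw [cfc_apply f T hT hf.continuousOn]
    exact h

/-- Integrals of continuous functions against integrable densities on a bounded set. -/
theorem Continuous.integrable_mul_of_ae_le {μ : Measure ℝ} {g : ℝ → ℂ} (hg : Integrable g μ)
    {K : ℝ} (hK : ∀ᵐ x ∂μ, K < |x| → g x = 0) {f : ℝ → ℂ} (hf : Continuous f) :
    Integrable (fun x => f x * g x) μ := by
  obtain ⟨B, hB⟩ := (isCompact_Icc (a := -K) (b := K)).exists_bound_of_continuousOn hf.continuousOn
  refine Integrable.mono' (hg.norm.const_mul |B|)
    (hf.aestronglyMeasurable.mul hg.aestronglyMeasurable) ?_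
  filter_upwards [hK] with x hx
  by_cases h : K < |x|
  · simp [hx h]
  · rw [norm_mul]
    exact mul_le_mul_of_nonneg_right ((hB x (abs_le.1 (not_lt.1 h))).trans (le_abs_self B))
      (norm_nonneg _)

theorem ae_eq_of_integral_continuous_mul_eq {μ : Measure ℝ} {g h : ℝ → ℂ}
    (hg : Integrable g μ) (hh : Integrable h μ) {K : ℝ} (hK : ∀ᵐ x ∂μ, |x| ≤ K)
    (H : ∀ f : ℝ → ℝ, Continuous f → ∫ x, (f x : ℂ) * g x ∂μ = ∫ x, (f x : ℂ) * h x ∂μ) :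
    g =ᵐ[μ] h := by
  have hi : ∀ {g : ℝ → ℂ}, Integrable g μ → ∀ f : ℝ → ℝ, Continuous f →
      Integrable (fun x => (f x : ℂ) * g x) μ := fun hg f hf =>
    Continuous.integrable_mul_of_ae_le (f := fun x => (f x : ℂ)) hg
      (hK.mono fun x hx hx' => absurd hx (not_le.2 hx')) (by fun_prop)
  have := ae_eq_zero_of_integral_contDiff_smul_eq_zero (hg.sub hh).locallyIntegrable (by
    intro f hf _
    have h1 := H f hf.continuous
    have h2 : ∀ x, f x • (g - h) x = (f x : ℂ) * g x - (f x : ℂ) * h x := fun x => by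
      simp [mul_sub]
    simp_rw [h2]
    rw [integral_sub (hi hg f hf.continuous) (hi hh f hf.continuous), h1, sub_self])
  filter_upwards [this] with x hx
  exact sub_eq_zero.1 hx

/-- The matrix of spectral measures of a family of vectors. The entries are defined by
polarization of the scalar spectral measures, as densities with respect to the sum of the scalar
spectral measures of the family. -/
theorem IsSelfAdjoint.exists_matrix_spectral_measure {H : Type*} [NormedAddCommGroup H]
    [InnerProductSpace ℂ H] [CompleteSpace H] {T : H →L[ℂ] H} (hT : IsSelfAdjoint T)
    {κ : Type*} [Fintype κ] (φ : κ → H) :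
    ∃ W : MatrixMeasure κ, W.IsPositive ∧ (∀ᵐ x ∂W.base, |x| ≤ ‖T‖) ∧
      ∀ f : ℝ → ℝ, Continuous f → ∀ p q,
        ∫ x, (f x : ℂ) * W.density x p q ∂W.base = ⟪φ p, cfc f T (φ q)⟫_ℂ := by
  classical
  choose μ hfin hsupp hμ using hT.exists_scalar_spectral_measure
  have hsymm : ∀ f : ℝ → ℝ, ∀ u v, ⟪cfc f T u, v⟫_ℂ = ⟪u, cfc f T v⟫_ℂ := fun f u v => by
    have h := cfc_predicate f T
    rw [← ContinuousLinearMap.adjoint_inner_right, h.adjoint_eq]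
  have hμC : ∀ f : ℝ → ℝ, Continuous f → ∀ v, ∫ x, (f x : ℂ) ∂(μ v) = ⟪v, cfc f T v⟫_ℂ := by
    intro f hf v
    rw [integral_complex_ofReal, hμ v f hf]
    refine Complex.conj_eq_iff_re.1 ?_
    rw [inner_conj_symm, hsymm]
  have hext : ∀ (ν₁ ν₂ : Measure ℝ) [IsFiniteMeasure ν₁] [IsFiniteMeasure ν₂],
      (∀ f : ℝ → ℝ, Continuous f → ∫ x, f x ∂ν₁ = ∫ x, f x ∂ν₂) → ν₁ = ν₂ := fun ν₁ ν₂ _ _ h =>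
    ext_of_forall_integral_eq_of_IsFiniteMeasure fun f => h f f.continuous
  have hintR : ∀ v (f : ℝ → ℝ), Continuous f → Integrable f (μ v) := fun v f hf => by
    have h1 := Continuous.integrable_mul_of_ae_le (μ := μ v) (g := fun _ => 1)
      (integrable_const _) ((hsupp v).mono fun x hx hx' => absurd hx (not_le.2 hx'))
      (f := fun x => (f x : ℂ)) (by fun_prop)
    simpa using h1.re
  -- parallelogram law and homogeneity of the scalar measures
  have hpar : ∀ u v, μ (u + v) + μ (u - v) = (2 : NNReal) • (μ u + μ v) := by
    intro u v
    refine hext _ _ fun f hf => ?_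
    rw [integral_add_measure (hintR _ f hf) (hintR _ f hf), integral_smul_nnreal_measure,
      integral_add_measure (hintR _ f hf) (hintR _ f hf), hμ _ f hf, hμ _ f hf, hμ _ f hf,
      hμ _ f hf]
    simp only [map_add, map_sub, inner_add_left, inner_add_right, inner_sub_left, inner_sub_right,
      Complex.add_re, Complex.sub_re, NNReal.smul_def, NNReal.coe_ofNat, smul_eq_mul]
    ring
  have hsmul : ∀ (c : ℂ) v, μ (c • v) = (‖c‖₊ ^ 2) • μ v := by
    intro c v
    refine hext _ _ fun f hf => ?_
    rw [integral_smul_nnreal_measure, hμ _ f hf, hμ _ f hf, map_smul, inner_smul_left,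
      inner_smul_right, ← mul_assoc, Complex.conj_mul', NNReal.smul_def, ← Complex.ofReal_pow,
      Complex.re_ofReal_mul]
    simp
  let base : Measure ℝ := Measure.sum fun p => μ (φ p)
  have hbfin : IsFiniteMeasure base := by
    refine ⟨?_⟩
    simp only [base, Measure.sum_apply _ MeasurableSet.univ, tsum_fintype]
    exact ENNReal.sum_lt_top.2 fun p _ => measure_lt_top _ _
  have hbsupp : ∀ᵐ x ∂base, |x| ≤ ‖T‖ := by
    rw [Measure.ae_sum_iff]
    exact fun p => hsupp _
  -- the vectors whose spectral measure has a density with respect to `base`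
  let M : Submodule ℂ H :=
    { carrier := {v | μ v ≪ base}
      add_mem' := fun {u v} hu hv => by
        have h1 : μ (u + v) ≤ (2 : NNReal) • (μ u + μ v) := by
          rw [← hpar]; exact Measure.le_add_right le_rfl
        refine h1.absolutelyContinuous.trans (Measure.AbsolutelyContinuous.smul_left ?_ _)
        exact Measure.AbsolutelyContinuous.add_left_iff.2 ⟨hu, hv⟩
      zero_mem' := by
        have h := hsmul 0 0
        simp only [smul_zero, nnnorm_zero, ne_eq, OfNat.ofNat_ne_zero, not_false_eq_true,
          zero_pow, zero_smul] at h
        change μ 0 ≪ base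
        rw [h]
        exact Measure.AbsolutelyContinuous.zero _
      smul_mem' := fun c v hv => by
        change μ (c • v) ≪ base
        rw [hsmul]
        exact Measure.AbsolutelyContinuous.smul_left hv _ }
  have hφM : ∀ p, φ p ∈ M := fun p => Measure.absolutelyContinuous_sum_right p
    Measure.AbsolutelyContinuous.rfl
  let r : H → ℝ → ℂ := fun v x => (((μ v).rnDeriv base x).toReal : ℂ)
  have hrmeas : ∀ v, Measurable (r v) := fun v =>
    Complex.measurable_ofReal.comp (Measure.measurable_rnDeriv _ _).ennreal_toReal
  have hrint : ∀ v, Integrable (r v) base := fun v => Measure.integrable_toReal_rnDeriv.ofReal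
  have hr : ∀ v ∈ M, ∀ f : ℝ → ℝ, Continuous f →
      ∫ x, (f x : ℂ) * r v x ∂base = ⟪v, cfc f T v⟫_ℂ := by
    intro v hv f hf
    rw [← hμC f hf, ← integral_rnDeriv_smul (show μ v ≪ base from hv)]
    refine integral_congr_ae (Filter.Eventually.of_forall fun x => ?_)
    simp [r, mul_comm]
  have hi : ∀ {g : ℝ → ℂ}, Integrable g base → ∀ f : ℝ → ℝ, Continuous f →
      Integrable (fun x => (f x : ℂ) * g x) base := fun hg f hf =>
    Continuous.integrable_mul_of_ae_le (f := fun x => (f x : ℂ)) hg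
      (hbsupp.mono fun x hx hx' => absurd hx (not_le.2 hx')) (by fun_prop)
  let ρ : ℝ → Matrix κ κ ℂ := fun x => Matrix.of fun p q =>
    (r (φ q + φ p) x - r (φ q - φ p) x + Complex.I * r (φ q + Complex.I • φ p) x
      - Complex.I * r (φ q - Complex.I • φ p) x) / 4
  have hρmeas : ∀ p q, Measurable fun x => ρ x p q := fun p q => by
    simp only [ρ, Matrix.of_apply]
    have := hrmeas
    fun_prop
  have hρint : ∀ p q, Integrable (fun x => ρ x p q) base := fun p q => by
    simp only [ρ, Matrix.of_apply]
    exact ((((hrint _).sub (hrint _)).add ((hrint _).const_mul _)).sub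
      ((hrint _).const_mul _)).div_const _
  have hρ : ∀ p q, ∀ f : ℝ → ℝ, Continuous f →
      ∫ x, (f x : ℂ) * ρ x p q ∂base = ⟪φ p, cfc f T (φ q)⟫_ℂ := by
    intro p q f hf
    have h1 := hr _ (M.add_mem (hφM q) (hφM p)) f hf
    have h2 := hr _ (M.sub_mem (hφM q) (hφM p)) f hf
    have h3 := hr _ (M.add_mem (hφM q) (M.smul_mem Complex.I (hφM p))) f hf
    have h4 := hr _ (M.sub_mem (hφM q) (M.smul_mem Complex.I (hφM p))) f hf
    have hpol := inner_map_polarization (cfc f T : H →L[ℂ] H).toLinearMap (φ q) (φ p)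
    simp only [ContinuousLinearMap.coe_coe, hsymm] at hpol
    rw [hpol, ← h1, ← h2, ← h3, ← h4]
    have e : ∀ x, (f x : ℂ) * ρ x p q = ((f x : ℂ) * r (φ q + φ p) x
        - (f x : ℂ) * r (φ q - φ p) x + Complex.I * ((f x : ℂ) * r (φ q + Complex.I • φ p) x)
        - Complex.I * ((f x : ℂ) * r (φ q - Complex.I • φ p) x)) / 4 := fun x => by
      simp only [ρ, Matrix.of_apply]; ring
    simp_rw [e]
    have hi' := fun v => hi (hrint v) f hf
    have hA : Integrable (fun x => (f x : ℂ) * r (φ q + φ p) x - (f x : ℂ) * r (φ q - φ p) x)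
        base := (hi' _).sub (hi' _)
    have hB : Integrable (fun x => (f x : ℂ) * r (φ q + φ p) x - (f x : ℂ) * r (φ q - φ p) x
        + Complex.I * ((f x : ℂ) * r (φ q + Complex.I • φ p) x)) base :=
      hA.add ((hi' _).const_mul _)
    rw [integral_div, integral_sub hB ((hi' _).const_mul _), integral_add hA ((hi' _).const_mul _),
      integral_sub (hi' _) (hi' _), integral_const_mul, integral_const_mul]
  have hherm : ∀ᵐ x ∂base, (ρ x).IsHermitian := by
    have : ∀ p q, (fun x => star (ρ x q p)) =ᵐ[base] fun x => ρ x p q := by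
      intro p q
      refine ae_eq_of_integral_continuous_mul_eq ?_ (hρint p q) hbsupp fun f hf => ?_
      · exact (Complex.conjCLE.toContinuousLinearMap.integrable_comp (hρint q p))
      · rw [hρ p q f hf, ← hsymm, ← inner_conj_symm, ← hρ q p f hf, ← integral_conj]
        simp
    have h2 : ∀ᵐ x ∂base, ∀ p q, star (ρ x q p) = ρ x p q :=
      ae_all_iff.2 fun p => ae_all_iff.2 fun q => this p q
    filter_upwards [h2] with x hx
    ext p q
    exact hx p q
  -- `v* ρ v` is the density of the spectral measure at `∑ v p φ p`, for one `v` at a time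
  have hpos : ∀ v : κ → ℂ, ∀ᵐ x ∂base, 0 ≤ star v ⬝ᵥ (ρ x *ᵥ v) := by
    intro v
    have e : ∀ x, star v ⬝ᵥ (ρ x *ᵥ v) = ∑ p, ∑ q, (star (v p) * v q) * ρ x p q := fun x => by
      simp only [dotProduct, Matrix.mulVec, Pi.star_apply, Finset.mul_sum]
      exact Finset.sum_congr rfl fun p _ => Finset.sum_congr rfl fun q _ => by ring
    have hM : ∑ p, v p • φ p ∈ M := M.sum_mem fun p _ => M.smul_mem _ (hφM p)
    have : (fun x => star v ⬝ᵥ (ρ x *ᵥ v)) =ᵐ[base] r (∑ p, v p • φ p) := by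
      refine ae_eq_of_integral_continuous_mul_eq ?_ (hrint _) hbsupp fun f hf => ?_
      · simp_rw [e]
        exact integrable_finsetSum _ fun p _ => integrable_finsetSum _ fun q _ =>
          (hρint p q).const_mul _
      · rw [hr _ hM f hf]
        have e' : ∀ x, (f x : ℂ) * (star v ⬝ᵥ (ρ x *ᵥ v)) =
            ∑ p, ∑ q, (star (v p) * v q) * ((f x : ℂ) * ρ x p q) := fun x => by
          rw [e, Finset.mul_sum]
          refine Finset.sum_congr rfl fun p _ => ?_
          rw [Finset.mul_sum]
          exact Finset.sum_congr rfl fun q _ => by ring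
        simp_rw [e']
        have hi' := fun p q => (hi (hρint p q) f hf).const_mul (star (v p) * v q)
        rw [integral_finsetSum _ fun p _ => integrable_finsetSum _ fun q _ => hi' p q]
        simp_rw [integral_finsetSum _ fun q _ => hi' _ q, integral_const_mul, hρ _ _ f hf]
        rw [map_sum, sum_inner]
        refine Finset.sum_congr rfl fun p _ => ?_
        rw [inner_sum]
        refine Finset.sum_congr rfl fun q _ => ?_
        rw [map_smul, inner_smul_left, inner_smul_right, ← mul_assoc]
        rfl
    filter_upwards [this] with x hx
    rw [hx]
    exact Complex.zero_le_real.2 ENNReal.toReal_nonneg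
  -- a countable dense set of vectors suffices
  have hpsd : ∀ᵐ x ∂base, (ρ x).PosSemidef := by
    have h1 : ∀ᵐ x ∂base, ∀ n, 0 ≤ star (TopologicalSpace.denseSeq (κ → ℂ) n) ⬝ᵥ
        (ρ x *ᵥ TopologicalSpace.denseSeq (κ → ℂ) n) := ae_all_iff.2 fun n => hpos _
    filter_upwards [h1, hherm] with x hx hx'
    refine Matrix.PosSemidef.of_dotProduct_mulVec_nonneg hx' fun v => ?_
    have hcl : IsClosed {v : κ → ℂ | 0 ≤ star v ⬝ᵥ (ρ x *ᵥ v)} := by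
      refine isClosed_le continuous_const ?_
      simp only [dotProduct, Matrix.mulVec]
      fun_prop
    have hd := (TopologicalSpace.denseRange_denseSeq (κ → ℂ)).closure_range
    have hsub := hcl.closure_subset_iff.2 (Set.range_subset_iff.2 hx)
    exact hsub (hd ▸ Set.mem_univ v)
  -- the density is changed on a null set, to be positive everywhere
  let N : Set ℝ := toMeasurable base {x | ¬ (ρ x).PosSemidef}
  have hN : ∀ᵐ x ∂base, x ∉ N := by
    have : base N = 0 := by rw [measure_toMeasurable]; exact hpsd
    exact measure_eq_zero_iff_ae_notMem.1 this
  let ρ' : ℝ → Matrix κ κ ℂ := fun x => open Classical in if x ∈ N then 0 else ρ x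
  have hae : ∀ᵐ x ∂base, ρ' x = ρ x := by
    filter_upwards [hN] with x hx
    simp [ρ', hx]
  refine ⟨⟨base, hbfin, ρ', fun p q => ?_, fun p q => ?_⟩, fun x => ?_, hbsupp,
    fun f hf p q => ?_⟩
  · have : (fun x => ρ' x p q) = fun x => open Classical in if x ∈ N then 0 else ρ x p q := by
      funext x
      simp only [ρ']
      split_ifs <;> rfl
    rw [this]
    exact Measurable.ite (measurableSet_toMeasurable _ _) measurable_const (hρmeas p q)
  · exact (hρint p q).congr (hae.mono fun x hx => by simp only [hx])
  · by_cases hx : x ∈ N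
    · simp only [ρ', hx, if_true]
      exact Matrix.PosSemidef.zero
    · simp only [ρ', hx, if_false]
      by_contra h
      exact hx (subset_toMeasurable _ _ h)
  · rw [← hρ p q f hf]
    exact integral_congr_ae (hae.mono fun x hx => by simp only [hx])

/-- A symmetric operator whose moments grow at most like `K ^ k` is bounded by `K`: the numbers
`‖T ^ n v‖` are log-convex, so that a ratio above `K` would persist. -/
theorem LinearMap.IsSymmetric.norm_apply_le_of_moments {E : Type*} [NormedAddCommGroup E]
    [InnerProductSpace ℂ E] {T : E →ₗ[ℂ] E} (hT : T.IsSymmetric) {K : ℝ} (hK : 0 < K)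
    (v : E) {C : ℝ} (hC : ∀ k, ‖⟪v, (T ^ k) v⟫_ℂ‖ ≤ C * K ^ k) : ‖T v‖ ≤ K * ‖v‖ := by
  by_contra! h
  have hmove : ∀ m (x y : E), ⟪(T ^ m) x, y⟫_ℂ = ⟪x, (T ^ m) y⟫_ℂ := fun m x y => hT.pow m x y
  have h0 : 0 < ‖v‖ := by
    rcases (norm_nonneg v).eq_or_lt with h0 | h0
    · rw [norm_eq_zero.1 h0.symm] at h
      simp at h
    · exact h0
  set q := ‖T v‖ / ‖v‖ with hq
  have hqK : K < q := by rwa [hq, lt_div_iff₀ h0]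
  have hq0 : 0 < q := hK.trans hqK
  have step : ∀ n, 0 < ‖(T ^ n) v‖ ∧ q * ‖(T ^ n) v‖ ≤ ‖(T ^ (n + 1)) v‖ := by
    intro n
    induction n with
    | zero => exact ⟨by simpa using h0, by simp [hq, h0.ne']⟩
    | succ n ih =>
      have hpos : 0 < ‖(T ^ (n + 1)) v‖ := (mul_pos hq0 ih.1).trans_le ih.2
      refine ⟨hpos, ?_⟩
      have hcs : ‖(T ^ (n + 1)) v‖ * ‖(T ^ (n + 1)) v‖ ≤ ‖(T ^ n) v‖ * ‖(T ^ (n + 2)) v‖ := by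
        have e : ⟪(T ^ (n + 1)) v, (T ^ (n + 1)) v⟫_ℂ = ⟪(T ^ n) v, (T ^ (n + 2)) v⟫_ℂ := by
          rw [hmove, hmove, ← Module.End.mul_apply, ← Module.End.mul_apply, ← pow_add, ← pow_add]
          congr 3
          omega
        have h2 := norm_inner_le_norm (𝕜 := ℂ) ((T ^ n) v) ((T ^ (n + 2)) v)
        rw [← e, inner_self_eq_norm_sq_to_K] at h2
        simpa [sq] using h2
      have h3 : q * ‖(T ^ (n + 1)) v‖ * ‖(T ^ n) v‖ ≤ ‖(T ^ (n + 2)) v‖ * ‖(T ^ n) v‖ := by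
        calc _ = ‖(T ^ (n + 1)) v‖ * (q * ‖(T ^ n) v‖) := by ring
          _ ≤ ‖(T ^ (n + 1)) v‖ * ‖(T ^ (n + 1)) v‖ := by gcongr; exact ih.2
          _ ≤ _ := by rw [mul_comm ‖(T ^ (n + 2)) v‖]; exact hcs
      exact le_of_mul_le_mul_right h3 ih.1
  have grow : ∀ n, q ^ n * ‖v‖ ≤ ‖(T ^ n) v‖ := by
    intro n
    induction n with
    | zero => simp
    | succ n ih =>
      calc q ^ (n + 1) * ‖v‖ = q * (q ^ n * ‖v‖) := by ring
        _ ≤ q * ‖(T ^ n) v‖ := by gcongr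
        _ ≤ _ := (step n).2
  have bound : ∀ n, ((q / K) ^ 2) ^ n ≤ C / ‖v‖ ^ 2 := by
    intro n
    have h1 : (q ^ n * ‖v‖) ^ 2 ≤ C * K ^ (2 * n) := by
      calc (q ^ n * ‖v‖) ^ 2 ≤ ‖(T ^ n) v‖ ^ 2 := by gcongr; exact grow n
        _ = ‖⟪v, (T ^ (2 * n)) v⟫_ℂ‖ := by
          rw [two_mul, pow_add, Module.End.mul_apply, ← hmove, inner_self_eq_norm_sq_to_K]
          simp
        _ ≤ _ := hC _
    rw [le_div_iff₀ (by positivity), ← pow_mul, div_pow, div_mul_eq_mul_div,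
      div_le_iff₀ (by positivity)]
    calc _ = (q ^ n * ‖v‖) ^ 2 := by ring
      _ ≤ _ := h1
  have hgt : 1 < (q / K) ^ 2 := one_lt_pow₀ ((one_lt_div hK).2 hqK) two_ne_zero
  obtain ⟨n, hn⟩ := pow_unbounded_of_one_lt (C / ‖v‖ ^ 2) hgt
  exact absurd (bound n) (not_le.2 hn)

/-- A symmetric operator on an inner product space whose moments grow at most exponentially is
bounded, so that its extension to the completion is a self-adjoint bounded operator, and its moments
are those of a positive matrix measure. -/
theorem LinearMap.IsSymmetric.exists_matrix_spectral_measure {E : Type*} [NormedAddCommGroup E]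
    [InnerProductSpace ℂ E] {T : E →ₗ[ℂ] E} (hT : T.IsSymmetric) {K : ℝ} (hK : 0 < K)
    (hC : ∀ v, ∃ C : ℝ, ∀ k, ‖⟪v, (T ^ k) v⟫_ℂ‖ ≤ C * K ^ k)
    {κ : Type*} [Fintype κ] (φ : κ → E) :
    ∃ W : MatrixMeasure κ, W.IsPositive ∧ (∀ᵐ x ∂W.base, |x| ≤ K) ∧
      ∀ (k : ℕ) p q, ∫ x : ℝ, (x : ℂ) ^ k * W.density x p q ∂W.base = ⟪φ p, (T ^ k) (φ q)⟫_ℂ := by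
  have hbd : ∀ v, ‖T v‖ ≤ K * ‖v‖ := fun v =>
    (hC v).elim fun C h => hT.norm_apply_le_of_moments hK v h
  let S : UniformSpace.Completion E →L[ℂ] UniformSpace.Completion E :=
    (T.mkContinuous K hbd).completion
  have hS : ∀ v : E, S v = (T v : E) := fun v =>
    ContinuousLinearMap.completion_apply_coe (T.mkContinuous K hbd) v
  have hSpow : ∀ (k : ℕ) (v : E), (S ^ k) v = ((T ^ k) v : E) := by
    intro k
    induction k with
    | zero => intro v; simp
    | succ k ih => intro v; rw [pow_succ, pow_succ, mul_apply_eq_comp,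
        Module.End.mul_apply, hS, ih]
  have hSnorm : ‖S‖ ≤ K := by
    refine S.opNorm_le_bound hK.le fun x => ?_
    refine UniformSpace.Completion.induction_on x
      (isClosed_le (by fun_prop) (by fun_prop)) fun v => ?_
    rw [hS, UniformSpace.Completion.norm_coe, UniformSpace.Completion.norm_coe]
    exact hbd v
  have hSsa : IsSelfAdjoint S := by
    rw [ContinuousLinearMap.isSelfAdjoint_iff_isSymmetric]
    intro x y
    refine UniformSpace.Completion.induction_on₂ x y
      (isClosed_eq (by simp only [ContinuousLinearMap.coe_coe]; fun_prop)
        (by simp only [ContinuousLinearMap.coe_coe]; fun_prop)) fun v u => ?_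
    simp only [ContinuousLinearMap.coe_coe, hS, UniformSpace.Completion.inner_coe]
    exact hT v u
  obtain ⟨W, hW, hWs, hWm⟩ :=
    hSsa.exists_matrix_spectral_measure fun p => (φ p : UniformSpace.Completion E)
  refine ⟨W, hW, hWs.mono fun x hx => hx.trans hSnorm, fun k p q => ?_⟩
  have := hWm (fun x => x ^ k) (by fun_prop) p q
  rw [cfc_pow_id S k, hSpow, UniformSpace.Completion.inner_coe] at this
  rw [← this]
  simp

/-! ### Block tridiagonal matrices on the integers -/

section Tridiagonal

variable {ι : Type*} [Fintype ι]

/-- The block tridiagonal matrix as an operator on finitely supported vectors. -/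
def tridiag (a b c : ℤ → Matrix ι ι ℂ) : Module.End ℂ (ℤ →₀ (ι → ℂ)) :=
  Finsupp.lsum ℂ fun n => Finsupp.lsingle (n + 1) ∘ₗ (a n).mulVecLin
    + Finsupp.lsingle n ∘ₗ (b n).mulVecLin + Finsupp.lsingle (n - 1) ∘ₗ (c n).mulVecLin

variable (a b c : ℤ → Matrix ι ι ℂ)

theorem tridiag_single (n : ℤ) (u : ι → ℂ) : tridiag a b c (Finsupp.single n u) =
    Finsupp.single (n + 1) (a n *ᵥ u) + Finsupp.single n (b n *ᵥ u)
      + Finsupp.single (n - 1) (c n *ᵥ u) := by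
  simp [tridiag]

theorem tridiag_apply (φ : ℤ →₀ (ι → ℂ)) (j : ℤ) : tridiag a b c φ j =
    a (j - 1) *ᵥ φ (j - 1) + b j *ᵥ φ j + c (j + 1) *ᵥ φ (j + 1) := by
  induction φ using Finsupp.induction_linear with
  | zero => simp
  | add f g hf hg =>
    simp only [map_add, Finsupp.add_apply, hf, hg, Matrix.mulVec_add]
    abel
  | single n u =>
    have h1 : n + 1 = j ↔ n = j - 1 := by omega
    have h2 : n - 1 = j ↔ n = j + 1 := by omega
    rw [tridiag_single]
    simp only [Finsupp.add_apply, Finsupp.single_apply, h1, h2]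
    by_cases h3 : n = j - 1
    · subst h3
      simp [show j - 1 ≠ j + 1 by omega]
    · by_cases h4 : n = j
      · subst h4
        simp [show ¬ n = n - 1 by omega]
      · by_cases h5 : n = j + 1
        · subst h5
          simp [show j + 1 ≠ j - 1 by omega]
        · simp [h3, h4, h5]

variable [DecidableEq ι]

/-- The block `(j, i)` of the `k`-th power of the block tridiagonal matrix whose column `n` has the
entries `c n`, `b n`, `a n` in the rows `n - 1`, `n`, `n + 1`. -/
def triPow (a b c : ℤ → Matrix ι ι ℂ) : ℕ → ℤ → ℤ → Matrix ι ι ℂ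
  | 0, j, i => if j = i then 1 else 0
  | k + 1, j, i => a (j - 1) * triPow a b c k (j - 1) i + b j * triPow a b c k j i
      + c (j + 1) * triPow a b c k (j + 1) i

theorem TridiagonalCTOQW.blockPow_eq_triPow {d : ℕ} (w : TridiagonalCTOQW d) (k : ℕ) (j i : ℤ) :
    w.blockPow k j i = triPow (fun n => rep (w.A n)) w.diag (fun n => rep (w.C n)) k j i := by
  induction k generalizing j with
  | zero => rfl
  | succ k ih => simp only [TridiagonalCTOQW.blockPow, triPow, ih]

theorem tridiag_pow_single_apply (k : ℕ) (j i : ℤ) (u : ι → ℂ) :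
    (tridiag a b c ^ k) (Finsupp.single i u) j = triPow a b c k j i *ᵥ u := by
  induction k generalizing j with
  | zero =>
    simp only [pow_zero, Module.End.one_apply, triPow, Finsupp.single_apply, eq_comm (a := j)]
    split_ifs <;> simp
  | succ k ih =>
    rw [pow_succ', Module.End.mul_apply, tridiag_apply, ih, ih, ih]
    simp only [triPow, Matrix.add_mulVec, Matrix.mulVec_mulVec]

theorem Matrix.ext_mulVec {M N : Matrix ι ι ℂ} (h : ∀ u, M *ᵥ u = N *ᵥ u) : M = N :=
  Matrix.toLin'.injective (LinearMap.ext fun u => by simpa using h u)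

theorem triPow_succ_right (k : ℕ) (j i : ℤ) : triPow a b c (k + 1) j i =
    triPow a b c k j (i + 1) * a i + triPow a b c k j i * b i + triPow a b c k j (i - 1) * c i := by
  refine Matrix.ext_mulVec fun u => ?_
  rw [← tridiag_pow_single_apply, pow_succ, Module.End.mul_apply, tridiag_single, map_add, map_add,
    Finsupp.add_apply, Finsupp.add_apply, tridiag_pow_single_apply, tridiag_pow_single_apply,
    tridiag_pow_single_apply]
  simp only [Matrix.add_mulVec, Matrix.mulVec_mulVec]

open scoped Matrix.Norms.L2Operator in
theorem norm_triPow_le {K : ℝ} (ha : ∀ n, ‖a n‖ ≤ K) (hb : ∀ n, ‖b n‖ ≤ K) (hc : ∀ n, ‖c n‖ ≤ K)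
    (k : ℕ) (j i : ℤ) : ‖triPow a b c k j i‖ ≤ ‖(1 : Matrix ι ι ℂ)‖ * (3 * K) ^ k := by
  have hK : 0 ≤ K := (norm_nonneg _).trans (ha 0)
  induction k generalizing j with
  | zero =>
    simp only [triPow, pow_zero, mul_one]
    split_ifs <;> simp
  | succ k ih =>
    have h : ∀ (x y : Matrix ι ι ℂ), ‖x‖ ≤ K → ‖y‖ ≤ ‖(1 : Matrix ι ι ℂ)‖ * (3 * K) ^ k →
        ‖x * y‖ ≤ K * (‖(1 : Matrix ι ι ℂ)‖ * (3 * K) ^ k) := fun x y hx hy =>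
      (norm_mul_le _ _).trans (mul_le_mul hx hy (norm_nonneg _) hK)
    calc _ ≤ _ := norm_add₃_le
      _ ≤ _ := add_le_add (add_le_add (h _ _ (ha _) (ih _)) (h _ _ (hb _) (ih _)))
          (h _ _ (hc _) (ih _))
      _ = _ := by ring

/-- The family `a` with its value at `n₀` replaced by `0`, that is, with the jump from `n₀`
removed. The edge between `-1` and `0` is removed by `cutAt (-1)` for the jumps to the right and
by `cutAt 0` for those to the left. -/
abbrev cutAt {ι : Type*} (n₀ : ℤ) (a : ℤ → Matrix ι ι ℂ) : ℤ → Matrix ι ι ℂ :=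
  Function.update a n₀ 0

theorem cutAt_of_ne {ι : Type*} {a : ℤ → Matrix ι ι ℂ} {n₀ n : ℤ} (h : n ≠ n₀) :
    cutAt n₀ a n = a n :=
  Function.update_of_ne h _ _

/-- Without the edge between `-1` and `0`, the nonnegative and the negative sites do not
communicate. -/
theorem triPow_cutAt_eq_zero (k : ℕ) {j i : ℤ} (h : ¬ (0 ≤ j ↔ 0 ≤ i)) :
    triPow (cutAt (-1) a) b (cutAt 0 c) k j i = 0 := by
  induction k generalizing j with
  | zero =>
    have : j ≠ i := by rintro rfl; exact h Iff.rfl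
    simp [triPow, this]
  | succ k ih =>
    rw [triPow, ih h]
    have h1 : cutAt (-1) a (j - 1) * triPow (cutAt (-1) a) b (cutAt 0 c) k (j - 1) i = 0 := by
      by_cases hj : j = 0
      · simp [hj, cutAt]
      · rw [ih (by omega), mul_zero]
    have h2 : cutAt 0 c (j + 1) * triPow (cutAt (-1) a) b (cutAt 0 c) k (j + 1) i = 0 := by
      by_cases hj : j = -1
      · simp [hj, cutAt]
      · rw [ih (by omega), mul_zero]
    rw [h1, h2]
    simp

/-- The Duhamel formula for powers. -/
theorem pow_succ_eq_add_sum_antidiagonal {R : Type*} [Ring R] (x y : R) (n : ℕ) :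
    x ^ (n + 1) = y ^ (n + 1)
      + ∑ p ∈ Finset.HasAntidiagonal.antidiagonal n, y ^ p.1 * (x - y) * x ^ p.2 := by
  induction n with
  | zero => simp
  | succ n ih =>
    rw [Finset.Nat.sum_antidiagonal_succ, pow_succ' y (n + 1)]
    have : ∀ p : ℕ × ℕ, y ^ (p.1 + 1) * (x - y) * x ^ p.2 = y * (y ^ p.1 * (x - y) * x ^ p.2) :=
      fun p => by rw [pow_succ']; noncomm_ring
    simp only [this, ← Finset.mul_sum]
    rw [add_left_comm, ← mul_add, ← ih, pow_succ' x (n + 1)]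
    simp [sub_mul]

/-- Paths decomposed at their last passage of the edge between `-1` and `0`. -/
theorem triPow_succ_eq_cutAt (n : ℕ) (j i : ℤ) : triPow a b c (n + 1) j i =
    triPow (cutAt (-1) a) b (cutAt 0 c) (n + 1) j i + ∑ p ∈ Finset.HasAntidiagonal.antidiagonal n,
      (triPow (cutAt (-1) a) b (cutAt 0 c) p.1 j 0 * a (-1) * triPow a b c p.2 (-1) i
        + triPow (cutAt (-1) a) b (cutAt 0 c) p.1 j (-1) * c 0 * triPow a b c p.2 0 i) := by
  have hV : ∀ φ, (tridiag a b c - tridiag (cutAt (-1) a) b (cutAt 0 c)) φ =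
      Finsupp.single 0 (a (-1) *ᵥ φ (-1)) + Finsupp.single (-1) (c 0 *ᵥ φ 0) := by
    intro φ
    ext1 j
    rw [LinearMap.sub_apply, Finsupp.sub_apply, tridiag_apply, tridiag_apply, Finsupp.add_apply]
    by_cases h0 : j = 0
    · subst h0
      simp [cutAt, Function.update_of_ne]
    · by_cases h1 : j = -1
      · subst h1
        simp [cutAt, Function.update_of_ne]
      · rw [cutAt_of_ne (by omega), cutAt_of_ne (by omega),
          Finsupp.single_eq_of_ne h0, Finsupp.single_eq_of_ne h1]
        simp
  refine Matrix.ext_mulVec fun u => ?_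
  rw [← tridiag_pow_single_apply, pow_succ_eq_add_sum_antidiagonal _
    (tridiag (cutAt (-1) a) b (cutAt 0 c)), LinearMap.add_apply, Finsupp.add_apply,
    tridiag_pow_single_apply, Matrix.add_mulVec, Matrix.sum_mulVec, LinearMap.sum_apply,
    Finsupp.finsetSum_apply]
  congr 1
  refine Finset.sum_congr rfl fun p _ => ?_
  rw [Module.End.mul_apply, Module.End.mul_apply, hV, map_add, Finsupp.add_apply,
    tridiag_pow_single_apply, tridiag_pow_single_apply, tridiag_pow_single_apply,
    tridiag_pow_single_apply]
  simp only [Matrix.add_mulVec, Matrix.mulVec_mulVec, mul_assoc]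

end Tridiagonal

/-! ### Resolvent blocks -/

section Resolvent

open scoped Matrix.Norms.L2Operator

variable {ι : Type*} [Fintype ι] [DecidableEq ι] (a b c : ℤ → Matrix ι ι ℂ)

/-- The block `(j, i)` of the Neumann series `∑ L ^ k / w ^ (k + 1)` of the resolvent `(w - L)⁻¹`
of a block tridiagonal matrix `L`. -/
def resolventBlock (w : ℂ) (j i : ℤ) : Matrix ι ι ℂ :=
  ∑' k : ℕ, w⁻¹ ^ (k + 1) • triPow a b c k j i

variable {a b c}

theorem summable_norm_resolventBlock {K : ℝ} (ha : ∀ n, ‖a n‖ ≤ K) (hb : ∀ n, ‖b n‖ ≤ K)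
    (hc : ∀ n, ‖c n‖ ≤ K) {w : ℂ} (hw : 3 * K < ‖w‖) (j i : ℤ) :
    Summable fun k : ℕ => ‖w⁻¹ ^ (k + 1) • triPow a b c k j i‖ := by
  have hK : 0 ≤ K := (norm_nonneg _).trans (ha 0)
  have hw0 : 0 < ‖w‖ := lt_of_le_of_lt (by positivity) hw
  have hq : 3 * K / ‖w‖ < 1 := (div_lt_one hw0).2 hw
  refine Summable.of_nonneg_of_le (fun _ => norm_nonneg _) (fun k => ?_)
    ((summable_geometric_of_lt_one (by positivity) hq).mul_left
      (‖w‖⁻¹ * ‖(1 : Matrix ι ι ℂ)‖))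
  rw [norm_smul, norm_pow, norm_inv]
  calc _ ≤ ‖w‖⁻¹ ^ (k + 1) * (‖(1 : Matrix ι ι ℂ)‖ * (3 * K) ^ k) := by
        gcongr
        exact norm_triPow_le a b c ha hb hc k j i
    _ = _ := by rw [div_pow, inv_pow, pow_succ]; field_simp

theorem norm_cutAt_le {K : ℝ} (ha : ∀ n, ‖a n‖ ≤ K) (n₀ n : ℤ) : ‖cutAt n₀ a n‖ ≤ K := by
  by_cases h : n = n₀
  · subst h
    simpa using (norm_nonneg _).trans (ha n)
  · rw [cutAt_of_ne h]
    exact ha n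

/-- The second resolvent identity for the removal of the edge between `-1` and `0`. -/
theorem resolventBlock_eq_cutAt {K : ℝ} (ha : ∀ n, ‖a n‖ ≤ K) (hb : ∀ n, ‖b n‖ ≤ K)
    (hc : ∀ n, ‖c n‖ ≤ K) {w : ℂ} (hw : 3 * K < ‖w‖) (j i : ℤ) :
    resolventBlock a b c w j i = resolventBlock (cutAt (-1) a) b (cutAt 0 c) w j i
      + (resolventBlock (cutAt (-1) a) b (cutAt 0 c) w j 0 * a (-1) * resolventBlock a b c w (-1) i
      + resolventBlock (cutAt (-1) a) b (cutAt 0 c) w j (-1) * c 0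
        * resolventBlock a b c w 0 i) := by
  have hs := summable_norm_resolventBlock ha hb hc hw
  have hs0 := summable_norm_resolventBlock (norm_cutAt_le ha (-1)) hb (norm_cutAt_le hc 0) hw
  -- Cauchy products of the two Neumann series
  have hprod : ∀ (s : ℤ) (x : Matrix ι ι ℂ) (r : ℤ),
      (Summable fun n : ℕ => ∑ p ∈ Finset.HasAntidiagonal.antidiagonal n,
        w⁻¹ ^ (n + 2) • (triPow (cutAt (-1) a) b (cutAt 0 c) p.1 j s * x
          * triPow a b c p.2 r i)) ∧
      resolventBlock (cutAt (-1) a) b (cutAt 0 c) w j s * x * resolventBlock a b c w r i =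
      ∑' n : ℕ, ∑ p ∈ Finset.HasAntidiagonal.antidiagonal n,
        w⁻¹ ^ (n + 2) • (triPow (cutAt (-1) a) b (cutAt 0 c) p.1 j s * x
          * triPow a b c p.2 r i) := by
    intro s x r
    have h1 : Summable fun k : ℕ =>
        ‖w⁻¹ ^ (k + 1) • triPow (cutAt (-1) a) b (cutAt 0 c) k j s * x‖ :=
      Summable.of_nonneg_of_le (fun _ => norm_nonneg _) (fun k => norm_mul_le _ _)
        ((hs0 j s).mul_right ‖x‖)
    have e : ∀ n : ℕ, ∑ p ∈ Finset.HasAntidiagonal.antidiagonal n,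
        w⁻¹ ^ (n + 2) • (triPow (cutAt (-1) a) b (cutAt 0 c) p.1 j s * x
          * triPow a b c p.2 r i) = ∑ p ∈ Finset.HasAntidiagonal.antidiagonal n,
        (w⁻¹ ^ (p.1 + 1) • triPow (cutAt (-1) a) b (cutAt 0 c) p.1 j s * x)
          * (w⁻¹ ^ (p.2 + 1) • triPow a b c p.2 r i) := fun n => by
      refine Finset.sum_congr rfl fun p hp => ?_
      rw [← Finset.HasAntidiagonal.mem_antidiagonal.1 hp, Matrix.smul_mul, Matrix.smul_mul,
        Matrix.mul_smul, smul_smul, ← pow_add]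
      congr 2
      ring
    simp_rw [e]
    refine ⟨(summable_norm_sum_mul_antidiagonal_of_summable_norm h1 (hs r i)).of_norm, ?_⟩
    rw [← tsum_mul_tsum_eq_tsum_sum_antidiagonal_of_summable_norm h1 (hs r i), resolventBlock,
      resolventBlock, (hs0 j s).of_norm.tsum_mul_right]
  obtain ⟨s1, e1⟩ := hprod 0 (a (-1)) (-1)
  obtain ⟨s2, e2⟩ := hprod (-1) (c 0) 0
  rw [e1, e2, ← s1.tsum_add s2, resolventBlock, (hs j i).of_norm.tsum_eq_zero_add, resolventBlock,
    (hs0 j i).of_norm.tsum_eq_zero_add, add_assoc, ← Summable.tsum_add _ (s1.add s2)]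
  · congr 1
    refine tsum_congr fun n => ?_
    rw [triPow_succ_eq_cutAt, smul_add, ← Finset.sum_add_distrib, Finset.smul_sum]
    simp only [smul_add]
  · exact (summable_nat_add_iff 1).2 (hs0 j i).of_norm

theorem resolventBlock_cutAt_eq_zero (w : ℂ) {j i : ℤ} (h : ¬ (0 ≤ j ↔ 0 ≤ i)) :
    resolventBlock (cutAt (-1) a) b (cutAt 0 c) w j i = 0 := by
  simp [resolventBlock, triPow_cutAt_eq_zero a b c _ h]

end Resolvent

section BlockInverse

variable {ι : Type*} [Fintype ι] [DecidableEq ι]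

/-- Solution of the resolvent equations for two subsystems, with resolvents `f` and `g`, which are
coupled by `a` and `c`. -/
theorem isUnit_and_eq_of_coupled {a c f g g₀₀ g₀₁ g₁₀ g₁₁ : Matrix ι ι ℂ}
    (h₀₀ : g₀₀ = f + f * a * g₁₀) (h₁₀ : g₁₀ = g * c * g₀₀)
    (h₁₁ : g₁₁ = g + g * c * g₀₁) (h₀₁ : g₀₁ = f * a * g₁₁) :
    (IsUnit (1 - a * g * c * f) ∧ IsUnit (1 - c * f * a * g)) ∧
    g₀₀ = f * (1 - a * g * c * f)⁻¹ ∧ g₁₁ = g * (1 - c * f * a * g)⁻¹ ∧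
    g₀₁ = f * (1 - a * g * c * f)⁻¹ * a * g ∧ g₁₀ = g * (1 - c * f * a * g)⁻¹ * c * f := by
  -- one half of the claim, applied twice
  have key : ∀ {a c f g x y : Matrix ι ι ℂ}, x = f + f * a * g * c * x → y = g + g * c * f * a * y →
      IsUnit (1 - a * g * c * f) ∧ x = f * (1 - a * g * c * f)⁻¹ ∧
      f * a * y = f * (1 - a * g * c * f)⁻¹ * a * g := by
    intro a c f g x y hx hy
    have hU : (1 - a * g * c * f) * (1 + a * y * c * f) = 1 := by
      have : (1 - a * g * c * f) * (1 + a * y * c * f) =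
          1 + a * (y - (g + g * c * f * a * y)) * c * f := by noncomm_ring
      rw [this, ← hy]; simp
    have hX : (1 - f * a * g * c) * (1 + x * a * g * c) = 1 := by
      have : (1 - f * a * g * c) * (1 + x * a * g * c) =
          1 + (x - (f + f * a * g * c * x)) * a * g * c := by noncomm_ring
      rw [this, ← hx]; simp
    have hY : (1 - g * c * f * a) * (1 + y * c * f * a) = 1 := by
      have : (1 - g * c * f * a) * (1 + y * c * f * a) =
          1 + (y - (g + g * c * f * a * y)) * c * f * a := by noncomm_ring
      rw [this, ← hy]; simp
    have hU' := mul_eq_one_comm.1 hU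
    have hX' := mul_eq_one_comm.1 hX
    have hY' := mul_eq_one_comm.1 hY
    have hinv : (1 - a * g * c * f)⁻¹ = 1 + a * y * c * f := Matrix.inv_eq_right_inv hU
    have hxe : x = f * (1 - a * g * c * f)⁻¹ := by
      have h1 : (1 - f * a * g * c) * x = f := by
        have : (1 - f * a * g * c) * x = x - f * a * g * c * x := by noncomm_ring
        rw [this]; nth_rewrite 1 [hx]; simp
      have h2 : (1 - f * a * g * c) * (f * (1 - a * g * c * f)⁻¹) = f := by
        have : (1 - f * a * g * c) * (f * (1 - a * g * c * f)⁻¹) =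
          f * ((1 - a * g * c * f) * (1 - a * g * c * f)⁻¹) := by noncomm_ring
        rw [this, hinv, hU, mul_one]
      calc x = (1 + x * a * g * c) * ((1 - f * a * g * c) * x) := by
            rw [← mul_assoc, hX', one_mul]
        _ = (1 + x * a * g * c) * ((1 - f * a * g * c) * (f * (1 - a * g * c * f)⁻¹)) := by
            rw [h1, h2]
        _ = _ := by rw [← mul_assoc, hX', one_mul]
    refine ⟨IsUnit.of_mul_eq_one _ hU, hxe, ?_⟩
    have h1 : a * g = (1 - a * g * c * f) * (a * y) := by
      have : (1 - a * g * c * f) * (a * y) = a * (y - g * c * f * a * y) := by noncomm_ring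
      rw [this]; nth_rewrite 1 [hy]; simp
    calc f * a * y = f * ((1 - a * g * c * f)⁻¹ * ((1 - a * g * c * f) * (a * y))) := by
          rw [← mul_assoc (1 - a * g * c * f)⁻¹, hinv, hU', one_mul, mul_assoc]
      _ = _ := by rw [← h1]; simp only [mul_assoc]
  have e0 : g₀₀ = f + f * a * g * c * g₀₀ := by
    conv_lhs => rw [h₀₀, h₁₀]
    simp only [mul_assoc]
  have e1 : g₁₁ = g + g * c * f * a * g₁₁ := by
    conv_lhs => rw [h₁₁, h₀₁]
    simp only [mul_assoc]
  obtain ⟨u0, x0, y0⟩ := key e0 e1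
  obtain ⟨u1, x1, y1⟩ := key e1 e0
  exact ⟨⟨u0, u1⟩, x0, x1, by rw [h₀₁, y0], by rw [h₁₀, y1]⟩

end BlockInverse

/-! ### Contractivity of the semigroup in the Heisenberg picture -/

section Heisenberg

/-- Row–column form of the Cauchy–Schwarz inequality for a map in Kraus form. -/
theorem ContinuousLinearMap.norm_sum_star_mul_mul_le {E : Type*} [NormedAddCommGroup E]
    [InnerProductSpace ℂ E] [CompleteSpace E] {I : Type*} [Fintype I] (V X : I → E →L[ℂ] E)
    {m β : ℝ} (hm : 0 ≤ m) (hβ : 0 ≤ β) (hX : ∀ i, ‖X i‖ ≤ m)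
    (hV : ∀ u, ∑ i, ‖V i u‖ ^ 2 ≤ β * ‖u‖ ^ 2) :
    ‖∑ i, star (V i) * X i * V i‖ ≤ m * β := by
  refine ContinuousLinearMap.opNorm_le_bound _ (by positivity) fun v => ?_
  set T := ∑ i, star (V i) * X i * V i with hT
  have hVs : ∀ u, √(∑ i, ‖V i u‖ ^ 2) ≤ √β * ‖u‖ := fun u => by
    refine Real.sqrt_le_iff.2 ⟨by positivity, ?_⟩
    rw [mul_pow, Real.sq_sqrt hβ]
    exact hV u
  have h1 : ‖T v‖ * ‖T v‖ ≤ m * β * ‖v‖ * ‖T v‖ := by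
    have e : ⟪T v, T v⟫_ℂ = ∑ i, ⟪V i (T v), X i (V i v)⟫_ℂ := by
      nth_rewrite 2 [hT]
      rw [_root_.sum_apply, inner_sum]
      refine Finset.sum_congr rfl fun i _ => ?_
      change ⟪_, (star (V i)) (X i (V i v))⟫_ℂ = _
      rw [ContinuousLinearMap.star_eq_adjoint, ContinuousLinearMap.adjoint_inner_right]
    have h2 : ‖T v‖ * ‖T v‖ = ‖⟪T v, T v⟫_ℂ‖ := by
      rw [inner_self_eq_norm_sq_to_K]; simp [sq]
    rw [h2, e]
    calc ‖∑ i, ⟪V i (T v), X i (V i v)⟫_ℂ‖ ≤ ∑ i, ‖V i (T v)‖ * (m * ‖V i v‖) := by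
          refine (norm_sum_le _ _).trans (Finset.sum_le_sum fun i _ => ?_)
          refine (norm_inner_le_norm _ _).trans ?_
          gcongr
          exact (X i).le_of_opNorm_le (hX i) _
      _ = m * ∑ i, ‖V i (T v)‖ * ‖V i v‖ := by
          rw [Finset.mul_sum]; exact Finset.sum_congr rfl fun i _ => by ring
      _ ≤ m * (√(∑ i, ‖V i (T v)‖ ^ 2) * √(∑ i, ‖V i v‖ ^ 2)) := by
          gcongr
          exact Real.sum_mul_le_sqrt_mul_sqrt _ _ _
      _ ≤ m * ((√β * ‖T v‖) * (√β * ‖v‖)) := by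
          gcongr
          · exact hVs _
          · exact hVs _
      _ = m * (√β * √β) * ‖v‖ * ‖T v‖ := by ring
      _ = _ := by rw [Real.mul_self_sqrt hβ]
  rcases (norm_nonneg (T v)).eq_or_lt with h0 | h0
  · rw [← h0]; positivity
  · exact le_of_mul_le_mul_right h1 h0

/-- A bounded operator which is dissipative to first order generates a contraction semigroup. -/
theorem NormedSpace.norm_exp_smul_le_one {𝔸 : Type*} [NormedRing 𝔸] [NormedAlgebra ℂ 𝔸]
    [CompleteSpace 𝔸] {a : 𝔸} {C : ℝ}
    (h : ∀ ε : ℝ, 0 ≤ ε → ‖1 + (ε : ℂ) • a‖ ≤ 1 + C * ε ^ 2) {t : ℝ} (ht : 0 ≤ t) :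
    ‖NormedSpace.exp ((t : ℂ) • a)‖ ≤ 1 := by
  -- `exp (t a)` is the `n`-th power of `exp (ε a)` with `ε = t / n`
  have key : ∀ η : ℝ, 0 < η → ‖NormedSpace.exp ((t : ℂ) • a)‖ ≤ Real.exp (η * t) := by
    intro η hη
    have hd := (hasDerivAt_exp_smul_const (𝕂 := ℂ) a (0 : ℂ)).isLittleO
    have hd' := hd.def (half_pos hη)
    simp only [zero_smul, NormedSpace.exp_zero, one_mul, sub_zero] at hd'
    have hlim : Filter.Tendsto (fun n : ℕ => t / (n : ℝ)) Filter.atTop (nhds 0) :=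
      tendsto_const_div_atTop_nhds_zero_nat t
    have hlimC : Filter.Tendsto (fun n : ℕ => ((t / (n : ℝ) : ℝ) : ℂ)) Filter.atTop (nhds 0) := by
      have := (Complex.continuous_ofReal.tendsto 0).comp hlim
      simpa [Function.comp_def] using this
    have h1 := hlimC.eventually hd'
    have h2 : ∀ᶠ n : ℕ in Filter.atTop, C * (t / (n : ℝ)) < η / 2 := by
      have := hlim.const_mul C
      rw [mul_zero] at this
      exact this.eventually_lt_const (half_pos hη)
    obtain ⟨n, hn1, hn2, hn3⟩ := (h1.and (h2.and (Filter.eventually_gt_atTop 0))).exists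
    set ε : ℝ := t / (n : ℝ) with hε
    have hε0 : 0 ≤ ε := by positivity
    have hb : ‖NormedSpace.exp ((ε : ℂ) • a)‖ ≤ 1 + η * ε := by
      calc ‖NormedSpace.exp ((ε : ℂ) • a)‖
          = ‖(NormedSpace.exp ((ε : ℂ) • a) - 1 - (ε : ℂ) • a) + (1 + (ε : ℂ) • a)‖ := by
            congr 1; abel
        _ ≤ η / 2 * ε + (1 + C * ε ^ 2) := by
            refine (norm_add_le _ _).trans (add_le_add ?_ (h ε hε0))
            simpa [abs_of_nonneg hε0] using hn1
        _ = 1 + (η / 2 + C * ε) * ε := by ring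
        _ ≤ 1 + η * ε := by
            have : η / 2 + C * ε ≤ η := by linarith
            gcongr
    have hpow : NormedSpace.exp ((t : ℂ) • a) = NormedSpace.exp ((ε : ℂ) • a) ^ n := by
      let _ : NormedAlgebra ℚ 𝔸 := NormedAlgebra.restrictScalars ℚ ℂ 𝔸
      rw [← NormedSpace.exp_nsmul, ← Nat.cast_smul_eq_nsmul ℂ, smul_smul, hε]
      congr 2
      push_cast
      field_simp
    rw [hpow]
    calc _ ≤ ‖NormedSpace.exp ((ε : ℂ) • a)‖ ^ n := norm_pow_le' _ hn3
      _ ≤ (1 + η * ε) ^ n := by gcongr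
      _ ≤ (Real.exp (η * ε)) ^ n := by
          gcongr
          linarith [Real.add_one_le_exp (η * ε)]
      _ = Real.exp (η * t) := by
          rw [← Real.exp_nat_mul, hε]
          congr 1
          field_simp
  have hlim : Filter.Tendsto (fun η : ℝ => Real.exp (η * t)) (nhdsWithin 0 (Set.Ioi 0))
      (nhds 1) := by
    have : Continuous fun η : ℝ => Real.exp (η * t) := by fun_prop
    have := (this.tendsto 0).mono_left (nhdsWithin_le_nhds (s := Set.Ioi 0))
    simpa using this
  exact ge_of_tendsto hlim (Filter.eventually_of_mem self_mem_nhdsWithin fun η hη => key η hη)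

open scoped Matrix.Norms.L2Operator

theorem Matrix.exists_l2_opNorm_le_of_entries {ι : Type*} [Fintype ι] [DecidableEq ι] :
    ∃ c : ℝ, ∀ (M : Matrix ι ι ℂ) (K : ℝ), (∀ p q, ‖M p q‖ ≤ K) → ‖M‖ ≤ c * K := by
  refine ⟨∑ p : ι, ∑ q : ι, ‖Matrix.single p q (1 : ℂ)‖, fun M K h => ?_⟩
  conv_lhs => rw [Matrix.matrix_eq_sum_single M]
  rw [Finset.sum_mul]
  refine (norm_sum_le _ _).trans (Finset.sum_le_sum fun p _ => ?_)
  rw [Finset.sum_mul]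
  refine (norm_sum_le _ _).trans (Finset.sum_le_sum fun q _ => ?_)
  have : Matrix.single p q (M p q) = M p q • Matrix.single p q (1 : ℂ) := by
    rw [Matrix.smul_single, smul_eq_mul, mul_one]
  rw [this, norm_smul, mul_comm]
  gcongr
  exact h p q

namespace TridiagonalCTOQW

variable {d : ℕ} (w : TridiagonalCTOQW d)

/-- The evolution preserves the total probability: the Heisenberg generator annihilates `1`. -/
theorem conjTranspose_G_add_G (n : ℤ) : (w.G n)ᴴ + w.G n
    + ((w.A n)ᴴ * w.A n + (w.B n)ᴴ * w.B n + (w.C n)ᴴ * w.C n) = 0 := by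
  have h2 : star (2⁻¹ : ℂ) = 2⁻¹ := by simp
  simp only [G, Matrix.conjTranspose_sub, Matrix.conjTranspose_neg, Matrix.conjTranspose_smul,
    (w.isHermitian_H n).eq, Matrix.conjTranspose_add, Matrix.conjTranspose_mul,
    Matrix.conjTranspose_conjTranspose, one_div, h2, Complex.star_def, Complex.conj_I]
  module

theorem exists_norm_le : ∃ K : ℝ, 0 ≤ K ∧
    ∀ n, ‖w.G n‖ ≤ K ∧ ‖w.A n‖ ≤ K ∧ ‖w.B n‖ ≤ K ∧ ‖w.C n‖ ≤ K := by
  obtain ⟨K, hK⟩ := w.bounded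
  obtain ⟨c, hc⟩ := Matrix.exists_l2_opNorm_le_of_entries (ι := Fin d)
  have hH := fun n => hc (w.H n) K fun p q => (hK n p q).1
  have hA := fun n => hc (w.A n) K fun p q => (hK n p q).2.1
  have hB := fun n => hc (w.B n) K fun p q => (hK n p q).2.2.1
  have hC := fun n => hc (w.C n) K fun p q => (hK n p q).2.2.2
  set K' := c * K
  have hK' : 0 ≤ K' := (norm_nonneg _).trans (hA 0)
  have hsq : ∀ M : Matrix (Fin d) (Fin d) ℂ, ‖M‖ ≤ K' → ‖Mᴴ * M‖ ≤ K' ^ 2 := fun M hM => by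
    rw [Matrix.l2_opNorm_conjTranspose_mul_self, sq]
    gcongr
  refine ⟨K' + 3 * K' ^ 2 + K', by positivity, fun n => ⟨?_, ?_, ?_, ?_⟩⟩
  · calc ‖w.G n‖ ≤ ‖w.H n‖ + 1 / 2 * (‖(w.A n)ᴴ * w.A n‖ + ‖(w.B n)ᴴ * w.B n‖
          + ‖(w.C n)ᴴ * w.C n‖) := by
          refine (norm_sub_le _ _).trans (add_le_add ?_ ?_)
          · rw [norm_neg, norm_smul, Complex.norm_I, one_mul]
          · rw [norm_smul]
            have : ‖(1 / 2 : ℂ)‖ = 1 / 2 := by simp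
            rw [this]
            gcongr
            exact norm_add₃_le
      _ ≤ K' + 1 / 2 * (K' ^ 2 + K' ^ 2 + K' ^ 2) := by
          gcongr
          exacts [hH n, hsq _ (hA n), hsq _ (hB n), hsq _ (hC n)]
      _ ≤ _ := by nlinarith
  · exact (hA n).trans (by nlinarith)
  · exact (hB n).trans (by nlinarith)
  · exact (hC n).trans (by nlinarith)

/-- The jump operators `S` are those of the family `A`, of which some may be dropped. -/
def IsSubfamily (A S : ℤ → Matrix (Fin d) (Fin d) ℂ) : Prop := ∀ n, S n = A n ∨ S n = 0

/-- One component of the generator in the Heisenberg picture, with jump operators `S` to the right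
and `T` to the left. -/
def heisenbergFun (S T X : ℤ → Matrix (Fin d) (Fin d) ℂ) (n : ℤ) : Matrix (Fin d) (Fin d) ℂ :=
  (w.G n)ᴴ * X n + X n * w.G n + (S n)ᴴ * X (n + 1) * S n + (w.B n)ᴴ * X n * w.B n
    + (T n)ᴴ * X (n - 1) * T n

variable {w}

theorem norm_heisenbergFun_le {S T X : ℤ → Matrix (Fin d) (Fin d) ℂ} {K m : ℝ}
    (hK : ∀ n, ‖w.G n‖ ≤ K ∧ ‖S n‖ ≤ K ∧ ‖w.B n‖ ≤ K ∧ ‖T n‖ ≤ K) (hX : ∀ n, ‖X n‖ ≤ m) (n : ℤ) :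
    ‖w.heisenbergFun S T X n‖ ≤ (2 * K + 3 * K ^ 2) * m := by
  have hK0 : 0 ≤ K := (norm_nonneg _).trans (hK 0).1
  have hm0 : 0 ≤ m := (norm_nonneg _).trans (hX 0)
  have h3 : ∀ U Y : Matrix (Fin d) (Fin d) ℂ, ‖U‖ ≤ K → ‖Y‖ ≤ m → ‖Uᴴ * Y * U‖ ≤ K ^ 2 * m :=
    fun U Y hU hY => by
      calc _ ≤ ‖Uᴴ‖ * ‖Y‖ * ‖U‖ := norm_mul₃_le
        _ ≤ K * m * K := by rw [Matrix.l2_opNorm_conjTranspose]; gcongr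
        _ = _ := by ring
  have h1 : ‖(w.G n)ᴴ * X n‖ ≤ K * m := (norm_mul_le _ _).trans <| by
    rw [Matrix.l2_opNorm_conjTranspose]
    exact mul_le_mul (hK n).1 (hX n) (norm_nonneg _) hK0
  have h2 : ‖X n * w.G n‖ ≤ m * K := (norm_mul_le _ _).trans <|
    mul_le_mul (hX n) (hK n).1 (norm_nonneg _) hm0
  calc _ ≤ K * m + m * K + K ^ 2 * m + K ^ 2 * m + K ^ 2 * m :=
        norm_add_le_of_le (norm_add_le_of_le (norm_add_le_of_le (norm_add_le_of_le h1 h2)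
          (h3 _ _ (hK n).2.1 (hX _))) (h3 _ _ (hK n).2.2.1 (hX _))) (h3 _ _ (hK n).2.2.2 (hX _))
    _ = _ := by ring

/-- To first order the Heisenberg evolution is the completely positive map with Kraus operators
`1 + ε G`, `√ε S`, `√ε B`, `√ε T`, and these satisfy `∑ V* V ≤ 1 + ε² G* G`. -/
theorem norm_add_smul_heisenbergFun_le {S T X : ℤ → Matrix (Fin d) (Fin d) ℂ} {K m : ℝ}
    (hS : IsSubfamily w.A S) (hT : IsSubfamily w.C T)
    (hK : ∀ n, ‖w.G n‖ ≤ K) (hX : ∀ n, ‖X n‖ ≤ m) {ε : ℝ} (hε : 0 ≤ ε) (n : ℤ) :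
    ‖X n + (ε : ℂ) • w.heisenbergFun S T X n‖ ≤ (1 + 2 * K ^ 2 * ε ^ 2) * m := by
  have hK0 : 0 ≤ K := (norm_nonneg _).trans (hK 0)
  have hm0 : 0 ≤ m := (norm_nonneg _).trans (hX 0)
  obtain ⟨Φ, hΦ⟩ : ∃ Φ : Matrix (Fin d) (Fin d) ℂ ≃⋆ₐ[ℂ]
      (EuclideanSpace ℂ (Fin d) →L[ℂ] EuclideanSpace ℂ (Fin d)), ∀ M, ‖Φ M‖ = ‖M‖ :=
    ⟨Matrix.toEuclideanCLM, fun M => (Matrix.cstar_norm_def M).symm⟩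
  have hΦs : ∀ M : Matrix (Fin d) (Fin d) ℂ, Φ Mᴴ = star (Φ M) := fun M => map_star Φ M
  let s : ℂ := (√ε : ℂ)
  have hss : star s * s = (ε : ℂ) := by
    simp only [s, Complex.star_def, Complex.conj_ofReal]
    rw [← Complex.ofReal_mul, Real.mul_self_sqrt hε]
  let V : Fin 4 → EuclideanSpace ℂ (Fin d) →L[ℂ] EuclideanSpace ℂ (Fin d) :=
    ![Φ (1 + (ε : ℂ) • w.G n), Φ (s • S n), Φ (s • w.B n), Φ (s • T n)]
  let Y : Fin 4 → EuclideanSpace ℂ (Fin d) →L[ℂ] EuclideanSpace ℂ (Fin d) :=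
    ![Φ (X n), Φ (X (n + 1)), Φ (X n), Φ (X (n - 1))]
  have hY : ∀ i, ‖Y i‖ ≤ m := by
    intro i
    fin_cases i <;> simp [Y, hΦ, hX]
  have hV : ∀ u, ∑ i, ‖V i u‖ ^ 2 ≤ (1 + K ^ 2 * ε ^ 2) * ‖u‖ ^ 2 := by
    intro u
    have hscale : ∀ M, ‖Φ (s • M) u‖ ^ 2 = ε * ‖Φ M u‖ ^ 2 := fun M => by
      have : Φ (s • M) u = s • Φ M u := by rw [map_smul]; rfl
      rw [this, norm_smul, mul_pow]
      congr 1
      simp only [s, Complex.norm_real, Real.norm_eq_abs, sq_abs]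
      exact Real.sq_sqrt hε
    have hsub : ∀ {A S : ℤ → Matrix (Fin d) (Fin d) ℂ}, IsSubfamily A S →
        ‖Φ (S n) u‖ ^ 2 ≤ ‖Φ (A n) u‖ ^ 2 := fun {A S} h => by
      rcases h n with h | h
      · rw [h]
      · rw [h, map_zero]
        simp
    have hsq : ∀ M, ‖Φ M u‖ ^ 2 = (⟪u, Φ (Mᴴ * M) u⟫_ℂ).re := fun M => by
      rw [map_mul, hΦs, ContinuousLinearMap.apply_norm_sq_eq_inner_adjoint_right]
      rfl
    have hG : 2 * (⟪u, Φ (w.G n) u⟫_ℂ).re + (‖Φ (w.A n) u‖ ^ 2 + ‖Φ (w.B n) u‖ ^ 2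
        + ‖Φ (w.C n) u‖ ^ 2) = 0 := by
      have h := congrArg (fun M => (⟪u, Φ M u⟫_ℂ).re) (w.conjTranspose_G_add_G n)
      simp only [map_add, map_zero, add_apply, inner_add_right, Complex.add_re, ← hsq,
        zero_apply, inner_zero_right, Complex.zero_re] at h
      have h2 : (⟪u, Φ (w.G n)ᴴ u⟫_ℂ).re = (⟪u, Φ (w.G n) u⟫_ℂ).re := by
        rw [hΦs, ContinuousLinearMap.star_eq_adjoint, ContinuousLinearMap.adjoint_inner_right,
          ← inner_conj_symm, Complex.conj_re]
      rw [h2] at h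
      linarith
    have h0 : ‖Φ (1 + (ε : ℂ) • w.G n) u‖ ^ 2 = ‖u‖ ^ 2 + 2 * ε * (⟪u, Φ (w.G n) u⟫_ℂ).re
        + ε ^ 2 * ‖Φ (w.G n) u‖ ^ 2 := by
      have : Φ (1 + (ε : ℂ) • w.G n) u = u + (ε : ℂ) • Φ (w.G n) u := by
        rw [map_add, map_one, map_smul]; rfl
      rw [this, norm_add_sq (𝕜 := ℂ), inner_smul_right, norm_smul]
      simp [mul_pow]
      ring
    have hGu : ‖Φ (w.G n) u‖ ^ 2 ≤ K ^ 2 * ‖u‖ ^ 2 := by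
      rw [← mul_pow]
      gcongr
      exact ContinuousLinearMap.le_of_opNorm_le _ ((hΦ _).trans_le (hK n)) u
    have hsum : ∑ i, ‖V i u‖ ^ 2 = ‖Φ (1 + (ε : ℂ) • w.G n) u‖ ^ 2 + ε * ‖Φ (S n) u‖ ^ 2
        + ε * ‖Φ (w.B n) u‖ ^ 2 + ε * ‖Φ (T n) u‖ ^ 2 := by
      rw [Fin.sum_univ_four, ← hscale, ← hscale, ← hscale]
      rfl
    rw [hsum, h0]
    have hS' := mul_le_mul_of_nonneg_left (hsub hS) hε
    have hT' := mul_le_mul_of_nonneg_left (hsub hT) hε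
    have hG' := mul_le_mul_of_nonneg_left hGu (sq_nonneg ε)
    have hε' : ε * (2 * (⟪u, Φ (w.G n) u⟫_ℂ).re + (‖Φ (w.A n) u‖ ^ 2 + ‖Φ (w.B n) u‖ ^ 2
        + ‖Φ (w.C n) u‖ ^ 2)) = 0 := by rw [hG, mul_zero]
    nlinarith
  -- the map with Kraus operators `V` differs from `1 + ε (heisenbergFun S T)` by `ε² G* X G`
  have hkraus := ContinuousLinearMap.norm_sum_star_mul_mul_le V Y hm0 (by positivity) hY hV
  have hsplit : X n + (ε : ℂ) • w.heisenbergFun S T X n =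
      ((1 + (ε : ℂ) • w.G n)ᴴ * X n * (1 + (ε : ℂ) • w.G n)
        + (s • S n)ᴴ * X (n + 1) * (s • S n) + (s • w.B n)ᴴ * X n * (s • w.B n)
        + (s • T n)ᴴ * X (n - 1) * (s • T n)) - ((ε : ℂ) ^ 2) • ((w.G n)ᴴ * X n * w.G n) := by
    have hs : ∀ U Z : Matrix (Fin d) (Fin d) ℂ, (s • U)ᴴ * Z * (s • U) = (ε : ℂ) • (Uᴴ * Z * U) :=
      fun U Z => by
        rw [Matrix.conjTranspose_smul, Matrix.smul_mul, Matrix.smul_mul, Matrix.mul_smul,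
          smul_smul, hss]
    rw [hs, hs, hs]
    simp only [heisenbergFun, Matrix.conjTranspose_add, Matrix.conjTranspose_one,
      Matrix.conjTranspose_smul, add_mul, mul_add, one_mul, mul_one, Matrix.smul_mul,
      Matrix.mul_smul, Complex.star_def, Complex.conj_ofReal]
    module
  have h1 : ‖(1 + (ε : ℂ) • w.G n)ᴴ * X n * (1 + (ε : ℂ) • w.G n)
        + (s • S n)ᴴ * X (n + 1) * (s • S n) + (s • w.B n)ᴴ * X n * (s • w.B n)
        + (s • T n)ᴴ * X (n - 1) * (s • T n)‖ ≤ m * (1 + K ^ 2 * ε ^ 2) := by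
    rw [← hΦ]
    refine le_trans (le_of_eq ?_) hkraus
    rw [Fin.sum_univ_four]
    simp only [V, Y, Matrix.cons_val, map_add, map_mul, hΦs]
  have h2 : ‖((ε : ℂ) ^ 2) • ((w.G n)ᴴ * X n * w.G n)‖ ≤ ε ^ 2 * (K * m * K) := by
    rw [norm_smul]
    refine mul_le_mul (by simp) ?_ (norm_nonneg _) (sq_nonneg _)
    refine norm_mul₃_le.trans ?_
    rw [Matrix.l2_opNorm_conjTranspose]
    have := hK n
    have := hX n
    gcongr
  rw [hsplit]
  calc _ ≤ m * (1 + K ^ 2 * ε ^ 2) + ε ^ 2 * (K * m * K) := norm_sub_le_of_le h1 h2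
    _ = _ := by ring

end TridiagonalCTOQW

end Heisenberg

section Heisenberg

open scoped Matrix.Norms.L2Operator BoundedContinuousFunction

variable {d : ℕ} {w : TridiagonalCTOQW d}

/-- The semigroup generated by a bounded operator `F` which is dissipative to first order is
bounded on `[0, ∞)`, weakly. -/
theorem exists_norm_tsum_le_of_dissipative {𝓧 : Type*} [NormedAddCommGroup 𝓧] [NormedSpace ℂ 𝓧]
    [CompleteSpace 𝓧] (F : 𝓧 →ₗ[ℂ] 𝓧) {B C : ℝ} (hF : ∀ X, ‖F X‖ ≤ B * ‖X‖)
    (h : ∀ ε : ℝ, 0 ≤ ε → ∀ X, ‖X + (ε : ℂ) • F X‖ ≤ (1 + C * ε ^ 2) * ‖X‖)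
    (ℓ : 𝓧 →ₗ[ℂ] ℂ) {b : ℝ} (hℓ : ∀ X, ‖ℓ X‖ ≤ b * ‖X‖) (X : 𝓧) :
    ∃ c : ℝ, ∀ t : ℝ, 0 ≤ t →
      ‖∑' k : ℕ, (t : ℂ) ^ k / (k.factorial : ℂ) * ℓ (F^[k] X)‖ ≤ c := by
  rcases subsingleton_or_nontrivial 𝓧 with hs | hs
  · exact ⟨0, fun t _ => by simp [Subsingleton.elim _ (0 : 𝓧)]⟩
  let F' : 𝓧 →L[ℂ] 𝓧 := F.mkContinuous B hF
  let ℓ' : 𝓧 →L[ℂ] ℂ := ℓ.mkContinuous b hℓ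
  let Λ : (𝓧 →L[ℂ] 𝓧) →L[ℂ] ℂ := ℓ'.comp (ContinuousLinearMap.apply ℂ _ X)
  obtain ⟨Y, hY⟩ := exists_ne (0 : 𝓧)
  refine ⟨‖Λ‖, fun t ht => ?_⟩
  have h1 := (NormedSpace.exp_series_hasSum_exp' (𝕂 := ℂ) ((t : ℂ) • F')).mapL Λ
  have h2 : ∀ k : ℕ, Λ (((k.factorial : ℂ)⁻¹) • ((t : ℂ) • F') ^ k) =
      (t : ℂ) ^ k / (k.factorial : ℂ) * ℓ (F^[k] X) := by
    intro k
    have h3 : (F' ^ k) X = F^[k] X := by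
      induction k with
      | zero => rfl
      | succ k ih => rw [pow_succ', mul_apply_eq_comp, ih, Function.iterate_succ_apply']; rfl
    rw [smul_pow, map_smul, map_smul]
    change _ • _ • ℓ ((F' ^ k) X) = _
    rw [h3, smul_eq_mul, smul_eq_mul]
    ring
  simp_rw [h2] at h1
  rw [h1.tsum_eq]
  refine (Λ.le_opNorm _).trans (mul_le_of_le_one_right (norm_nonneg _) ?_)
  refine NormedSpace.norm_exp_smul_le_one (a := F') (C := C) (fun ε hε => ?_) ht
  refine ContinuousLinearMap.opNorm_le_bound _ ?_ fun X => h ε hε X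
  exact nonneg_of_mul_nonneg_left ((norm_nonneg _).trans (h ε hε Y)) (norm_pos_iff.2 hY)

theorem Matrix.norm_entry_le_l2_opNorm {ι : Type*} [Fintype ι] [DecidableEq ι] (M : Matrix ι ι ℂ)
    (p q : ι) : ‖M p q‖ ≤ ‖M‖ := by
  have h := Matrix.l2_opNorm_mulVec M (EuclideanSpace.single q 1)
  have h2 := PiLp.norm_apply_le
    ((EuclideanSpace.equiv ι ℂ).symm (M *ᵥ (EuclideanSpace.single q (1 : ℂ)).ofLp)) p
  have h3 := h2.trans h
  simpa using h3

theorem rep_conjTranspose (X : Matrix (Fin d) (Fin d) ℂ) : (rep X)ᴴ = rep Xᴴ := by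
  ext p q
  simp [rep, Matrix.kroneckerMap_apply, Matrix.conjTranspose_apply]

theorem repAdd_conjTranspose (X : Matrix (Fin d) (Fin d) ℂ) : (repAdd X)ᴴ = repAdd Xᴴ := by
  ext p q
  simp [repAdd, Matrix.kroneckerMap_apply, Matrix.conjTranspose_apply, Matrix.one_apply, eq_comm,
    apply_ite (starRingEnd ℂ)]

namespace TridiagonalCTOQW

theorem rowVec_heisenbergFun (S T X : ℤ → Matrix (Fin d) (Fin d) ℂ) (n : ℤ) :
    rowVec (w.heisenbergFun S T X n) = (rep (S n))ᴴ *ᵥ rowVec (X (n + 1))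
      + (w.diag n)ᴴ *ᵥ rowVec (X n) + (rep (T n))ᴴ *ᵥ rowVec (X (n - 1)) := by
  rw [diag, Matrix.conjTranspose_add, Matrix.add_mulVec, rep_conjTranspose, rep_conjTranspose,
    rep_conjTranspose, repAdd_conjTranspose, repAdd_mulVec, rep_mulVec, rep_mulVec, rep_mulVec]
  ext p
  simp only [rowVec, heisenbergFun, Matrix.add_apply, Pi.add_apply,
    Matrix.conjTranspose_conjTranspose]
  ring

/-- Powers of the Heisenberg generator are adjoint to those of the block tridiagonal generator. -/
theorem rowVec_heisenbergFun_iterate_single (S T : ℤ → Matrix (Fin d) (Fin d) ℂ) (j : ℤ)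
    (Y : Matrix (Fin d) (Fin d) ℂ) (k : ℕ) (i : ℤ) :
    rowVec ((w.heisenbergFun S T)^[k] (fun n => if j = n then Y else 0) i) =
      (triPow (fun n => rep (S n)) w.diag (fun n => rep (T n)) k j i)ᴴ *ᵥ rowVec Y := by
  induction k generalizing i with
  | zero =>
    rw [Function.iterate_zero, triPow, id]
    split_ifs
    · simp
    · simp only [Matrix.conjTranspose_zero, Matrix.zero_mulVec]; rfl
  | succ k ih =>
    rw [Function.iterate_succ_apply', rowVec_heisenbergFun, ih, ih, ih, triPow_succ_right]
    simp only [Matrix.conjTranspose_add, Matrix.conjTranspose_mul, Matrix.add_mulVec,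
      Matrix.mulVec_mulVec]

/-- The blocks of the semigroup generated by the walk, or by the walk without some of its jumps,
are bounded on `[0, ∞)`. -/
theorem exists_norm_tsum_triPow_le {S T : ℤ → Matrix (Fin d) (Fin d) ℂ}
    (hS : IsSubfamily w.A S) (hT : IsSubfamily w.C T) (j i : ℤ) (p q : Fin d × Fin d) :
    ∃ C : ℝ, ∀ t : ℝ, 0 ≤ t → ‖∑' k : ℕ, (t : ℂ) ^ k / (k.factorial : ℂ) *
      triPow (fun n => rep (S n)) w.diag (fun n => rep (T n)) k j i p q‖ ≤ C := by
  obtain ⟨K, hK0, hK'⟩ := w.exists_norm_le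
  have hsub : ∀ {A S : ℤ → Matrix (Fin d) (Fin d) ℂ} (n : ℤ), IsSubfamily A S → ‖A n‖ ≤ K →
      ‖S n‖ ≤ K := fun n h hA => by
    rcases h n with h | h
    · rwa [h]
    · rw [h, norm_zero]; exact hK0
  have hK : ∀ n, ‖w.G n‖ ≤ K ∧ ‖S n‖ ≤ K ∧ ‖w.B n‖ ≤ K ∧ ‖T n‖ ≤ K := fun n =>
    ⟨(hK' n).1, hsub n hS (hK' n).2.1, (hK' n).2.2.1, hsub n hT (hK' n).2.2.2⟩
  -- the observable with the matrix unit `p` at the site `j`, which is tested at the site `i`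
  let Y : Matrix (Fin d) (Fin d) ℂ := Matrix.single p.1 p.2 1
  let X : ℤ →ᵇ Matrix (Fin d) (Fin d) ℂ := BoundedContinuousFunction.ofNormedAddCommGroupDiscrete
    (fun n => if j = n then Y else 0) ‖Y‖ (fun n => by split_ifs <;> simp)
  let F : (ℤ →ᵇ Matrix (Fin d) (Fin d) ℂ) → (ℤ →ᵇ Matrix (Fin d) (Fin d) ℂ) := fun X =>
    BoundedContinuousFunction.ofNormedAddCommGroupDiscrete
      (w.heisenbergFun S T X) ((2 * K + 3 * K ^ 2) * ‖X‖)
      (norm_heisenbergFun_le hK X.norm_coe_le_norm)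
  obtain ⟨C, hC⟩ := exists_norm_tsum_le_of_dissipative (𝓧 := ℤ →ᵇ Matrix (Fin d) (Fin d) ℂ)
    { toFun := F
      map_add' := fun X Y => by
        ext1 n
        simp only [F, BoundedContinuousFunction.coe_ofNormedAddCommGroupDiscrete,
          BoundedContinuousFunction.coe_add, heisenbergFun, Pi.add_apply]
        noncomm_ring
      map_smul' := fun z X => by
        ext1 n
        simp only [F, BoundedContinuousFunction.coe_ofNormedAddCommGroupDiscrete,
          BoundedContinuousFunction.coe_smul, heisenbergFun, RingHom.id_apply, Matrix.mul_smul,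
          Matrix.smul_mul, smul_add] }
    (B := 2 * K + 3 * K ^ 2) (C := 2 * K ^ 2) (fun X =>
      (BoundedContinuousFunction.norm_le (by positivity)).2
        (norm_heisenbergFun_le hK X.norm_coe_le_norm))
    (fun ε hε X => by
      rw [BoundedContinuousFunction.norm_le (by positivity)]
      exact norm_add_smul_heisenbergFun_le hS hT (fun n => (hK n).1) X.norm_coe_le_norm hε)
    { toFun := fun X => X i q.1 q.2
      map_add' := fun X Y => rfl
      map_smul' := fun z X => rfl }
    (b := 1) (fun X => by
      rw [one_mul]
      exact (Matrix.norm_entry_le_l2_opNorm _ _ _).trans (X.norm_coe_le_norm i)) X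
  refine ⟨C, fun t ht => ?_⟩
  have hiter : ∀ k : ℕ, ((F^[k] X : ℤ →ᵇ Matrix (Fin d) (Fin d) ℂ) :
      ℤ → Matrix (Fin d) (Fin d) ℂ) =
        (w.heisenbergFun S T)^[k] (fun n => if j = n then Y else 0) := by
    intro k
    induction k with
    | zero => rfl
    | succ k ih =>
      rw [Function.iterate_succ_apply', Function.iterate_succ_apply', ← ih]
      rfl
  have h2 : ∀ k : ℕ, (t : ℂ) ^ k / (k.factorial : ℂ) *
      triPow (fun n => rep (S n)) w.diag (fun n => rep (T n)) k j i p q =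
      star ((t : ℂ) ^ k / (k.factorial : ℂ) * (F^[k] X) i q.1 q.2) := by
    intro k
    have h3 := congrFun (rowVec_heisenbergFun_iterate_single (w := w) S T j Y k i) q
    have h4 : rowVec Y = Pi.single p 1 := by
      ext r
      simp only [rowVec, Y, Matrix.single_apply, Pi.single_apply, Prod.ext_iff, eq_comm]
    rw [h4, ← hiter] at h3
    change (F^[k] X) i q.1 q.2 = _ at h3
    rw [h3]
    simp [Matrix.mulVec_single]
  simp_rw [h2]
  rw [← tsum_star, norm_star]
  exact hC t ht

end TridiagonalCTOQW

end Heisenberg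

/-! ### Laplace and Stieltjes transforms -/

section Laplace

variable {μ : Measure ℝ}

/-- If the integrals of `u ^ n τ` grow at most like `r ^ n`, then `τ` lives on `{u ≤ r}`. -/
theorem ae_eq_zero_of_integral_pow_mul_le {τ u : ℝ → ℝ} (hτ : ∀ x, 0 ≤ τ x) (hu : ∀ x, 0 ≤ u x)
    (hum : Measurable u) {C r : ℝ} (hr : 0 ≤ r)
    (hi : ∀ n : ℕ, Integrable (fun x => u x ^ n * τ x) μ)
    (hC : ∀ n : ℕ, ∫ x, u x ^ n * τ x ∂μ ≤ C * r ^ n) : ∀ᵐ x ∂μ, r < u x → τ x = 0 := by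
  have hτi : Integrable τ μ := by simpa using hi 0
  have key : ∀ m : ℕ, ∀ᵐ x ∂μ, r + 1 / ((m : ℝ) + 1) ≤ u x → τ x = 0 := by
    intro m
    set q := r + 1 / ((m : ℝ) + 1) with hq
    have hm : 0 < 1 / ((m : ℝ) + 1) := Nat.one_div_pos_of_nat
    have hrq : r < q := by linarith
    have hq0 : 0 < q := by linarith
    have hS : MeasurableSet {x | q ≤ u x} := measurableSet_le measurable_const hum
    have hle : ∀ n : ℕ, ∫ x in {x | q ≤ u x}, τ x ∂μ ≤ C * (r / q) ^ n := by
      intro n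
      have h1 : q ^ n * ∫ x in {x | q ≤ u x}, τ x ∂μ ≤ C * r ^ n := by
        calc q ^ n * ∫ x in {x | q ≤ u x}, τ x ∂μ = ∫ x in {x | q ≤ u x}, q ^ n * τ x ∂μ := by
              rw [integral_const_mul]
          _ ≤ ∫ x in {x | q ≤ u x}, u x ^ n * τ x ∂μ := by
              refine setIntegral_mono_on (hτi.integrableOn.const_mul _) (hi n).integrableOn hS
                fun x hx => ?_
              exact mul_le_mul_of_nonneg_right (pow_le_pow_left₀ hq0.le hx n) (hτ x)
          _ ≤ ∫ x, u x ^ n * τ x ∂μ := setIntegral_le_integral (hi n)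
              (Filter.Eventually.of_forall fun x => mul_nonneg (pow_nonneg (hu x) n) (hτ x))
          _ ≤ _ := hC n
      rw [div_pow, mul_div_assoc', le_div_iff₀ (by positivity), mul_comm]
      exact h1
    have hlim : Filter.Tendsto (fun n : ℕ => C * (r / q) ^ n) Filter.atTop (nhds 0) := by
      simpa using (tendsto_pow_atTop_nhds_zero_of_lt_one (by positivity)
        ((div_lt_one hq0).2 hrq)).const_mul C
    have h0 : ∫ x in {x | q ≤ u x}, τ x ∂μ = 0 :=
      le_antisymm (ge_of_tendsto' hlim hle) (integral_nonneg hτ)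
    rw [integral_eq_zero_iff_of_nonneg hτ hτi.integrableOn] at h0
    exact (ae_restrict_iff' hS).1 h0
  filter_upwards [ae_all_iff.2 key] with x hx hrx
  obtain ⟨m, hm⟩ := exists_nat_one_div_lt (sub_pos.2 hrx)
  exact hx m (by linarith)

/-- Exponential integrals of a density of bounded support as series of its moments. -/
theorem integral_exp_neg_mul_eq_tsum {g : ℝ → ℂ} (hg : Integrable g μ) {K : ℝ}
    (hK : ∀ᵐ x ∂μ, K < |x| → g x = 0) {m : ℕ → ℂ}
    (hm : ∀ k, ∫ x : ℝ, (x : ℂ) ^ k * g x ∂μ = (-1) ^ k * m k) (t : ℝ) :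
    ∫ x : ℝ, (Real.exp (-x * t) : ℂ) * g x ∂μ =
      ∑' k : ℕ, (t : ℂ) ^ k / (k.factorial : ℂ) * m k := by
  have hi : ∀ k : ℕ, Integrable (fun x : ℝ => ((-x * t : ℝ) : ℂ) ^ k / (k.factorial : ℂ) * g x) μ :=
    fun k => Continuous.integrable_mul_of_ae_le
      (f := fun x : ℝ => ((-x * t : ℝ) : ℂ) ^ k / (k.factorial : ℂ)) hg hK (by fun_prop)
  have hsum : Summable fun k : ℕ =>
      ∫ x : ℝ, ‖((-x * t : ℝ) : ℂ) ^ k / (k.factorial : ℂ) * g x‖ ∂μ := by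
    refine Summable.of_nonneg_of_le (fun k => integral_nonneg fun _ => norm_nonneg _) (fun k => ?_)
      ((Real.summable_pow_div_factorial (|K| * |t|)).mul_right (∫ x, ‖g x‖ ∂μ))
    rw [← integral_const_mul]
    refine integral_mono_ae (hi k).norm (hg.norm.const_mul _) ?_
    filter_upwards [hK] with x hx
    by_cases h : K < |x|
    · simp [hx h]
    · have e : ‖((-x * t : ℝ) : ℂ)‖ = |x| * |t| := by
        rw [Complex.norm_real, Real.norm_eq_abs, abs_mul, abs_neg]
      rw [norm_mul, norm_div, norm_pow, e, Complex.norm_natCast]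
      have hxK : |x| ≤ |K| := (not_lt.1 h).trans (le_abs_self K)
      gcongr
  have h := hasSum_integral_of_summable_integral_norm hi hsum
  have e1 : ∀ x : ℝ, ∑' k : ℕ, ((-x * t : ℝ) : ℂ) ^ k / (k.factorial : ℂ) * g x =
      (Real.exp (-x * t) : ℂ) * g x := fun x => by
    rw [tsum_mul_right, Complex.ofReal_exp, Complex.exp_eq_exp_ℂ,
      congrFun (NormedSpace.exp_eq_tsum_div (𝔸 := ℂ))]
  have e2 : ∀ k : ℕ, ∫ x : ℝ, ((-x * t : ℝ) : ℂ) ^ k / (k.factorial : ℂ) * g x ∂μ =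
      (t : ℂ) ^ k / (k.factorial : ℂ) * m k := fun k => by
    have : ∀ x : ℝ, ((-x * t : ℝ) : ℂ) ^ k / (k.factorial : ℂ) * g x =
        ((-1) ^ k * (t : ℂ) ^ k / (k.factorial : ℂ)) * ((x : ℂ) ^ k * g x) := fun x => by
      push_cast
      rw [neg_mul, neg_pow, mul_pow]
      ring
    simp_rw [this]
    rw [integral_const_mul, hm]
    have h1 : ((-1 : ℂ) ^ k) * (-1) ^ k = 1 := by rw [← mul_pow]; simp
    linear_combination ((t : ℂ) ^ k / (k.factorial : ℂ) * m k) * h1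
  simp_rw [e1, e2] at h
  exact h.tsum_eq.symm

/-- Points near a point of the slit plane stay away from `(-∞, 0]`. -/
theorem Complex.exists_le_norm_ofReal_add {w : ℂ} (hw : w ∈ Complex.slitPlane) :
    ∃ δ : ℝ, 0 < δ ∧ ∀ x : ℝ, 0 ≤ x → ∀ v ∈ Metric.ball w δ, δ ≤ ‖(x : ℂ) + v‖ := by
  obtain ⟨ε, hε, hb⟩ := Metric.isOpen_iff.1 Complex.isOpen_slitPlane w hw
  refine ⟨ε / 2, half_pos hε, fun x hx v hv => ?_⟩
  by_contra! h
  have : (-(x : ℂ)) ∈ Metric.ball w ε := by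
    rw [Metric.mem_ball, dist_eq_norm] at hv ⊢
    calc ‖-(x : ℂ) - w‖ = ‖-((x : ℂ) + v) + (v - w)‖ := by congr 1; ring
      _ ≤ ‖(x : ℂ) + v‖ + ‖v - w‖ := by rw [← norm_neg ((x : ℂ) + v)]; exact norm_add_le _ _
      _ < ε := by linarith
  have h2 := hb this
  rw [Complex.mem_slitPlane_iff] at h2
  simp at h2
  linarith

theorem integrable_div_ofReal_add {g : ℝ → ℂ} (hg : Integrable g μ)
    (h0 : ∀ᵐ x ∂μ, x < 0 → g x = 0) {w : ℂ} (hw : w ∈ Complex.slitPlane) :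
    Integrable (fun x : ℝ => g x / ((x : ℂ) + w)) μ := by
  obtain ⟨δ, hδ, h⟩ := Complex.exists_le_norm_ofReal_add hw
  refine Integrable.mono' (hg.norm.mul_const δ⁻¹)
    (hg.aestronglyMeasurable.div₀ (by fun_prop)) ?_
  filter_upwards [h0] with x hx
  by_cases h' : x < 0
  · simp [hx h']
  · rw [norm_div, div_eq_mul_inv]
    gcongr
    exact h x (not_lt.1 h') w (Metric.mem_ball_self hδ)

theorem differentiableOn_integral_div_ofReal_add {g : ℝ → ℂ} (hg : Integrable g μ)
    (h0 : ∀ᵐ x ∂μ, x < 0 → g x = 0) :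
    DifferentiableOn ℂ (fun w : ℂ => ∫ x : ℝ, g x / ((x : ℂ) + w) ∂μ) Complex.slitPlane := by
  intro w hw
  obtain ⟨δ, hδ, h⟩ := Complex.exists_le_norm_ofReal_add hw
  have hmeas : ∀ v : ℂ, AEStronglyMeasurable (fun x : ℝ => g x / ((x : ℂ) + v)) μ :=
    fun v => hg.aestronglyMeasurable.div₀ (by fun_prop)
  refine (hasDerivAt_integral_of_dominated_loc_of_deriv_le
    (F := fun (v : ℂ) (x : ℝ) => g x / ((x : ℂ) + v))
    (F' := fun (v : ℂ) (x : ℝ) => -g x / ((x : ℂ) + v) ^ 2)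
    (bound := fun x => ‖g x‖ * (δ ^ 2)⁻¹) (Metric.ball_mem_nhds w hδ)
    (Filter.Eventually.of_forall hmeas) (integrable_div_ofReal_add hg h0 hw)
    (hg.aestronglyMeasurable.neg.div₀ (by fun_prop)) ?_ (hg.norm.mul_const _)
    ?_).2.differentiableAt.differentiableWithinAt
  · filter_upwards [h0] with x hx v hv
    by_cases h' : x < 0
    · simp [hx h']
    · rw [norm_div, norm_neg, norm_pow, div_eq_mul_inv]
      gcongr
      exact h x (not_lt.1 h') v hv
  · filter_upwards [h0] with x hx v hv
    by_cases h' : x < 0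
    · simp only [hx h', zero_div, neg_zero]
      exact hasDerivAt_const _ _
    · have hne : (x : ℂ) + v ≠ 0 := norm_pos_iff.1 (hδ.trans_le (h x (not_lt.1 h') v hv))
      have := ((hasDerivAt_const v (g x)).fun_div ((hasDerivAt_id v).const_add (x : ℂ)) hne)
      simpa using this

theorem integral_pow_mul_exp_neg_mul_Ioi (k : ℕ) {r : ℝ} (hr : 0 < r) :
    IntegrableOn (fun t : ℝ => t ^ k * Real.exp (-(r * t))) (Set.Ioi 0) ∧
    ∫ t in Set.Ioi (0 : ℝ), t ^ k * Real.exp (-(r * t)) = k.factorial / r ^ (k + 1) := by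
  have h := Real.integral_rpow_mul_exp_neg_mul_Ioi (a := k + 1) (by positivity) hr
  rw [Real.Gamma_nat_eq_factorial] at h
  have h2 : (1 / r) ^ ((k : ℝ) + 1) * k.factorial = k.factorial / r ^ (k + 1) := by
    rw [← Nat.cast_succ, Real.rpow_natCast]
    rw [one_div, inv_pow]
    field_simp
  have h1 : ∫ t in Set.Ioi (0 : ℝ), t ^ k * Real.exp (-(r * t)) = k.factorial / r ^ (k + 1) := by
    rw [← h2, ← h]
    refine setIntegral_congr_fun measurableSet_Ioi fun t _ => ?_
    simp
  refine ⟨?_, h1⟩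
  by_contra hi
  rw [integral_undef hi] at h1
  have : (0 : ℝ) < k.factorial / r ^ (k + 1) := by positivity
  exact this.ne h1

/-- A Stieltjes transform as a Neumann series, by two evaluations of a Laplace transform. -/
theorem integral_div_ofReal_add_eq_tsum [SFinite μ] {g : ℝ → ℂ} (hg : Integrable g μ)
    (h0 : ∀ᵐ x ∂μ, x < 0 → g x = 0) {h : ℕ → ℂ} {C K : ℝ} (hK : 0 ≤ K)
    (hC : ∀ k, ‖h k‖ ≤ C * K ^ k)
    (hexp : ∀ t : ℝ, 0 ≤ t → ∫ x : ℝ, (Real.exp (-x * t) : ℂ) * g x ∂μ =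
      ∑' k : ℕ, (t : ℂ) ^ k / (k.factorial : ℂ) * h k) {r : ℝ} (hr : K < r) :
    ∫ x : ℝ, g x / ((x : ℂ) + (r : ℂ)) ∂μ = ∑' k : ℕ, (r : ℂ)⁻¹ ^ (k + 1) * h k := by
  have hr0 : 0 < r := hK.trans_lt hr
  let ν : Measure ℝ := volume.restrict (Set.Ioi 0)
  let F : ℝ → ℝ → ℂ := fun x t => (Real.exp (-(r * t)) : ℂ) * ((Real.exp (-x * t) : ℂ) * g x)
  -- integration over `t` first
  have hx : ∀ᵐ x ∂μ, ∫ t, F x t ∂ν = g x / ((x : ℂ) + (r : ℂ)) := by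
    filter_upwards [h0] with x hx
    by_cases hx0 : x < 0
    · simp [F, hx hx0]
    · have e : ∀ t : ℝ, F x t = ((t ^ 0 * Real.exp (-((x + r) * t)) : ℝ) : ℂ) * g x := fun t => by
        simp only [F]
        rw [← mul_assoc, ← Complex.ofReal_mul, ← Real.exp_add, pow_zero, one_mul]
        congr 3
        ring
      simp_rw [e]
      rw [integral_mul_const, integral_complex_ofReal,
        (integral_pow_mul_exp_neg_mul_Ioi 0 (by linarith : 0 < x + r)).2]
      push_cast
      simp
      ring
  -- integration over `x` first
  have ht : ∀ᵐ t ∂ν, ∫ x, F x t ∂μ =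
      ∑' k : ℕ, (Real.exp (-(r * t)) : ℂ) * ((t : ℂ) ^ k / (k.factorial : ℂ) * h k) := by
    filter_upwards [ae_restrict_mem measurableSet_Ioi] with t ht
    rw [integral_const_mul, hexp t (le_of_lt ht), tsum_mul_left]
  have hF : Integrable (Function.uncurry F) (μ.prod ν) := by
    have h1 : Integrable (fun t : ℝ => Real.exp (-(r * t))) ν := by
      have := (integral_pow_mul_exp_neg_mul_Ioi 0 hr0).1
      simp only [pow_zero, one_mul] at this
      exact this
    have h2 := (hg.norm.mul_prod h1)
    refine Integrable.mono' h2 ?_ ?_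
    · refine AEStronglyMeasurable.mul (by fun_prop) (AEStronglyMeasurable.mul (by fun_prop) ?_)
      exact hg.aestronglyMeasurable.comp_fst
    · have h3 : ∀ᵐ z ∂(μ.prod ν), (z.1 < 0 → g z.1 = 0) ∧ 0 < z.2 := by
        have h4 : ∀ᵐ z ∂(μ.prod ν), z.1 < 0 → g z.1 = 0 :=
          Measure.quasiMeasurePreserving_fst.ae h0
        have h5 : ∀ᵐ z ∂(μ.prod ν), 0 < z.2 :=
          Measure.quasiMeasurePreserving_snd.ae (ae_restrict_mem measurableSet_Ioi)
        exact h4.and h5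
      filter_upwards [h3] with z hz
      by_cases hz0 : z.1 < 0
      · simp [Function.uncurry, F, hz.1 hz0]
      · have h6 : Real.exp (-z.1 * z.2) ≤ 1 := by
          rw [Real.exp_le_one_iff]
          nlinarith [hz.2, not_lt.1 hz0]
        simp only [Function.uncurry, F, norm_mul, Complex.norm_real, Real.norm_eq_abs,
          Real.abs_exp]
        calc _ ≤ Real.exp (-(r * z.2)) * (1 * ‖g z.1‖) := by gcongr
          _ = _ := by ring
  have hswap : ∫ x, g x / ((x : ℂ) + (r : ℂ)) ∂μ =
      ∫ t, ∑' k : ℕ, (Real.exp (-(r * t)) : ℂ) * ((t : ℂ) ^ k / (k.factorial : ℂ) * h k) ∂ν := by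
    rw [← integral_congr_ae hx, integral_integral_swap hF, integral_congr_ae ht]
  rw [hswap]
  have e : ∀ (k : ℕ) (t : ℝ), (Real.exp (-(r * t)) : ℂ) * ((t : ℂ) ^ k / (k.factorial : ℂ) * h k) =
      ((t ^ k * Real.exp (-(r * t)) : ℝ) : ℂ) * (h k / (k.factorial : ℂ)) := fun k t => by
    push_cast
    ring
  simp_rw [e]
  have hi : ∀ k : ℕ, Integrable (fun t : ℝ =>
      ((t ^ k * Real.exp (-(r * t)) : ℝ) : ℂ) * (h k / (k.factorial : ℂ))) ν := fun k =>
    (integral_pow_mul_exp_neg_mul_Ioi k hr0).1.ofReal.mul_const _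
  have hval : ∀ k : ℕ, ∫ t : ℝ, ((t ^ k * Real.exp (-(r * t)) : ℝ) : ℂ)
      * (h k / (k.factorial : ℂ)) ∂ν = (r : ℂ)⁻¹ ^ (k + 1) * h k := fun k => by
    rw [integral_mul_const, integral_complex_ofReal, (integral_pow_mul_exp_neg_mul_Ioi k hr0).2]
    have : (k.factorial : ℂ) ≠ 0 := by exact_mod_cast k.factorial_ne_zero
    have hr' : (r : ℂ) ≠ 0 := by exact_mod_cast hr0.ne'
    push_cast
    rw [inv_pow]
    field_simp
  have hsum : Summable fun k : ℕ => ∫ t : ℝ, ‖((t ^ k * Real.exp (-(r * t)) : ℝ) : ℂ)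
      * (h k / (k.factorial : ℂ))‖ ∂ν := by
    have hnorm : ∀ k : ℕ, ∫ t : ℝ, ‖((t ^ k * Real.exp (-(r * t)) : ℝ) : ℂ)
        * (h k / (k.factorial : ℂ))‖ ∂ν = ‖h k‖ / r ^ (k + 1) := fun k => by
      have e1 : ∀ᵐ t ∂ν, ‖((t ^ k * Real.exp (-(r * t)) : ℝ) : ℂ) * (h k / (k.factorial : ℂ))‖ =
          t ^ k * Real.exp (-(r * t)) * (‖h k‖ / k.factorial) := by
        filter_upwards [ae_restrict_mem measurableSet_Ioi] with t ht
        have : 0 ≤ t ^ k * Real.exp (-(r * t)) := by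
          have : (0 : ℝ) < t := ht
          positivity
        rw [norm_mul, Complex.norm_real, Real.norm_of_nonneg this, norm_div, Complex.norm_natCast]
      rw [integral_congr_ae e1, integral_mul_const, (integral_pow_mul_exp_neg_mul_Ioi k hr0).2]
      have : (k.factorial : ℝ) ≠ 0 := by exact_mod_cast k.factorial_ne_zero
      field_simp
    simp_rw [hnorm]
    refine Summable.of_nonneg_of_le (fun k => by positivity) (fun k => ?_)
      ((summable_geometric_of_lt_one (by positivity) ((div_lt_one hr0).2 hr)).mul_left (C / r))
    calc _ ≤ C * K ^ k / r ^ (k + 1) := by gcongr; exact hC k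
      _ = _ := by rw [div_pow, pow_succ]; field_simp
  have := hasSum_integral_of_summable_integral_norm hi hsum
  simp_rw [hval] at this
  exact this.tsum_eq.symm

/-- Holomorphic functions on the slit plane which agree at large positive numbers agree. -/
theorem eqOn_slitPlane_of_eq_ofReal {F : Type*} [NormedAddCommGroup F] [NormedSpace ℂ F]
    [CompleteSpace F] {f g : ℂ → F} (hf : DifferentiableOn ℂ f Complex.slitPlane)
    (hg : DifferentiableOn ℂ g Complex.slitPlane) {K : ℝ}
    (h : ∀ r : ℝ, K < r → f r = g r) : Set.EqOn f g Complex.slitPlane := by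
  set z₀ : ℝ := |K| + 1
  have hz : K < z₀ := (le_abs_self K).trans_lt (lt_add_one _)
  have hz0 : 0 < z₀ := by positivity
  refine (hf.analyticOnNhd Complex.isOpen_slitPlane).eqOn_of_preconnected_of_frequently_eq
    (hg.analyticOnNhd Complex.isOpen_slitPlane)
    (Complex.starConvex_one_slitPlane.isPathConnected
      Complex.one_mem_slitPlane).isConnected.isPreconnected
    (z₀ := (z₀ : ℂ)) (Complex.ofReal_mem_slitPlane.2 hz0) ?_
  have hlim : Filter.Tendsto (fun r : ℝ => (r : ℂ)) (nhdsWithin z₀ {z₀}ᶜ)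
      (nhdsWithin (z₀ : ℂ) {(z₀ : ℂ)}ᶜ) := by
    refine tendsto_nhdsWithin_of_tendsto_nhds_of_eventually_within _
      ((Complex.continuous_ofReal.tendsto z₀).mono_left nhdsWithin_le_nhds) ?_
    filter_upwards [self_mem_nhdsWithin] with r hr
    simpa using hr
  have hev : ∀ᶠ r : ℝ in nhdsWithin z₀ {z₀}ᶜ, f r = g r :=
    Filter.Eventually.mono (nhdsWithin_le_nhds (lt_mem_nhds hz)) h
  exact hlim.frequently hev.frequently

end Laplace

/-! ### Support of positive matrix measures -/

/-- A positive matrix measure with `∫ u ^ n dW = O(r ^ n)` lives on `{u ≤ r}`. The condition is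
needed for the diagonal entries only, because a positive matrix of trace `0` vanishes. -/
theorem MatrixMeasure.IsPositive.density_eq_zero_of_growth {κ : Type*} [Fintype κ]
    {W : MatrixMeasure κ} (hW : W.IsPositive) {u : ℝ → ℝ} (hu : ∀ x, 0 ≤ u x) (hum : Measurable u)
    {r : ℝ} (hr : 0 ≤ r)
    (hi : ∀ p (n : ℕ), Integrable (fun x => ((u x ^ n : ℝ) : ℂ) * W.density x p p) W.base)
    (hC : ∀ p, ∃ C : ℝ, ∀ n : ℕ,
      ‖∫ x, ((u x ^ n : ℝ) : ℂ) * W.density x p p ∂W.base‖ ≤ C * r ^ n) :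
    ∀ᵐ x ∂W.base, r < u x → W.density x = 0 := by
  have hdiag : ∀ x p, 0 ≤ W.density x p p := fun x p => (hW x).diag_nonneg
  have hre : ∀ x p, ((W.density x p p).re : ℂ) = W.density x p p := fun x p =>
    (Complex.eq_re_of_ofReal_le (r := 0) (by simpa using hdiag x p)).symm
  have key : ∀ p, ∀ᵐ x ∂W.base, r < u x → (W.density x p p).re = 0 := by
    intro p
    obtain ⟨C, hC⟩ := hC p
    have e : ∀ (n : ℕ) x, ((u x ^ n : ℝ) : ℂ) * W.density x p p =
        ((u x ^ n * (W.density x p p).re : ℝ) : ℂ) := fun n x => by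
      rw [Complex.ofReal_mul, hre]
    simp only [e] at hi hC
    refine ae_eq_zero_of_integral_pow_mul_le (C := C)
      (fun x => (Complex.nonneg_iff.1 (hdiag x p)).1) hu hum hr ?_ ?_
    · intro n
      have h := (hi p n).re
      refine h.congr (Filter.Eventually.of_forall fun x => ?_)
      change Complex.re _ = _
      rw [Complex.re_ofReal_mul]
    · intro n
      have h := hC n
      rw [integral_complex_ofReal, Complex.norm_real] at h
      exact (le_abs_self _).trans h
  filter_upwards [ae_all_iff.2 key] with x hx hrx
  refine (hW x).trace_eq_zero_iff.1 (Finset.sum_eq_zero fun p _ => ?_)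
  rw [Matrix.diag_apply, ← hre, hx p hrx, Complex.ofReal_zero]

section Transform

variable {ι κ : Type*} [Fintype ι]

/-! ### Solutions of the three-term recurrence -/

/-- The functional `φ ↦ ∑ P n φ n` given by a row of matrices. -/
def rowTransform (P : ℤ → Matrix κ ι ℂ) : (ℤ →₀ (ι → ℂ)) →ₗ[ℂ] (κ → ℂ) :=
  Finsupp.lsum ℂ fun n => (P n).mulVecLin

theorem rowTransform_single (P : ℤ → Matrix κ ι ℂ) (n : ℤ) (u : ι → ℂ) :
    rowTransform P (Finsupp.single n u) = P n *ᵥ u := by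
  simp [rowTransform]

theorem rowTransform_apply (P : ℤ → Matrix κ ι ℂ) (φ : ℤ →₀ (ι → ℂ)) :
    rowTransform P φ = ∑ n ∈ φ.support, P n *ᵥ φ n := by
  simp [rowTransform, Finsupp.lsum_apply, Finsupp.sum]

/-- The row `P` solves `-x P n = P (n+1) a n + P n b n + P (n-1) c n` on all of `ℤ`. -/
def IsRowSolution (a b c : ℤ → Matrix ι ι ℂ) (x : ℝ) (P : ℤ → Matrix κ ι ℂ) : Prop :=
  ∀ n, -((x : ℂ) • P n) = P (n + 1) * a n + P n * b n + P (n - 1) * c n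

variable {a b c : ℤ → Matrix ι ι ℂ}

/-- The transform turns the generator into multiplication by `-x`. -/
theorem IsRowSolution.rowTransform_tridiag {x : ℝ} {P : ℤ → Matrix κ ι ℂ}
    (hP : IsRowSolution a b c x P) (φ : ℤ →₀ (ι → ℂ)) :
    rowTransform P (tridiag a b c φ) = -((x : ℂ) • rowTransform P φ) := by
  induction φ using Finsupp.induction_linear with
  | zero => simp
  | add f g hf hg => rw [map_add, map_add, hf, hg, map_add, smul_add, neg_add]
  | single n u =>
    rw [tridiag_single, map_add, map_add, rowTransform_single, rowTransform_single,
      rowTransform_single, rowTransform_single, ← Matrix.smul_mulVec, ← Matrix.neg_mulVec, hP n]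
    simp only [Matrix.add_mulVec, Matrix.mulVec_mulVec]

theorem IsRowSolution.rowTransform_tridiag_pow {x : ℝ} {P : ℤ → Matrix κ ι ℂ}
    (hP : IsRowSolution a b c x P) (k : ℕ) (φ : ℤ →₀ (ι → ℂ)) :
    rowTransform P ((tridiag a b c ^ k) φ) = (-(x : ℂ)) ^ k • rowTransform P φ := by
  induction k with
  | zero => simp
  | succ k ih =>
    rw [pow_succ', Module.End.mul_apply, hP.rowTransform_tridiag, ih, pow_succ', mul_smul, neg_smul]

/-! ### The symmetrizing inner product -/

/-- The sesquilinear form `∑ φ n* S n ψ n` on finitely supported vectors. -/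
def blockForm (S : ℤ → Matrix ι ι ℂ) (φ ψ : ℤ →₀ (ι → ℂ)) : ℂ :=
  φ.sum fun n u => star u ⬝ᵥ (S n *ᵥ ψ n)

section BlockForm

variable {S : ℤ → Matrix ι ι ℂ}

theorem blockForm_single_left (i : ℤ) (u : ι → ℂ) (ψ : ℤ →₀ (ι → ℂ)) :
    blockForm S (Finsupp.single i u) ψ = star u ⬝ᵥ (S i *ᵥ ψ i) := by
  simp [blockForm]

theorem blockForm_add_left (φ φ' ψ : ℤ →₀ (ι → ℂ)) :
    blockForm S (φ + φ') ψ = blockForm S φ ψ + blockForm S φ' ψ := by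
  classical
  rw [blockForm, Finsupp.sum_add_index'] <;> simp [blockForm, add_dotProduct]

theorem blockForm_add_right (φ ψ ψ' : ℤ →₀ (ι → ℂ)) :
    blockForm S φ (ψ + ψ') = blockForm S φ ψ + blockForm S φ ψ' := by
  simp [blockForm, Matrix.mulVec_add, dotProduct_add, Finsupp.sum_add]

theorem blockForm_zero_right (φ : ℤ →₀ (ι → ℂ)) : blockForm S φ 0 = 0 := by
  simp [blockForm]

theorem blockForm_zero_left (ψ : ℤ →₀ (ι → ℂ)) : blockForm S 0 ψ = 0 := by
  simp [blockForm]

/-- The inner product `∑ φ n* S n ψ n` on finitely supported vectors. -/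
@[reducible] def blockInnerCore (hS : ∀ n, (S n).PosDef) :
    InnerProductSpace.Core ℂ (ℤ →₀ (ι → ℂ)) where
  inner φ ψ := blockForm S φ ψ
  conj_inner_symm φ ψ := by
    classical
    have h : ∀ φ ψ : ℤ →₀ (ι → ℂ), blockForm S φ ψ =
        ∑ n ∈ φ.support ∪ ψ.support, star (φ n) ⬝ᵥ (S n *ᵥ ψ n) := fun φ ψ =>
      Finsupp.sum_of_support_subset _ Finset.subset_union_left _ (by simp)
    rw [h, h, map_sum, Finset.union_comm]
    refine Finset.sum_congr rfl fun n _ => ?_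
    change star _ = _
    rw [← Matrix.star_dotProduct_star, star_star, Matrix.star_mulVec, (hS n).isHermitian.eq,
      ← Matrix.dotProduct_mulVec]
  re_inner_nonneg φ := by
    change 0 ≤ Complex.re (∑ n ∈ φ.support, _)
    rw [Complex.re_sum]
    exact Finset.sum_nonneg fun n _ =>
      (Complex.nonneg_iff.1 ((hS n).posSemidef.dotProduct_mulVec_nonneg _)).1
  add_left φ ψ χ := blockForm_add_left φ ψ χ
  smul_left φ ψ z := by
    change blockForm S _ _ = _ * blockForm S _ _
    rw [blockForm, Finsupp.sum_smul_index', blockForm, Finsupp.sum, Finsupp.sum, Finset.mul_sum]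
    · simp
    · simp
  definite φ h := by
    change ∑ n ∈ φ.support, _ = (0 : ℂ) at h
    rw [Finset.sum_eq_zero_iff_of_nonneg fun n _ =>
      (hS n).posSemidef.dotProduct_mulVec_nonneg _] at h
    ext1 n
    by_contra hn
    exact ((hS n).dotProduct_mulVec_pos hn).ne' (h n (Finsupp.mem_support_iff.2 hn))

/-- The diagonal matrix `S` symmetrizes the block tridiagonal matrix. -/
structure IsSymmetrizer (a b c S : ℤ → Matrix ι ι ℂ) : Prop where
  posDef : ∀ n, (S n).PosDef
  off_diag : ∀ n, (a n)ᴴ * S (n + 1) = S n * c (n + 1)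
  diag : ∀ n, (b n)ᴴ * S n = S n * b n

theorem IsSymmetrizer.blockForm_tridiag (h : IsSymmetrizer a b c S) (φ ψ : ℤ →₀ (ι → ℂ)) :
    blockForm S (tridiag a b c φ) ψ = blockForm S φ (tridiag a b c ψ) := by
  induction φ using Finsupp.induction_linear with
  | zero => simp [blockForm_zero_left]
  | add f g hf hg => rw [map_add, blockForm_add_left, blockForm_add_left, hf, hg]
  | single n u =>
    have h1 := h.off_diag n
    have h2 := congrArg Matrix.conjTranspose (h.off_diag (n - 1))
    rw [sub_add_cancel, Matrix.conjTranspose_mul, Matrix.conjTranspose_mul,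
      (h.posDef _).isHermitian.eq, (h.posDef _).isHermitian.eq,
      Matrix.conjTranspose_conjTranspose] at h2
    rw [tridiag_single, blockForm_add_left, blockForm_add_left, blockForm_single_left,
      blockForm_single_left, blockForm_single_left, blockForm_single_left, tridiag_apply]
    simp only [Matrix.star_mulVec, ← Matrix.dotProduct_mulVec, Matrix.mulVec_add,
      Matrix.mulVec_mulVec, dotProduct_add, h1, h2, h.diag]
    ring

variable [DecidableEq ι]

open scoped Matrix.Norms.L2Operator in
theorem exists_norm_blockForm_tridiag_pow_le {K : ℝ} (ha : ∀ n, ‖a n‖ ≤ K) (hb : ∀ n, ‖b n‖ ≤ K)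
    (hc : ∀ n, ‖c n‖ ≤ K) (φ ψ : ℤ →₀ (ι → ℂ)) :
    ∃ C : ℝ, ∀ k : ℕ, ‖blockForm S φ ((tridiag a b c ^ k) ψ)‖ ≤ C * (3 * K) ^ k := by
  have hadd : ∀ f g : ℕ → ℂ, (∃ C : ℝ, ∀ k, ‖f k‖ ≤ C * (3 * K) ^ k) →
      (∃ C : ℝ, ∀ k, ‖g k‖ ≤ C * (3 * K) ^ k) → ∃ C : ℝ, ∀ k, ‖f k + g k‖ ≤ C * (3 * K) ^ k := by
    rintro f g ⟨C, hC⟩ ⟨D, hD⟩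
    exact ⟨C + D, fun k => by rw [add_mul]; exact norm_add_le_of_le (hC k) (hD k)⟩
  induction φ using Finsupp.induction_linear with
  | zero => exact ⟨0, fun k => by simp [blockForm_zero_left]⟩
  | add f g hf hg =>
    simp_rw [blockForm_add_left]
    exact hadd _ _ hf hg
  | single j u =>
    simp_rw [blockForm_single_left]
    induction ψ using Finsupp.induction_linear with
    | zero => exact ⟨0, fun k => by simp⟩
    | add f g hf hg =>
      simp_rw [map_add, Finsupp.add_apply, Matrix.mulVec_add, dotProduct_add]
      exact hadd _ _ hf hg
    | single i v =>
      simp_rw [tridiag_pow_single_apply]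
      let ℓ : Matrix ι ι ℂ →ₗ[ℂ] ℂ :=
        { toFun := fun M => star u ⬝ᵥ (S j *ᵥ (M *ᵥ v))
          map_add' := fun M N => by simp [Matrix.add_mulVec, Matrix.mulVec_add, dotProduct_add]
          map_smul' := fun z M => by
            simp [Matrix.smul_mulVec, Matrix.mulVec_smul, dotProduct_smul] }
      refine ⟨‖LinearMap.toContinuousLinearMap ℓ‖ * ‖(1 : Matrix ι ι ℂ)‖, fun k => ?_⟩
      refine ((LinearMap.toContinuousLinearMap ℓ).le_opNorm (triPow a b c k j i)).trans ?_
      rw [mul_assoc]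
      gcongr
      exact norm_triPow_le a b c ha hb hc k j i

end BlockForm

end Transform

/-! ### Representation of the powers of the generator -/

section Existence

variable {ι : Type*} [Fintype ι] {a b c S : ℤ → Matrix ι ι ℂ}

theorem IsSymmetrizer.blockForm_tridiag_pow (h : IsSymmetrizer a b c S) (k : ℕ)
    (φ ψ : ℤ →₀ (ι → ℂ)) :
    blockForm S ((tridiag a b c ^ k) φ) ψ = blockForm S φ ((tridiag a b c ^ k) ψ) := by
  induction k generalizing φ with
  | zero => rfl
  | succ k ih =>
    rw [pow_succ, Module.End.mul_apply, ih, h.blockForm_tridiag, ← Module.End.mul_apply,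
      ← pow_succ', pow_succ]

theorem blockForm_smul_right (z : ℂ) (φ ψ : ℤ →₀ (ι → ℂ)) :
    blockForm S φ (z • ψ) = z * blockForm S φ ψ := by
  simp [blockForm, Matrix.mulVec_smul, dotProduct_smul, Finsupp.mul_sum]

theorem blockForm_smul_left (z : ℂ) (φ ψ : ℤ →₀ (ι → ℂ)) :
    blockForm S (z • φ) ψ = star z * blockForm S φ ψ := by
  rw [blockForm, Finsupp.sum_smul_index' (by simp), blockForm, Finsupp.mul_sum]
  simp

variable [DecidableEq ι]

open scoped Matrix.Norms.L2Operator in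
/-- The moments of the generator with respect to the symmetrizing inner product are those of a
matrix measure of bounded support. -/
theorem IsSymmetrizer.exists_moment_measure (h : IsSymmetrizer a b c S) {K : ℝ}
    (ha : ∀ n, ‖a n‖ ≤ K) (hb : ∀ n, ‖b n‖ ≤ K) (hc : ∀ n, ‖c n‖ ≤ K)
    {κ : Type*} [Fintype κ] (φ : κ → ℤ →₀ (ι → ℂ)) :
    ∃ W : MatrixMeasure κ, W.IsPositive ∧ (∃ R : ℝ, ∀ᵐ x ∂W.base, |x| ≤ R) ∧
      ∀ (k : ℕ) p q, ∫ x : ℝ, (x : ℂ) ^ k * W.density x p q ∂W.base =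
        (-1) ^ k * blockForm S (φ p) ((tridiag a b c ^ k) (φ q)) := by
  have hK : 0 ≤ K := (norm_nonneg _).trans (ha 0)
  have hpow : ∀ (k : ℕ) (ψ : ℤ →₀ (ι → ℂ)), ((-tridiag a b c) ^ k) ψ =
      (-1 : ℂ) ^ k • (tridiag a b c ^ k) ψ := fun k ψ => by
    have : -tridiag a b c = (-1 : ℂ) • tridiag a b c :=
      LinearMap.ext fun _ => (neg_one_smul ℂ _).symm
    rw [this, smul_pow, LinearMap.smul_apply]
  let core := blockInnerCore h.posDef
  let _ : NormedAddCommGroup (ℤ →₀ (ι → ℂ)) := core.toNormedAddCommGroup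
  let _ : InnerProductSpace ℂ (ℤ →₀ (ι → ℂ)) := InnerProductSpace.ofCore core.toCore
  have hinner : ∀ φ ψ : ℤ →₀ (ι → ℂ), ⟪φ, ψ⟫_ℂ = blockForm S φ ψ := fun _ _ => rfl
  have hT : (-tridiag a b c : (ℤ →₀ (ι → ℂ)) →ₗ[ℂ] (ℤ →₀ (ι → ℂ))).IsSymmetric := by
    intro φ ψ
    rw [hinner, hinner, LinearMap.neg_apply, LinearMap.neg_apply, ← neg_one_smul ℂ,
      blockForm_smul_left, h.blockForm_tridiag, ← neg_one_smul ℂ (tridiag a b c ψ),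
      blockForm_smul_right]
    simp
  obtain ⟨W, hW, hWs, hWm⟩ := hT.exists_matrix_spectral_measure (K := 3 * K + 1) (by positivity)
    (fun v => by
      obtain ⟨C, hC⟩ := exists_norm_blockForm_tridiag_pow_le (S := S) ha hb hc v v
      refine ⟨|C|, fun k => ?_⟩
      rw [hpow, hinner, blockForm_smul_right, norm_mul, norm_pow, norm_neg, norm_one, one_pow,
        one_mul]
      refine (hC k).trans ?_
      have := le_abs_self C
      gcongr
      linarith) φ
  refine ⟨W, hW, ⟨_, hWs⟩, fun k p q => ?_⟩
  rw [hWm, hpow, hinner, blockForm_smul_right]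

open scoped Matrix.Norms.L2Operator in
/-- The measure of the moments of vectors `φ p` represents the powers of the generator on the
invariant subspace which is generated by these vectors, provided that the row transform maps them
to the standard basis. The case of the zeroth power is the orthogonality of the polynomials `P`.
-/
theorem IsSymmetrizer.exists_weight (h : IsSymmetrizer a b c S) {K : ℝ}
    (ha : ∀ n, ‖a n‖ ≤ K) (hb : ∀ n, ‖b n‖ ≤ K) (hc : ∀ n, ‖c n‖ ≤ K)
    {κ : Type*} [Fintype κ] [DecidableEq κ] (φ : κ → ℤ →₀ (ι → ℂ)) {P : ℝ → ℤ → Matrix κ ι ℂ}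
    (hP : ∀ x, IsRowSolution a b c x (P x)) (hPc : ∀ n p q, Continuous fun x => P x n p q)
    (hφ : ∀ x p, rowTransform (P x) (φ p) = Pi.single p 1) :
    ∃ W : MatrixMeasure κ, W.IsPositive ∧ (∃ R : ℝ, ∀ᵐ x ∂W.base, |x| ≤ R) ∧
      ∀ j i, (∀ u, Finsupp.single j u ∈
          Submodule.span ℂ {ψ | ∃ (m : ℕ) (p : κ), ψ = (tridiag a b c ^ m) (φ p)}) →
        (∀ u, Finsupp.single i u ∈
          Submodule.span ℂ {ψ | ∃ (m : ℕ) (p : κ), ψ = (tridiag a b c ^ m) (φ p)}) →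
        ∀ (k : ℕ) p q, ∫ x : ℝ, (x : ℂ) ^ k * ((P x j)ᴴ * W.density x * P x i) p q ∂W.base =
          (-1) ^ k * (S j * triPow a b c k j i) p q := by
  obtain ⟨W, hW, ⟨R, hR⟩, hWm⟩ := h.exists_moment_measure ha hb hc φ
  refine ⟨W, hW, ⟨R, hR⟩, ?_⟩
  -- `F ψ χ` is the density of the form in the transformed vectors
  let F : (ℤ →₀ (ι → ℂ)) → (ℤ →₀ (ι → ℂ)) → ℝ → ℂ := fun ψ χ x =>
    star (rowTransform (P x) ψ) ⬝ᵥ (W.density x *ᵥ rowTransform (P x) χ)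
  have hcont : ∀ ψ p, Continuous fun x => rowTransform (P x) ψ p := by
    intro ψ p
    simp_rw [rowTransform_apply, Finset.sum_apply, Matrix.mulVec, dotProduct]
    exact continuous_finsetSum _ fun n _ => continuous_finsetSum _ fun q _ =>
      (hPc n p q).mul continuous_const
  have hint : ∀ (k : ℕ) ψ χ, Integrable (fun x : ℝ => (x : ℂ) ^ k * F ψ χ x) W.base := by
    intro k ψ χ
    have e : ∀ x : ℝ, (x : ℂ) ^ k * F ψ χ x = ∑ p, ∑ q, ((x : ℂ) ^ k *
        star (rowTransform (P x) ψ p) * rowTransform (P x) χ q) * W.density x p q := fun x => by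
      simp only [F, dotProduct, Matrix.mulVec, Pi.star_apply, Finset.mul_sum]
      exact Finset.sum_congr rfl fun p _ => Finset.sum_congr rfl fun q _ => by ring
    simp_rw [e]
    refine integrable_finsetSum _ fun p _ => integrable_finsetSum _ fun q _ => ?_
    have h1 := hcont ψ p
    have h2 := hcont χ q
    exact Continuous.integrable_mul_of_ae_le (f := fun x : ℝ => (x : ℂ) ^ k *
      star (rowTransform (P x) ψ p) * rowTransform (P x) χ q) (W.integrable p q)
      (hR.mono fun x hx hx' => absurd hx (not_le.2 hx')) (by fun_prop)
  let G : Set (ℤ →₀ (ι → ℂ)) := {ψ | ∃ (m : ℕ) (p : κ), ψ = (tridiag a b c ^ m) (φ p)}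
  have key : ∀ ψ ∈ Submodule.span ℂ G, ∀ χ ∈ Submodule.span ℂ G, ∀ k : ℕ,
      ∫ x : ℝ, (x : ℂ) ^ k * F ψ χ x ∂W.base =
        (-1) ^ k * blockForm S ψ ((tridiag a b c ^ k) χ) := by
    intro ψ hψ χ hχ k
    induction hψ using Submodule.span_induction with
    | zero => simp [F, blockForm_zero_left]
    | add ψ ψ' _ _ h1 h2 =>
      have e : ∀ x : ℝ, (x : ℂ) ^ k * F (ψ + ψ') χ x =
          (x : ℂ) ^ k * F ψ χ x + (x : ℂ) ^ k * F ψ' χ x := fun x => by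
        simp [F, add_dotProduct, mul_add]
      simp_rw [e]
      rw [integral_add (hint _ _ _) (hint _ _ _), h1, h2, blockForm_add_left, mul_add]
    | smul z ψ _ h1 =>
      have e : ∀ x : ℝ, (x : ℂ) ^ k * F (z • ψ) χ x = star z * ((x : ℂ) ^ k * F ψ χ x) :=
        fun x => by simp [F]; ring
      simp_rw [e]
      rw [integral_const_mul, h1, blockForm_smul_left]
      ring
    | mem ψ hψ =>
      obtain ⟨m, p, rfl⟩ := hψ
      induction hχ using Submodule.span_induction with
      | zero => simp [F, blockForm_zero_right]
      | add χ χ' _ _ h1 h2 =>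
        have e : ∀ x : ℝ, (x : ℂ) ^ k * F ((tridiag a b c ^ m) (φ p)) (χ + χ') x =
            (x : ℂ) ^ k * F ((tridiag a b c ^ m) (φ p)) χ x
              + (x : ℂ) ^ k * F ((tridiag a b c ^ m) (φ p)) χ' x := fun x => by
          simp [F, Matrix.mulVec_add, dotProduct_add, mul_add]
        simp_rw [e]
        rw [integral_add (hint _ _ _) (hint _ _ _), h1, h2, map_add, blockForm_add_right, mul_add]
      | smul z χ _ h1 =>
        have e : ∀ x : ℝ, (x : ℂ) ^ k * F ((tridiag a b c ^ m) (φ p)) (z • χ) x =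
            z * ((x : ℂ) ^ k * F ((tridiag a b c ^ m) (φ p)) χ x) := fun x => by
          simp [F, Matrix.mulVec_smul, dotProduct_smul]; ring
        simp_rw [e]
        rw [integral_const_mul, h1, map_smul, blockForm_smul_right]
        ring
      | mem χ hχ =>
        obtain ⟨l, q, rfl⟩ := hχ
        have e : ∀ x : ℝ, (x : ℂ) ^ k * F ((tridiag a b c ^ m) (φ p)) ((tridiag a b c ^ l) (φ q)) x
            = (-1) ^ (m + l) * ((x : ℂ) ^ (k + m + l) * W.density x p q) := fun x => by
          simp only [F]
          rw [(hP x).rowTransform_tridiag_pow, (hP x).rowTransform_tridiag_pow, hφ, hφ]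
          simp only [star_smul, smul_dotProduct, Matrix.mulVec_smul, dotProduct_smul,
            Matrix.mulVec_single_one, Pi.star_single, star_one, single_one_dotProduct, smul_eq_mul,
            Matrix.col_apply, star_pow, star_neg, Complex.star_def, Complex.conj_ofReal]
          rw [neg_pow (x : ℂ) m, neg_pow (x : ℂ) l]
          ring
        simp_rw [e]
        rw [integral_const_mul, hWm, h.blockForm_tridiag_pow, ← Module.End.mul_apply,
          ← Module.End.mul_apply, ← pow_add, ← pow_add, ← mul_assoc, ← pow_add,
          show m + l + (k + m + l) = k + 2 * (m + l) by ring,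
          show m + k + l = k + m + l by ring, pow_add, pow_mul]
        simp
  intro j i hj hi k p q
  have hk := key _ (hj (Pi.single p 1)) _ (hi (Pi.single q 1)) k
  rw [blockForm_single_left, tridiag_pow_single_apply] at hk
  have e1 : star (Pi.single p (1 : ℂ) : ι → ℂ) ⬝ᵥ (S j *ᵥ (triPow a b c k j i *ᵥ Pi.single q 1)) =
      (S j * triPow a b c k j i) p q := by
    rw [Matrix.mulVec_mulVec]
    simp
  rw [e1] at hk
  rw [← hk]
  refine integral_congr_ae (Filter.Eventually.of_forall fun x => ?_)
  simp only [F, rowTransform_single, Matrix.star_mulVec, ← Matrix.dotProduct_mulVec,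
    Matrix.mulVec_mulVec]
  congr 1
  simp [Matrix.mul_assoc]

/-- An invariant subspace which contains the vectors at the site `0`, and those at `-1` which can be
reached from there in one step, contains all vectors at nonnegative sites. -/
theorem single_mem_of_nonneg {M : Submodule ℂ (ℤ →₀ (ι → ℂ))}
    (hM : ∀ ψ ∈ M, tridiag a b c ψ ∈ M) (ha : ∀ n, 0 ≤ n → IsUnit (a n))
    (h0 : ∀ u, Finsupp.single 0 u ∈ M) (h1 : ∀ u, Finsupp.single (-1) (c 0 *ᵥ u) ∈ M)
    (n : ℕ) (u : ι → ℂ) : Finsupp.single (n : ℤ) u ∈ M := by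
  suffices ∀ n : ℕ, (∀ u, Finsupp.single (n : ℤ) u ∈ M) ∧
      ∀ u, Finsupp.single ((n : ℤ) - 1) (c n *ᵥ u) ∈ M from (this n).1 u
  intro n
  induction n with
  | zero => exact ⟨h0, by simpa using h1⟩
  | succ n ih =>
    refine ⟨fun u => ?_, fun u => by simpa using ih.1 _⟩
    have hu := ha n (Int.natCast_nonneg n)
    have e := tridiag_single a b c n ((a n)⁻¹ *ᵥ u)
    rw [Matrix.mulVec_mulVec, Matrix.mul_nonsing_inv _ ((Matrix.isUnit_iff_isUnit_det _).1 hu),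
      Matrix.one_mulVec, add_assoc] at e
    push_cast
    rw [← sub_eq_of_eq_add e]
    exact M.sub_mem (hM _ (ih.1 _)) (M.add_mem (ih.1 _) (ih.2 _))

/-- The mirror image of `single_mem_of_nonneg`. -/
theorem single_mem_of_neg {M : Submodule ℂ (ℤ →₀ (ι → ℂ))}
    (hM : ∀ ψ ∈ M, tridiag a b c ψ ∈ M) (hc : ∀ n, n ≤ -1 → IsUnit (c n))
    (h0 : ∀ u, Finsupp.single (-1) u ∈ M) (h1 : ∀ u, Finsupp.single 0 (a (-1) *ᵥ u) ∈ M)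
    (n : ℕ) (u : ι → ℂ) : Finsupp.single (-(n : ℤ) - 1) u ∈ M := by
  suffices ∀ n : ℕ, (∀ u, Finsupp.single (-(n : ℤ) - 1) u ∈ M) ∧
      ∀ u, Finsupp.single (-(n : ℤ)) (a (-(n : ℤ) - 1) *ᵥ u) ∈ M from (this n).1 u
  intro n
  induction n with
  | zero => exact ⟨by simpa using h0, by simpa using h1⟩
  | succ n ih =>
    refine ⟨fun u => ?_, fun u => ?_⟩
    · have hu := hc (-(n : ℤ) - 1) (by omega)
      have e := tridiag_single a b c (-(n : ℤ) - 1) ((c (-(n : ℤ) - 1))⁻¹ *ᵥ u)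
      have hcu : c (-(n : ℤ) - 1) *ᵥ ((c (-(n : ℤ) - 1))⁻¹ *ᵥ u) = u := by
        rw [Matrix.mulVec_mulVec, Matrix.mul_nonsing_inv _ ((Matrix.isUnit_iff_isUnit_det _).1 hu),
          Matrix.one_mulVec]
      rw [hcu, sub_add_cancel] at e
      push_cast
      rw [show -((n : ℤ) + 1) - 1 = -(n : ℤ) - 1 - 1 by ring, ← sub_eq_iff_eq_add'.2 e]
      exact M.sub_mem (hM _ (ih.1 _)) (M.add_mem (ih.2 _) (ih.1 _))
    · push_cast
      rw [show -((n : ℤ) + 1) = -(n : ℤ) - 1 by ring]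
      exact ih.1 _

end Existence

/-! ### Stieltjes transforms of positive matrix measures with given Laplace transform -/

/-- A positive matrix measure whose Laplace transform is bounded and given by an exponential series
`∑ t ^ k / k! h k` lives on `[0, ∞)`, and its Stieltjes transform is given at large negative
numbers by the corresponding Neumann series. -/
theorem MatrixMeasure.IsPositive.stieltjes_of_laplace {κ : Type*} [Fintype κ]
    {W : MatrixMeasure κ} (hW : W.IsPositive) {h : ℕ → Matrix κ κ ℂ} {K : ℝ} (hK : 0 ≤ K)
    (hC : ∀ p q, ∃ C : ℝ, ∀ k, ‖h k p q‖ ≤ C * K ^ k)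
    (hi : ∀ t : ℝ, 0 ≤ t → ∀ p q,
      Integrable (fun x => (Real.exp (-x * t) : ℂ) * W.density x p q) W.base)
    (he : ∀ t : ℝ, 0 ≤ t → ∀ p q, ∫ x, (Real.exp (-x * t) : ℂ) * W.density x p q ∂W.base =
      ∑' k : ℕ, (t : ℂ) ^ k / (k.factorial : ℂ) * h k p q)
    (hb : ∀ p, ∃ C : ℝ, ∀ t : ℝ, 0 ≤ t →
      ‖∑' k : ℕ, (t : ℂ) ^ k / (k.factorial : ℂ) * h k p p‖ ≤ C) :
    (∀ᵐ x ∂W.base, x < 0 → W.density x = 0) ∧ ∀ r : ℝ, K < r → ∀ p q,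
      ∫ x, W.density x p q / ((x : ℂ) + (r : ℂ)) ∂W.base =
        ∑' k : ℕ, (r : ℂ)⁻¹ ^ (k + 1) * h k p q := by
  have := W.isFinite
  have e : ∀ (n : ℕ) (x : ℝ), Real.exp (-x) ^ n = Real.exp (-x * n) := fun n x => by
    rw [← Real.exp_nat_mul, mul_comm]
  have h0 : ∀ᵐ x ∂W.base, x < 0 → W.density x = 0 := by
    have := hW.density_eq_zero_of_growth (u := fun x => Real.exp (-x)) (r := 1)
      (fun x => (Real.exp_pos _).le) (by fun_prop) zero_le_one
      (fun p n => by simpa only [e] using hi n n.cast_nonneg p p)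
      (fun p => by
        obtain ⟨C, hC⟩ := hb p
        refine ⟨C, fun n => ?_⟩
        simp only [e]
        rw [he n n.cast_nonneg, one_pow, mul_one]
        exact hC n n.cast_nonneg)
    filter_upwards [this] with x hx hx0
    exact hx (Real.one_lt_exp_iff.2 (neg_pos.2 hx0))
  refine ⟨h0, fun r hr p q => ?_⟩
  obtain ⟨C, hC⟩ := hC p q
  exact integral_div_ofReal_add_eq_tsum (W.integrable p q)
    (h0.mono fun x hx hx0 => by rw [hx hx0]; rfl) hK hC (fun t ht => he t ht p q) hr

/-! ### Orthogonality and moments -/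

section Moments

open scoped Matrix.Norms.L2Operator

variable {ι : Type*} [Fintype ι] [DecidableEq ι] {a b c : ℤ → Matrix ι ι ℂ}

theorem norm_mul_triPow_apply_le {K : ℝ} (ha : ∀ n, ‖a n‖ ≤ K) (hb : ∀ n, ‖b n‖ ≤ K)
    (hc : ∀ n, ‖c n‖ ≤ K) (M : Matrix ι ι ℂ) (k : ℕ) (j i : ℤ) (p q : ι) :
    ‖(M * triPow a b c k j i) p q‖ ≤ ‖M‖ * ‖(1 : Matrix ι ι ℂ)‖ * (3 * K) ^ k := by
  refine (Matrix.norm_entry_le_l2_opNorm _ p q).trans ((norm_mul_le _ _).trans ?_)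
  rw [mul_assoc]
  gcongr
  exact norm_triPow_le a b c ha hb hc k j i

theorem summable_norm_exp_triPow {K : ℝ} (ha : ∀ n, ‖a n‖ ≤ K) (hb : ∀ n, ‖b n‖ ≤ K)
    (hc : ∀ n, ‖c n‖ ≤ K) (j i : ℤ) (t : ℝ) :
    Summable fun k : ℕ => ‖((t : ℂ) ^ k / (k.factorial : ℂ)) • triPow a b c k j i‖ := by
  have hK : 0 ≤ K := (norm_nonneg _).trans (ha 0)
  refine Summable.of_nonneg_of_le (fun _ => norm_nonneg _) (fun k => ?_)
    ((Real.summable_pow_div_factorial (|t| * (3 * K))).mul_left ‖(1 : Matrix ι ι ℂ)‖)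
  rw [norm_smul, norm_div, norm_pow, Complex.norm_real, Complex.norm_natCast, Real.norm_eq_abs]
  calc _ ≤ |t| ^ k / (k.factorial : ℝ) * (‖(1 : Matrix ι ι ℂ)‖ * (3 * K) ^ k) := by
        gcongr
        exact norm_triPow_le a b c ha hb hc k j i
    _ = _ := by rw [mul_pow]; ring

theorem Matrix.mul_tsum_apply {f : ℕ → Matrix ι ι ℂ} (hf : Summable fun k => ‖f k‖)
    (M : Matrix ι ι ℂ) (p q : ι) : (M * ∑' k, f k) p q = ∑' k, (M * f k) p q := by
  have h1 : HasSum (fun k => M * f k) (M * ∑' k, f k) := hf.of_norm.hasSum.mul_left M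
  let φ : Matrix ι ι ℂ →ₗ[ℂ] ℂ := Matrix.entryLinearMap ℂ ℂ p q
  exact (h1.mapL φ.toContinuousLinearMap).tsum_eq.symm

/-- If the solution `P` of the three-term recurrence with `P s = 1` is orthogonal to its member at
the site `s`, then the moments of the measure are the blocks of the powers of the generator. -/
theorem MatrixMeasure.moments_of_orthogonal {W : MatrixMeasure ι} {P : ℝ → ℤ → Matrix ι ι ℂ}
    (hP : ∀ x, IsRowSolution a b c x (P x)) {s : ℤ} (hs : ∀ x, P x s = 1)
    (hi : ∀ j p q, Integrable (fun x => (W.density x * P x j) p q) W.base)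
    (ho : ∀ j, j ≠ s → ∀ p q, ∫ x, (W.density x * P x j) p q ∂W.base = 0) (k : ℕ) (p q : ι) :
    Integrable (fun x : ℝ => (x : ℂ) ^ k * W.density x p q) W.base ∧
      ∫ x : ℝ, (x : ℂ) ^ k * W.density x p q ∂W.base =
        (-1) ^ k * (W.mass * triPow a b c k s s) p q := by
  let φ := (tridiag a b c ^ k) (Finsupp.single s (Pi.single q 1))
  have e : ∀ x : ℝ, (x : ℂ) ^ k * W.density x p q =
      (-1) ^ k * ∑ n ∈ φ.support, ∑ m, (W.density x * P x n) p m * φ n m := by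
    intro x
    have h1 := (hP x).rowTransform_tridiag_pow k (Finsupp.single s (Pi.single q 1))
    rw [rowTransform_single, hs, Matrix.one_mulVec, rowTransform_apply] at h1
    have h2 := congrArg (fun v => (W.density x *ᵥ v) p) h1
    simp only [Matrix.mulVec_smul, Matrix.mulVec_single_one, Pi.smul_apply, smul_eq_mul,
      Matrix.col_apply] at h2
    rw [Matrix.mulVec_sum, Finset.sum_apply] at h2
    simp only [Matrix.mulVec_mulVec] at h2
    change ∑ n ∈ φ.support, ∑ m, (W.density x * P x n) p m * φ n m = _ at h2
    rw [h2, neg_pow (x : ℂ), ← mul_assoc, ← mul_assoc, ← mul_pow]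
    simp
  have hint : ∀ n, Integrable (fun x => ∑ m, (W.density x * P x n) p m * φ n m) W.base :=
    fun n => integrable_finsetSum _ fun m _ => (hi n p m).mul_const _
  simp_rw [e]
  refine ⟨(integrable_finsetSum _ fun n _ => hint n).const_mul _, ?_⟩
  rw [integral_const_mul, integral_finsetSum _ fun n _ => hint n]
  congr 1
  have h3 : ∀ n, ∫ x, ∑ m, (W.density x * P x n) p m * φ n m ∂W.base =
      if n = s then (W.mass * triPow a b c k s s) p q else 0 := by
    intro n
    rw [integral_finsetSum _ fun m _ => (hi n p m).mul_const _]
    simp_rw [integral_mul_const]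
    split_ifs with hn
    · subst hn
      rw [Matrix.mul_apply]
      refine Finset.sum_congr rfl fun m _ => ?_
      simp only [hs, mul_one, φ, tridiag_pow_single_apply]
      simp [MatrixMeasure.mass]
    · simp [ho n hn]
  simp_rw [h3]
  rw [Finset.sum_ite_eq']
  split_ifs with h4
  · rfl
  · have h5 : triPow a b c k s s *ᵥ Pi.single q 1 = 0 := by
      rw [← tridiag_pow_single_apply]
      exact Finsupp.notMem_support_iff.1 h4
    rw [← Matrix.col_apply (W.mass * _), ← Matrix.mulVec_single_one, ← Matrix.mulVec_mulVec, h5]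
    simp

/-- The Stieltjes transform of an orthogonality weight at large negative numbers. -/
theorem MatrixMeasure.IsPositive.stieltjes_of_orthogonal {W : MatrixMeasure ι} (hW : W.IsPositive)
    {K : ℝ} (ha : ∀ n, ‖a n‖ ≤ K) (hb : ∀ n, ‖b n‖ ≤ K) (hc : ∀ n, ‖c n‖ ≤ K)
    {P : ℝ → ℤ → Matrix ι ι ℂ}
    (hP : ∀ x, IsRowSolution a b c x (P x)) {s : ℤ} (hs : ∀ x, P x s = 1)
    (hi : ∀ j p q, Integrable (fun x => (W.density x * P x j) p q) W.base)
    (ho : ∀ j, j ≠ s → ∀ p q, ∫ x, (W.density x * P x j) p q ∂W.base = 0)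
    (hbd : ∀ p, ∃ C : ℝ, ∀ t : ℝ, 0 ≤ t →
      ‖∑' k : ℕ, (t : ℂ) ^ k / (k.factorial : ℂ) * (W.mass * triPow a b c k s s) p p‖ ≤ C) :
    (∀ᵐ x ∂W.base, x < 0 → W.density x = 0) ∧ ∀ r : ℝ, 3 * K < r →
      W.stieltjes (-(r : ℂ)) = W.mass * resolventBlock a b c r s s := by
  have hK : 0 ≤ K := (norm_nonneg _).trans (ha 0)
  have hm := MatrixMeasure.moments_of_orthogonal hP hs hi ho
  have e : ∀ (n : ℕ) (x : ℝ), (((x ^ 2) ^ n : ℝ) : ℂ) = (x : ℂ) ^ (2 * n) := fun n x => by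
    rw [← pow_mul]; simp
  have hsupp : ∀ᵐ x ∂W.base, 3 * K < |x| → W.density x = 0 := by
    have := hW.density_eq_zero_of_growth (u := fun x => x ^ 2) (r := (3 * K) ^ 2)
      (fun x => sq_nonneg x) (by fun_prop) (sq_nonneg _)
      (fun p n => by simpa only [e] using (hm (2 * n) p p).1)
      (fun p => by
        refine ⟨‖W.mass‖ * ‖(1 : Matrix ι ι ℂ)‖, fun n => ?_⟩
        simp only [e]
        rw [(hm (2 * n) p p).2, norm_mul, norm_pow, norm_neg, norm_one, one_pow, one_mul, ← pow_mul]
        exact norm_mul_triPow_apply_le ha hb hc _ _ _ _ _ _)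
    filter_upwards [this] with x hx hx'
    exact hx (by rw [← sq_abs x]; gcongr)
  obtain ⟨h0, h1⟩ := hW.stieltjes_of_laplace (h := fun k => W.mass * triPow a b c k s s)
    (K := 3 * K) (by positivity)
    (fun p q => ⟨_, fun k => norm_mul_triPow_apply_le ha hb hc _ _ _ _ _ _⟩)
    (fun t _ p q => Continuous.integrable_mul_of_ae_le
      (f := fun x : ℝ => (Real.exp (-x * t) : ℂ)) (W.integrable p q)
      (hsupp.mono fun x hx hx' => by rw [hx hx']; rfl) (by fun_prop))
    (fun t _ p q => integral_exp_neg_mul_eq_tsum (W.integrable p q)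
      (hsupp.mono fun x hx hx' => by rw [hx hx']; rfl) (fun k => (hm k p q).2) t) hbd
  refine ⟨h0, fun r hr => ?_⟩
  ext p q
  have hr' : 3 * K < ‖(r : ℂ)‖ := by
    rw [Complex.norm_real]; exact hr.trans_le (le_abs_self r)
  rw [resolventBlock, Matrix.mul_tsum_apply (summable_norm_resolventBlock ha hb hc hr' s s)]
  simp only [Matrix.mul_smul, Matrix.smul_apply, smul_eq_mul]
  rw [← h1 r hr p q]
  simp [MatrixMeasure.stieltjes]

end Moments

/-! ### Rows of matrix polynomials on the integers -/

section Rows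

variable {ι : Type*}

/-- The family on `ℤ` with values `f k` at `k` and `g k` at `-k - 1`. -/
def intRow {α : Type*} (f g : ℕ → α) : ℤ → α
  | Int.ofNat k => f k
  | Int.negSucc k => g k

theorem intRow_natCast {α : Type*} (f g : ℕ → α) (k : ℕ) : intRow f g (k : ℤ) = f k := rfl

theorem intRow_neg {α : Type*} (f g : ℕ → α) (k : ℕ) : intRow f g (-(k : ℤ) - 1) = g k := by
  rw [show -(k : ℤ) - 1 = Int.negSucc k by rw [Int.negSucc_eq]; ring]
  rfl

theorem Int.exists_eq_natCast_or_eq_neg (n : ℤ) : ∃ k : ℕ, n = k ∨ n = -(k : ℤ) - 1 := by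
  cases n with
  | ofNat k => exact ⟨k, Or.inl rfl⟩
  | negSucc k => exact ⟨k, Or.inr (by rw [Int.negSucc_eq]; ring)⟩

variable [Fintype ι] [DecidableEq ι]

section ThreeTerm

variable {a b c : ℕ → Matrix ι ι ℂ} (p q : Matrix ι ι ℂ) (x : ℝ)

theorem threeTerm_recurrence_zero (ha : IsUnit (a 0)) : -((x : ℂ) • threeTerm a b c p q x 0) =
    threeTerm a b c p q x 1 * a 0 + threeTerm a b c p q x 0 * b 0 + p * c 0 := by
  simp only [threeTerm]
  rw [Matrix.nonsing_inv_mul_cancel_right _ _ ((Matrix.isUnit_iff_isUnit_det _).1 ha)]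
  abel

theorem threeTerm_recurrence_succ {n : ℕ} (ha : IsUnit (a (n + 1))) :
    -((x : ℂ) • threeTerm a b c p q x (n + 1)) =
      threeTerm a b c p q x (n + 2) * a (n + 1) + threeTerm a b c p q x (n + 1) * b (n + 1)
        + threeTerm a b c p q x n * c (n + 1) := by
  rw [threeTerm.eq_3 a b c p q x n,
    Matrix.nonsing_inv_mul_cancel_right _ _ ((Matrix.isUnit_iff_isUnit_det _).1 ha)]
  abel

theorem threeTerm_zero_zero (n : ℕ) : threeTerm a b c 0 0 x n = 0 := by
  induction n using Nat.strong_induction_on with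
  | _ n ih =>
    match n with
    | 0 => rfl
    | 1 => simp [threeTerm]
    | n + 2 => simp [threeTerm, ih n (by omega), ih (n + 1) (by omega)]

theorem continuous_threeTerm (n : ℕ) (r s : ι) :
    Continuous fun x => threeTerm a b c p q x n r s := by
  suffices Continuous fun x => threeTerm a b c p q x n from this.matrix_elem r s
  induction n using Nat.strong_induction_on with
  | _ n ih =>
    match n with
    | 0 => exact continuous_const
    | 1 =>
      simp only [threeTerm]
      fun_prop
    | n + 2 =>
      have h0 := ih n (by omega)
      have h1 := ih (n + 1) (by omega)
      simp only [threeTerm]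
      fun_prop

end ThreeTerm

/-- The solutions of the recurrence on the two half-lines fit together to a solution on `ℤ` as soon
as they do at the sites `0` and `-1`. The coefficients `a'` and `c'` of the resulting recurrence
may differ from `a` and `c` on the edge between these sites. -/
theorem isRowSolution_intRow {a b c a' c' : ℤ → Matrix ι ι ℂ} (ha : ∀ n, 0 ≤ n → IsUnit (a n))
    (hc : ∀ n, n ≤ -1 → IsUnit (c n)) (ha' : ∀ n, n ≠ -1 → a' n = a n)
    (hc' : ∀ n, n ≠ 0 → c' n = c n) {p q p' q' : Matrix ι ι ℂ}
    (h0 : q' * c' 0 = p * c 0) (h1 : q * a' (-1) = p' * a (-1)) (x : ℝ) :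
    IsRowSolution a' b c' x (intRow
      (threeTerm (fun k : ℕ => a k) (fun k : ℕ => b k) (fun k : ℕ => c k) p q x)
      (threeTerm (fun k : ℕ => c (-k - 1)) (fun k : ℕ => b (-k - 1)) (fun k : ℕ => a (-k - 1))
        p' q' x)) := by
  intro n
  obtain ⟨k, rfl | rfl⟩ := Int.exists_eq_natCast_or_eq_neg n
  · rw [ha' _ (by omega), ← Nat.cast_succ, intRow_natCast, intRow_natCast]
    cases k with
    | zero =>
      have := threeTerm_recurrence_zero (a := fun k : ℕ => a k) (b := fun k : ℕ => b k)
        (c := fun k : ℕ => c k) p q x (ha _ le_rfl)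
      rw [this, show ((0 : ℕ) : ℤ) - 1 = -((0 : ℕ) : ℤ) - 1 by simp, intRow_neg]
      simp only [Nat.cast_zero]
      rw [threeTerm.eq_1 _ _ _ p' q', h0]
    | succ k =>
      have := threeTerm_recurrence_succ (a := fun k : ℕ => a k) (b := fun k : ℕ => b k)
        (c := fun k : ℕ => c k) p q x (ha ((k + 1 : ℕ) : ℤ) (by omega))
      rw [this, hc' _ (by omega), show ((k + 1 : ℕ) : ℤ) - 1 = (k : ℕ) by push_cast; ring,
        intRow_natCast]
  · rw [hc' _ (by omega), show -(k : ℤ) - 1 - 1 = -((k + 1 : ℕ) : ℤ) - 1 by push_cast; ring,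
      intRow_neg, intRow_neg]
    cases k with
    | zero =>
      have := threeTerm_recurrence_zero (a := fun k : ℕ => c (-k - 1))
        (b := fun k : ℕ => b (-k - 1)) (c := fun k : ℕ => a (-k - 1)) p' q' x (hc _ (by simp))
      rw [this, sub_add_cancel, show -((0 : ℕ) : ℤ) = ((0 : ℕ) : ℤ) by simp, intRow_natCast,
        threeTerm.eq_1 _ _ _ p q]
      simp only [Nat.cast_zero, zero_sub, zero_add]
      rw [h1]
      abel
    | succ k =>
      have := threeTerm_recurrence_succ (a := fun k : ℕ => c (-k - 1))
        (b := fun k : ℕ => b (-k - 1)) (c := fun k : ℕ => a (-k - 1)) p' q' x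
        (hc (-((k + 1 : ℕ) : ℤ) - 1) (by omega))
      rw [this, ha' _ (by omega), show -((k + 1 : ℕ) : ℤ) - 1 + 1 = -(k : ℤ) - 1 by push_cast; ring,
        intRow_neg]
      abel

end Rows

/-! ### Transition matrices of the walk -/

theorem rep_one {d : ℕ} : rep (1 : Matrix (Fin d) (Fin d) ℂ) = 1 := by
  rw [rep, Matrix.map_one _ (star_zero ℂ) (star_one ℂ), Matrix.one_kronecker_one]

theorem rep_zero {d : ℕ} : rep (0 : Matrix (Fin d) (Fin d) ℂ) = 0 := by
  rw [rep, Matrix.zero_kronecker]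

theorem rep_mul {d : ℕ} (X Y : Matrix (Fin d) (Fin d) ℂ) : rep (X * Y) = rep X * rep Y := by
  refine Matrix.ext_mulVec fun u => ?_
  obtain ⟨ρ, rfl⟩ : ∃ ρ : Matrix (Fin d) (Fin d) ℂ, u = rowVec ρ := ⟨fun i j => u (i, j), rfl⟩
  rw [← Matrix.mulVec_mulVec, rep_mulVec, rep_mulVec, rep_mulVec, Matrix.conjTranspose_mul]
  simp only [mul_assoc]

theorem isUnit_rep {d : ℕ} {X : Matrix (Fin d) (Fin d) ℂ} (hX : IsUnit X) : IsUnit (rep X) := by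
  obtain ⟨Y, hY⟩ := hX.exists_right_inv
  exact IsUnit.of_mul_eq_one (rep Y) (by rw [← rep_mul, hY, rep_one])

theorem cutAt_rep {d : ℕ} (n₀ : ℤ) (A : ℤ → Matrix (Fin d) (Fin d) ℂ) :
    cutAt n₀ (fun n => rep (A n)) = fun n => rep (cutAt n₀ A n) := by
  funext n
  by_cases h : n = n₀
  · subst h; simp [rep_zero]
  · rw [cutAt_of_ne h, cutAt_of_ne h]

namespace TridiagonalCTOQW

variable {d : ℕ} (w : TridiagonalCTOQW d)

open scoped Matrix.Norms.L2Operator in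
theorem exists_norm_rep_le :
    ∃ K : ℝ, ∀ n, ‖rep (w.A n)‖ ≤ K ∧ ‖w.diag n‖ ≤ K ∧ ‖rep (w.C n)‖ ≤ K := by
  obtain ⟨K, hK, hw⟩ := w.exists_norm_le
  obtain ⟨c, hc⟩ := Matrix.exists_l2_opNorm_le_of_entries (ι := Fin d × Fin d)
  have hent : ∀ {X : Matrix (Fin d) (Fin d) ℂ}, ‖X‖ ≤ K → ∀ p q, ‖X p q‖ ≤ K :=
    fun h p q => (Matrix.norm_entry_le_l2_opNorm _ p q).trans h
  have hrep : ∀ {X : Matrix (Fin d) (Fin d) ℂ}, ‖X‖ ≤ K → ∀ p q, ‖rep X p q‖ ≤ K * K := by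
    intro X h p q
    rw [rep, Matrix.kroneckerMap_apply, norm_mul, Matrix.map_apply, norm_star]
    gcongr
    · exact hent h _ _
    · exact hent h _ _
  have hone : ∀ p q : Fin d, ‖(1 : Matrix (Fin d) (Fin d) ℂ) p q‖ ≤ 1 := fun p q => by
    rw [Matrix.one_apply]; split_ifs <;> simp
  have hadd : ∀ {X : Matrix (Fin d) (Fin d) ℂ}, ‖X‖ ≤ K → ∀ p q, ‖repAdd X p q‖ ≤ 2 * K := by
    intro X h p q
    rw [repAdd, Matrix.add_apply, Matrix.kroneckerMap_apply, Matrix.kroneckerMap_apply,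
      Matrix.map_apply]
    refine (norm_add_le _ _).trans ?_
    rw [norm_mul, norm_mul, norm_star, two_mul]
    refine add_le_add ?_ ?_
    · simpa using mul_le_mul (hent h _ _) (hone _ _) (norm_nonneg _) hK
    · simpa using mul_le_mul (hone _ _) (hent h _ _) (norm_nonneg _) zero_le_one
  refine ⟨max (c * (K * K)) (c * (2 * K + K * K)), fun n => ⟨?_, ?_, ?_⟩⟩
  · exact (hc _ _ (hrep (hw n).2.1)).trans (le_max_left _ _)
  · exact (hc _ _ fun p q => (norm_add_le _ _).trans
      (add_le_add (hadd (hw n).1 p q) (hrep (hw n).2.2.1 p q))).trans (le_max_right _ _)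
  · exact (hc _ _ (hrep (hw n).2.2.2)).trans (le_max_left _ _)

variable {w} in
theorem Symmetrizable.isSymmetrizer {R E : ℤ → Matrix (Fin d × Fin d) (Fin d × Fin d) ℂ}
    (h : w.Symmetrizable R E) : IsSymmetrizer (fun n => rep (w.A n)) w.diag (fun n => rep (w.C n))
      (fun n => (R n)ᴴ * R n) where
  posDef n :=
    Matrix.PosDef.conjTranspose_mul_self _ (Matrix.mulVec_injective_of_isUnit (h.isUnit_R n))
  off_diag n := by
    rcases le_or_gt 0 n with hn | hn
    · exact h.right n hn
    · have := h.left (-n - 1) (by omega)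
      rw [show -(-n - 1) - 1 = n by ring, show -(-n - 1) = n + 1 by ring] at this
      exact this.symm
  diag n := by
    have h1 : (w.diag n)ᴴ * (R n)ᴴ = (R n)ᴴ * E n := by
      have := congrArg Matrix.conjTranspose (h.diagonal n)
      rwa [Matrix.conjTranspose_mul, Matrix.conjTranspose_mul, (h.isHermitian_E n).eq] at this
    rw [← mul_assoc, h1, mul_assoc, mul_assoc, h.diagonal]

end TridiagonalCTOQW

/-- Without the edge between `-1` and `0`, both sides of the relation for this edge vanish. -/
theorem IsSymmetrizer.cutAt {ι : Type*} [Fintype ι] {a b c S : ℤ → Matrix ι ι ℂ}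
    (h : IsSymmetrizer a b c S) : IsSymmetrizer (cutAt (-1) a) b (cutAt 0 c) S where
  posDef := h.posDef
  off_diag n := by
    by_cases hn : n = -1
    · subst hn; simp
    · rw [cutAt_of_ne hn, cutAt_of_ne (by omega), h.off_diag]
  diag := h.diag

section

open scoped Matrix.Norms.L2Operator

namespace TridiagonalCTOQW

variable {d : ℕ} {w : TridiagonalCTOQW d}

theorem exists_norm_tsum_mul_triPow_le {S T : ℤ → Matrix (Fin d) (Fin d) ℂ}
    (hS : IsSubfamily w.A S) (hT : IsSubfamily w.C T) {K : ℝ} (ha : ∀ n, ‖rep (S n)‖ ≤ K)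
    (hb : ∀ n, ‖w.diag n‖ ≤ K) (hc : ∀ n, ‖rep (T n)‖ ≤ K)
    (M : Matrix (Fin d × Fin d) (Fin d × Fin d) ℂ) (j i : ℤ) (p q : Fin d × Fin d) :
    ∃ C : ℝ, ∀ t : ℝ, 0 ≤ t → ‖∑' k : ℕ, (t : ℂ) ^ k / (k.factorial : ℂ) *
      (M * triPow (fun n => rep (S n)) w.diag (fun n => rep (T n)) k j i) p q‖ ≤ C := by
  choose C hC using fun m => exists_norm_tsum_triPow_le hS hT j i m q
  refine ⟨∑ m, ‖M p m‖ * C m, fun t ht => ?_⟩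
  have h1 := Matrix.mul_tsum_apply (summable_norm_exp_triPow ha hb hc j i t) M p q
  have h2 := fun m => Matrix.mul_tsum_apply (summable_norm_exp_triPow ha hb hc j i t) 1 m q
  simp only [Matrix.mul_smul, Matrix.smul_apply, smul_eq_mul, one_mul] at h1 h2
  rw [← h1, Matrix.mul_apply]
  refine (norm_sum_le _ _).trans (Finset.sum_le_sum fun m _ => ?_)
  rw [norm_mul, h2]
  gcongr
  exact hC m t ht

end TridiagonalCTOQW

end

/-! ### Construction of weight matrices -/

theorem MatrixMeasure.integrable_of_continuous {ι κ : Type*} [Fintype κ] {W : MatrixMeasure κ}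
    {R : ℝ} (hR : ∀ᵐ x ∂W.base, |x| ≤ R) {f : ℝ → ℂ} (hf : Continuous f)
    {P Q : ℝ → Matrix κ ι ℂ} (hP : ∀ p q, Continuous fun x => P x p q)
    (hQ : ∀ p q, Continuous fun x => Q x p q) (p q : ι) :
    Integrable (fun x => f x * ((P x)ᴴ * W.density x * Q x) p q) W.base := by
  have e : ∀ x, f x * ((P x)ᴴ * W.density x * Q x) p q =
      ∑ s, ∑ r, (f x * star (P x r p) * Q x s q) * W.density x r s := fun x => by
    simp only [Matrix.mul_apply, Matrix.conjTranspose_apply, Finset.sum_mul, Finset.mul_sum]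
    exact Finset.sum_congr rfl fun r _ => Finset.sum_congr rfl fun s _ => by ring
  simp_rw [e]
  refine integrable_finsetSum _ fun s _ => integrable_finsetSum _ fun r _ => ?_
  have h1 := hP r p
  have h2 := hQ s q
  exact Continuous.integrable_mul_of_ae_le (f := fun x => f x * star (P x r p) * Q x s q)
    (W.integrable r s) (hR.mono fun x hx hx' => absurd hx (not_le.2 hx')) (by fun_prop)

section Existence

open scoped Matrix.Norms.L2Operator

variable {ι : Type*} [Fintype ι] {a b c S : ℤ → Matrix ι ι ℂ}

theorem tridiag_mem_span {κ : Type*} (φ : κ → ℤ →₀ (ι → ℂ)) (ψ : ℤ →₀ (ι → ℂ))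
    (hψ : ψ ∈ Submodule.span ℂ {ψ | ∃ (m : ℕ) (p : κ), ψ = (tridiag a b c ^ m) (φ p)}) :
    tridiag a b c ψ ∈
      Submodule.span ℂ {ψ | ∃ (m : ℕ) (p : κ), ψ = (tridiag a b c ^ m) (φ p)} := by
  induction hψ using Submodule.span_induction with
  | zero => rw [map_zero]; exact zero_mem _
  | add ψ χ _ _ h1 h2 => rw [map_add]; exact add_mem h1 h2
  | smul z ψ _ h => rw [map_smul]; exact Submodule.smul_mem _ _ h
  | mem ψ h =>
    obtain ⟨m, p, rfl⟩ := h
    exact Submodule.subset_span ⟨m + 1, p, by rw [pow_succ', Module.End.mul_apply]⟩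

variable [DecidableEq ι]

theorem single_mem_of_basis {M : Submodule ℂ (ℤ →₀ (ι → ℂ))} {n : ℤ}
    (h : ∀ p, Finsupp.single n (Pi.single p 1) ∈ M) (u : ι → ℂ) : Finsupp.single n u ∈ M := by
  have : Finsupp.single n u = ∑ p, u p • Finsupp.single n (Pi.single p (1 : ℂ)) := by
    conv_lhs => rw [pi_eq_sum_univ' u]
    rw [← Finsupp.lsingle_apply (R := ℂ), map_sum]
    simp only [map_smul, Finsupp.lsingle_apply]
  rw [this]
  exact sum_mem fun p _ => M.smul_mem _ (h p)

/-- An orthogonality weight for the solution `P` of the three-term recurrence with initial value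
`1` at the site `σ 0`, restricted to the sites `σ k` which can be reached from there. -/
theorem IsSymmetrizer.exists_orthogonalityWeight (h : IsSymmetrizer a b c S) {K : ℝ}
    (ha : ∀ n, ‖a n‖ ≤ K) (hb : ∀ n, ‖b n‖ ≤ K) (hc : ∀ n, ‖c n‖ ≤ K)
    {P : ℝ → ℤ → Matrix ι ι ℂ} (hP : ∀ x, IsRowSolution a b c x (P x))
    (hPc : ∀ n p q, Continuous fun x => P x n p q) {σ : ℕ → ℤ} (hσ : Function.Injective σ)
    (h1 : ∀ x, P x (σ 0) = 1)
    (hmem : ∀ M : Submodule ℂ (ℤ →₀ (ι → ℂ)), (∀ ψ ∈ M, tridiag a b c ψ ∈ M) →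
      (∀ u, Finsupp.single (σ 0) u ∈ M) → ∀ k u, Finsupp.single (σ k) u ∈ M) :
    ∃ W : MatrixMeasure ι, W.IsOrthogonalityWeight fun x k => P x (σ k) := by
  let φ : ι → ℤ →₀ (ι → ℂ) := fun p => Finsupp.single (σ 0) (Pi.single p 1)
  obtain ⟨W, hW, ⟨R, hR⟩, hWm⟩ := h.exists_weight ha hb hc φ hP hPc
    (fun x p => by rw [rowTransform_single, h1, Matrix.one_mulVec])
  have hm := hmem _ (tridiag_mem_span (a := a) (b := b) (c := c) φ)
    (single_mem_of_basis fun p => Submodule.subset_span ⟨0, p, rfl⟩)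
  have hpair : ∀ j i, W.pair (fun _ => 1) (fun x => P x (σ j)) (fun x => P x (σ i)) =
      S (σ j) * if σ j = σ i then 1 else 0 := by
    intro j i
    ext p q
    have := hWm (σ j) (σ i) (hm j) (hm i) 0 p q
    simpa [MatrixMeasure.pair, triPow] using this
  refine ⟨W, hW, fun j i p q => ?_, fun j i hji => ?_, fun i => ?_⟩
  · have := MatrixMeasure.integrable_of_continuous hR (f := fun _ => 1) continuous_const
      (hPc (σ j)) (hPc (σ i)) p q
    simpa using this
  · rw [hpair, if_neg (hσ.ne hji), mul_zero]
  · rw [hpair, if_pos rfl, mul_one]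
    exact (h.posDef _).isUnit

end Existence

section Walk

open scoped Matrix.Norms.L2Operator

namespace TridiagonalCTOQW

variable {d : ℕ} (w : TridiagonalCTOQW d)

theorem poly_eq_intRow (α : Fin 2) (n : ℤ) (x : ℝ) : w.poly α n x =
    intRow (w.rightPoly (if α = 0 then 0 else 1) (if α = 0 then 1 else 0) x)
      (w.leftPoly (if α = 0 then 1 else 0) (if α = 0 then 0 else 1) x) n := by
  cases n <;> rfl

variable {w}

theorem continuous_poly (α : Fin 2) (n : ℤ) (p q : Fin d × Fin d) :
    Continuous fun x => w.poly α n x p q := by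
  obtain ⟨k, rfl | rfl⟩ := Int.exists_eq_natCast_or_eq_neg n
  · simp only [poly_eq_intRow, intRow_natCast]
    exact continuous_threeTerm _ _ _ _ _
  · simp only [poly_eq_intRow, intRow_neg]
    exact continuous_threeTerm _ _ _ _ _

theorem isRowSolution_poly (hA : ∀ n : ℤ, 0 ≤ n → IsUnit (w.A n))
    (hC : ∀ n : ℤ, n ≤ -1 → IsUnit (w.C n)) (α : Fin 2) (x : ℝ) :
    IsRowSolution (fun n => rep (w.A n)) w.diag (fun n => rep (w.C n)) x
      (fun n => w.poly α n x) := by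
  simp only [poly_eq_intRow]
  exact isRowSolution_intRow (fun n hn => isUnit_rep (hA n hn)) (fun n hn => isUnit_rep (hC n hn))
    (fun _ _ => rfl) (fun _ _ => rfl) (by simp) (by simp) x

/-- The polynomials of the walk on the sites `0, 1, …`, extended by zero: the recurrence on the
negative sites is solved with vanishing initial values. -/
def rightRow (w : TridiagonalCTOQW d) (x : ℝ) : ℤ → Matrix (Fin d × Fin d) (Fin d × Fin d) ℂ :=
  intRow (w.rightPoly 0 1 x) (w.leftPoly 0 0 x)

/-- The polynomials of the walk on the sites `-1, -2, …`, extended by zero: the recurrence on the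
nonnegative sites is solved with vanishing initial values. -/
def leftRow (w : TridiagonalCTOQW d) (x : ℝ) : ℤ → Matrix (Fin d × Fin d) (Fin d × Fin d) ℂ :=
  intRow (w.rightPoly 0 0 x) (w.leftPoly 0 1 x)

theorem isRowSolution_rightRow (hA : ∀ n : ℤ, 0 ≤ n → IsUnit (w.A n))
    (hC : ∀ n : ℤ, n ≤ -1 → IsUnit (w.C n)) (x : ℝ) :
    IsRowSolution (cutAt (-1) fun n => rep (w.A n)) w.diag (cutAt 0 fun n => rep (w.C n)) x
      (w.rightRow x) :=
  isRowSolution_intRow (fun n hn => isUnit_rep (hA n hn)) (fun n hn => isUnit_rep (hC n hn))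
    (fun _ h => cutAt_of_ne h) (fun _ h => cutAt_of_ne h) (by simp) (by simp) x

theorem isRowSolution_leftRow (hA : ∀ n : ℤ, 0 ≤ n → IsUnit (w.A n))
    (hC : ∀ n : ℤ, n ≤ -1 → IsUnit (w.C n)) (x : ℝ) :
    IsRowSolution (cutAt (-1) fun n => rep (w.A n)) w.diag (cutAt 0 fun n => rep (w.C n)) x
      (w.leftRow x) :=
  isRowSolution_intRow (fun n hn => isUnit_rep (hA n hn)) (fun n hn => isUnit_rep (hC n hn))
    (fun _ h => cutAt_of_ne h) (fun _ h => cutAt_of_ne h) (by simp) (by simp) x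

theorem continuous_intRow_poly (p q p' q' : Matrix (Fin d × Fin d) (Fin d × Fin d) ℂ) (n : ℤ)
    (r s : Fin d × Fin d) :
    Continuous fun x => intRow (w.rightPoly p q x) (w.leftPoly p' q' x) n r s := by
  obtain ⟨k, rfl | rfl⟩ := Int.exists_eq_natCast_or_eq_neg n
  · simp only [intRow_natCast]
    exact continuous_threeTerm _ _ _ _ _
  · simp only [intRow_neg]
    exact continuous_threeTerm _ _ _ _ _

variable {R E : ℤ → Matrix (Fin d × Fin d) (Fin d × Fin d) ℂ}

theorem Symmetrizable.exists_isRightWeight (hRE : w.Symmetrizable R E)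
    (hA : ∀ n : ℤ, 0 ≤ n → IsUnit (w.A n)) (hC : ∀ n : ℤ, n ≤ -1 → IsUnit (w.C n)) :
    ∃ W, w.IsRightWeight W := by
  obtain ⟨K, hK⟩ := w.exists_norm_rep_le
  refine hRE.isSymmetrizer.cutAt.exists_orthogonalityWeight
    (norm_cutAt_le (fun n => (hK n).1) _) (fun n => (hK n).2.1)
    (norm_cutAt_le (fun n => (hK n).2.2) _) (isRowSolution_rightRow hA hC)
    (continuous_intRow_poly _ _ _ _) (σ := fun k => (k : ℤ)) Nat.cast_injective (fun _ => rfl)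
    fun M hM h0 k u => ?_
  refine single_mem_of_nonneg hM (fun n hn => ?_) h0 (fun u => ?_) k u
  · rw [cutAt_of_ne (by omega)]
    exact isUnit_rep (hA n hn)
  · simp

theorem Symmetrizable.exists_isLeftWeight (hRE : w.Symmetrizable R E)
    (hA : ∀ n : ℤ, 0 ≤ n → IsUnit (w.A n)) (hC : ∀ n : ℤ, n ≤ -1 → IsUnit (w.C n)) :
    ∃ W, w.IsLeftWeight W := by
  obtain ⟨K, hK⟩ := w.exists_norm_rep_le
  have := hRE.isSymmetrizer.cutAt.exists_orthogonalityWeight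
    (norm_cutAt_le (fun n => (hK n).1) _) (fun n => (hK n).2.1)
    (norm_cutAt_le (fun n => (hK n).2.2) _) (isRowSolution_leftRow hA hC)
    (continuous_intRow_poly _ _ _ _) (σ := fun k => -(k : ℤ) - 1) (fun k l h => by simpa using h)
    (fun _ => intRow_neg _ _ _)
    fun M hM h0 k u => by
      refine single_mem_of_neg hM (fun n hn => ?_) (by simpa using h0) (fun u => ?_) k u
      · rw [cutAt_of_ne (by omega)]
        exact isUnit_rep (hC n hn)
      · simp
  simp only [leftRow, intRow_neg] at this
  exact this

/-- The site at which the family `α` of polynomials has the value `1`; at the site of the other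
family its value is `0`. -/
def site (α : Fin 2) : ℤ := if α = 0 then 0 else -1

theorem poly_site (α β : Fin 2) (x : ℝ) : w.poly α (site β) x = if α = β then 1 else 0 := by
  fin_cases α <;> fin_cases β <;> rfl

/-- The two families of polynomials as one family of matrices with two blocks, one above the
other. -/
def stackedPoly (w : TridiagonalCTOQW d) (x : ℝ) (n : ℤ) :
    Matrix (Fin 2 × (Fin d × Fin d)) (Fin d × Fin d) ℂ :=
  Matrix.of fun r q => w.poly r.1 n x r.2 q

theorem isRowSolution_stackedPoly (hA : ∀ n : ℤ, 0 ≤ n → IsUnit (w.A n))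
    (hC : ∀ n : ℤ, n ≤ -1 → IsUnit (w.C n)) (x : ℝ) :
    IsRowSolution (fun n => rep (w.A n)) w.diag (fun n => rep (w.C n)) x (w.stackedPoly x) := by
  intro n
  ext ⟨α, p⟩ q
  exact congrFun (congrFun (isRowSolution_poly hA hC α x n) p) q

theorem stackedPoly_conjTranspose_mul_mul (W : MatrixMeasure (Fin 2 × (Fin d × Fin d))) (x : ℝ)
    (j i : ℤ) : (w.stackedPoly x j)ᴴ * W.density x * w.stackedPoly x i =
      ∑ α : Fin 2, ∑ β : Fin 2, (w.poly α j x)ᴴ * (W.block α β).density x * w.poly β i x := by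
  ext p q
  simp only [Matrix.sum_apply, Matrix.mul_apply, Matrix.conjTranspose_apply, stackedPoly,
    Matrix.of_apply, Fintype.sum_prod_type (α₁ := Fin 2), MatrixMeasure.block, Finset.sum_mul]
  exact (Finset.sum_congr rfl fun β _ => Finset.sum_comm).trans Finset.sum_comm

theorem Symmetrizable.exists_isSpectralBlockMatrix (hRE : w.Symmetrizable R E)
    (hA : ∀ n : ℤ, 0 ≤ n → IsUnit (w.A n)) (hC : ∀ n : ℤ, n ≤ -1 → IsUnit (w.C n)) :
    ∃ W, w.IsSpectralBlockMatrix R W := by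
  obtain ⟨K, hK⟩ := w.exists_norm_rep_le
  let φ : Fin 2 × (Fin d × Fin d) → ℤ →₀ (Fin d × Fin d → ℂ) :=
    fun r => Finsupp.single (site r.1) (Pi.single r.2 1)
  have hc : ∀ n p q, Continuous fun x => w.stackedPoly x n p q :=
    fun n p q => continuous_poly _ _ _ _
  obtain ⟨W, hW, ⟨K', hK'⟩, hWm⟩ := hRE.isSymmetrizer.exists_weight
    (fun n => (hK n).1) (fun n => (hK n).2.1) (fun n => (hK n).2.2) φ
    (isRowSolution_stackedPoly hA hC) hc (fun x r => by
      obtain ⟨α, p⟩ := r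
      ext ⟨β, q⟩
      rw [rowTransform_single, Matrix.mulVec_single_one, Matrix.col_apply, stackedPoly,
        Matrix.of_apply, poly_site, Pi.single_apply]
      by_cases hαβ : β = α
      · simp [hαβ, Matrix.one_apply]
      · simp [hαβ])
  have hmem : ∀ n u, Finsupp.single n u ∈ Submodule.span ℂ {ψ | ∃ (m : ℕ)
      (p : Fin 2 × (Fin d × Fin d)), ψ = (tridiag (fun n => rep (w.A n)) w.diag
        (fun n => rep (w.C n)) ^ m) (φ p)} := by
    set M := Submodule.span ℂ {ψ | ∃ (m : ℕ) (p : Fin 2 × (Fin d × Fin d)),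
      ψ = (tridiag (fun n => rep (w.A n)) w.diag (fun n => rep (w.C n)) ^ m) (φ p)}
    have h0 := single_mem_of_basis (n := 0) (M := M) fun p =>
      Submodule.subset_span ⟨0, (0, p), rfl⟩
    have h1 := single_mem_of_basis (n := -1) (M := M) fun p =>
      Submodule.subset_span ⟨0, (1, p), rfl⟩
    intro n u
    obtain ⟨k, rfl | rfl⟩ := Int.exists_eq_natCast_or_eq_neg n
    · exact single_mem_of_nonneg (tridiag_mem_span φ) (fun n hn => isUnit_rep (hA n hn)) h0
        (fun u => h1 _) k u
    · exact single_mem_of_neg (tridiag_mem_span φ) (fun n hn => isUnit_rep (hC n hn)) h1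
        (fun u => h0 _) k u
  have hpi : ∀ (j i : ℤ) (t : ℝ) (α β : Fin 2), (W.block α β).PairIntegrable
      (fun x => (Real.exp (-x * t) : ℂ)) (w.poly α j) (w.poly β i) := by
    intro j i t α β p q
    -- the pairing with one block of the measure, as a pairing with the whole measure
    have hb : ∀ x, (w.poly α j x)ᴴ * (W.block α β).density x * w.poly β i x =
        (Matrix.of fun (r : Fin 2 × (Fin d × Fin d)) s =>
          if r.1 = α then w.poly α j x r.2 s else 0)ᴴ * W.density x *
        (Matrix.of fun (r : Fin 2 × (Fin d × Fin d)) s =>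
          if r.1 = β then w.poly β i x r.2 s else 0) := by
      intro x
      ext p q
      simp only [Matrix.mul_apply, Matrix.conjTranspose_apply, Matrix.of_apply,
        Fintype.sum_prod_type (α₁ := Fin 2), MatrixMeasure.block, Finset.sum_mul, apply_ite star,
        star_zero, ite_mul, zero_mul, mul_ite, mul_zero]
      simp
    have hc' : ∀ (α : Fin 2) (j : ℤ) (r : Fin 2 × (Fin d × Fin d)) (s : Fin d × Fin d),
        Continuous fun x => (Matrix.of fun (r : Fin 2 × (Fin d × Fin d)) s =>
          if r.1 = α then w.poly α j x r.2 s else 0) r s := by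
      intro α j r s
      simp only [Matrix.of_apply]
      split_ifs
      · exact continuous_poly _ _ _ _
      · exact continuous_const
    have := MatrixMeasure.integrable_of_continuous hK'
      (f := fun x => (Real.exp (-x * t) : ℂ)) (by fun_prop) (hc' α j) (hc' β i) p q
    refine this.congr (Filter.Eventually.of_forall fun x => ?_)
    simp only [Matrix.smul_apply, smul_eq_mul]
    rw [← hb]
  refine ⟨W, hW, fun j i t _ α β => hpi j i t α β, fun j i t _ => ?_⟩
  have hS : (R j)ᴴ * R j * w.semigroupBlock t j i = ∑ α : Fin 2, ∑ β : Fin 2,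
      (W.block α β).pair (fun x => (Real.exp (-x * t) : ℂ)) (w.poly α j) (w.poly β i) := by
    ext p q
    have hg : Integrable (fun x => ((w.stackedPoly x j)ᴴ * W.density x * w.stackedPoly x i) p q)
        W.base := by
      simpa using MatrixMeasure.integrable_of_continuous hK' (f := fun _ => 1) continuous_const
        (hc j) (hc i) p q
    have h1 := integral_exp_neg_mul_eq_tsum hg (K := K')
      (hK'.mono fun x hx hx' => absurd hx (not_le.2 hx'))
      (fun k => hWm j i (hmem j) (hmem i) k p q) t
    have h2 := Matrix.mul_tsum_apply (summable_norm_exp_triPow (fun n => (hK n).1)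
      (fun n => (hK n).2.1) (fun n => (hK n).2.2) j i t) ((R j)ᴴ * R j) p q
    simp only [Matrix.mul_smul, Matrix.smul_apply, smul_eq_mul] at h2
    simp only [semigroupBlock, blockPow_eq_triPow]
    rw [h2, ← h1]
    have h3 : ∀ x : ℝ, (Real.exp (-x * t) : ℂ) *
        ((w.stackedPoly x j)ᴴ * W.density x * w.stackedPoly x i) p q =
        ∑ α : Fin 2, ∑ β : Fin 2, ((Real.exp (-x * t) : ℂ) •
          ((w.poly α j x)ᴴ * (W.block α β).density x * w.poly β i x)) p q := fun x => by
      rw [stackedPoly_conjTranspose_mul_mul]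
      simp only [Matrix.sum_apply, Finset.mul_sum, Matrix.smul_apply, smul_eq_mul]
    simp_rw [h3]
    rw [integral_finsetSum _ fun α _ => integrable_finsetSum _ fun β _ => hpi j i t α β p q]
    simp only [Matrix.sum_apply]
    refine Finset.sum_congr rfl fun α _ => ?_
    rw [integral_finsetSum _ fun β _ => hpi j i t α β p q]
    rfl
  have hu : IsUnit ((R j)ᴴ * R j) := (hRE.isSymmetrizer.posDef j).isUnit
  simp only [← Finset.mul_sum]
  rw [← hS, normalization, Matrix.nonsing_inv_mul_cancel_left _ _
    ((Matrix.isUnit_iff_isUnit_det _).1 hu)]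

end TridiagonalCTOQW

end Walk

/-! ### Stieltjes transforms of given weight matrices -/

section Transforms

open scoped Matrix.Norms.L2Operator

/-- The Stieltjes transform of an orthogonality weight for a solution of the recurrence which
vanishes outside the sites `σ k`. -/
theorem MatrixMeasure.IsOrthogonalityWeight.stieltjes_eq {ι : Type*} [Fintype ι] [DecidableEq ι]
    {a b c : ℤ → Matrix ι ι ℂ} {K : ℝ} (ha : ∀ n, ‖a n‖ ≤ K) (hb : ∀ n, ‖b n‖ ≤ K)
    (hc : ∀ n, ‖c n‖ ≤ K) {P : ℝ → ℤ → Matrix ι ι ℂ} (hP : ∀ x, IsRowSolution a b c x (P x))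
    {σ : ℕ → ℤ} (h1 : ∀ x, P x (σ 0) = 1) (h0 : ∀ x j, (∀ k, j ≠ σ k) → P x j = 0)
    {W : MatrixMeasure ι} (hW : W.IsOrthogonalityWeight fun x k => P x (σ k))
    (hbd : ∀ p, ∃ C : ℝ, ∀ t : ℝ, 0 ≤ t → ‖∑' k : ℕ, (t : ℂ) ^ k / (k.factorial : ℂ) *
      (W.mass * triPow a b c k (σ 0) (σ 0)) p p‖ ≤ C) :
    IsUnit W.mass ∧ (∀ᵐ x ∂W.base, x < 0 → W.density x = 0) ∧ ∀ r : ℝ, 3 * K < r →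
      W.mass⁻¹ * W.stieltjes (-(r : ℂ)) = resolventBlock a b c r (σ 0) (σ 0) := by
  have hu : IsUnit W.mass := by
    have := hW.nonsingular 0
    simpa [MatrixMeasure.pair, MatrixMeasure.mass, h1] using this
  obtain ⟨hs, hr⟩ := hW.isPositive.stieltjes_of_orthogonal ha hb hc hP h1
    (fun j p q => by
      by_cases hj : ∃ k, j = σ k
      · obtain ⟨k, rfl⟩ := hj
        simpa [h1] using hW.integrable 0 k p q
      · simp [h0 _ j (not_exists.1 hj)])
    (fun j hj0 p q => by
      by_cases hj : ∃ k, j = σ k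
      · obtain ⟨k, rfl⟩ := hj
        have := congrFun (congrFun (hW.orthogonal 0 k fun h => hj0 (by rw [h])) p) q
        simpa [MatrixMeasure.pair, h1] using this
      · simp [h0 _ j (not_exists.1 hj)]) hbd
  refine ⟨hu, hs, fun r h => ?_⟩
  rw [hr r h, Matrix.nonsing_inv_mul_cancel_left _ _ ((Matrix.isUnit_iff_isUnit_det _).1 hu)]

theorem MatrixMeasure.stieltjesIntegrable_of_nonneg {ι : Type*} {W : MatrixMeasure ι}
    (h0 : ∀ᵐ x ∂W.base, x < 0 → W.density x = 0) {w : ℂ} (hw : w ∈ Complex.slitPlane) :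
    W.StieltjesIntegrable (-w) := by
  intro p q
  simpa only [sub_neg_eq_add] using integrable_div_ofReal_add (W.integrable p q)
    (h0.mono fun x hx hx' => by rw [hx hx']; rfl) hw

theorem MatrixMeasure.differentiableOn_stieltjes_neg {ι : Type*} [Fintype ι] [DecidableEq ι]
    {W : MatrixMeasure ι} (h0 : ∀ᵐ x ∂W.base, x < 0 → W.density x = 0) :
    DifferentiableOn ℂ (fun w => W.stieltjes (-w)) Complex.slitPlane := by
  have e : (fun w => W.stieltjes (-w)) = fun w => ∑ p, ∑ q,
      (∫ x, W.density x p q / ((x : ℂ) + w) ∂W.base) • Matrix.single p q (1 : ℂ) := by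
    funext w
    rw [Matrix.matrix_eq_sum_single (W.stieltjes (-w))]
    simp [MatrixMeasure.stieltjes, Matrix.smul_single]
  rw [e]
  exact DifferentiableOn.fun_sum fun p _ => DifferentiableOn.fun_sum fun q _ =>
    (differentiableOn_integral_div_ofReal_add (W.integrable p q)
      (h0.mono fun x hx hx' => by rw [hx hx']; rfl)).smul_const _

theorem MatrixMeasure.stieltjesOpp_eq_neg {ι : Type*} (W : MatrixMeasure ι) (z : ℂ) :
    W.stieltjesOpp z = -W.stieltjes z := by
  ext p q
  simp only [MatrixMeasure.stieltjesOpp, MatrixMeasure.stieltjes, Matrix.of_apply,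
    Matrix.neg_apply]
  rw [← integral_neg]
  refine integral_congr_ae (Filter.Eventually.of_forall fun x => ?_)
  change _ = -_
  rw [← div_neg, neg_sub]

namespace TridiagonalCTOQW

variable {d : ℕ} {w : TridiagonalCTOQW d} {R E : ℤ → Matrix (Fin d × Fin d) (Fin d × Fin d) ℂ}

theorem isSubfamily_cutAt {n₀ : ℤ} {A : ℤ → Matrix (Fin d) (Fin d) ℂ} :
    IsSubfamily A (cutAt n₀ A) := fun n => by
  by_cases h : n = n₀
  · subst h; simp
  · exact Or.inl (cutAt_of_ne h)

theorem exists_norm_tsum_mul_triPow_cutAt_le {K : ℝ} (ha : ∀ n, ‖rep (w.A n)‖ ≤ K)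
    (hb : ∀ n, ‖w.diag n‖ ≤ K) (hc : ∀ n, ‖rep (w.C n)‖ ≤ K)
    (M : Matrix (Fin d × Fin d) (Fin d × Fin d) ℂ) (j i : ℤ) (p q : Fin d × Fin d) :
    ∃ C : ℝ, ∀ t : ℝ, 0 ≤ t → ‖∑' k : ℕ, (t : ℂ) ^ k / (k.factorial : ℂ) *
      (M * triPow (cutAt (-1) fun n => rep (w.A n)) w.diag (cutAt 0 fun n => rep (w.C n)) k j i)
        p q‖ ≤ C := by
  have ha' := norm_cutAt_le ha (-1)
  have hc' := norm_cutAt_le hc 0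
  rw [cutAt_rep] at ha' hc' ⊢
  rw [cutAt_rep]
  exact exists_norm_tsum_mul_triPow_le isSubfamily_cutAt isSubfamily_cutAt ha' hb hc' M j i p q

theorem IsRightWeight.stieltjes_eq (hA : ∀ n : ℤ, 0 ≤ n → IsUnit (w.A n))
    (hC : ∀ n : ℤ, n ≤ -1 → IsUnit (w.C n)) {K : ℝ} (ha : ∀ n, ‖rep (w.A n)‖ ≤ K)
    (hb : ∀ n, ‖w.diag n‖ ≤ K) (hc : ∀ n, ‖rep (w.C n)‖ ≤ K)
    {W : MatrixMeasure (Fin d × Fin d)} (hW : w.IsRightWeight W) :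
    IsUnit W.mass ∧ (∀ᵐ x ∂W.base, x < 0 → W.density x = 0) ∧ ∀ r : ℝ, 3 * K < r →
      W.mass⁻¹ * W.stieltjes (-(r : ℂ)) = resolventBlock (cutAt (-1) fun n => rep (w.A n)) w.diag
        (cutAt 0 fun n => rep (w.C n)) r 0 0 :=
  MatrixMeasure.IsOrthogonalityWeight.stieltjes_eq (norm_cutAt_le ha _) hb (norm_cutAt_le hc _)
    (isRowSolution_rightRow hA hC) (σ := fun k => (k : ℤ)) (fun _ => rfl)
    (fun x j hj => by
      obtain ⟨k, rfl | rfl⟩ := Int.exists_eq_natCast_or_eq_neg j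
      · exact absurd rfl (hj k)
      · rw [rightRow, intRow_neg]
        exact threeTerm_zero_zero x k)
    hW (fun p => exists_norm_tsum_mul_triPow_cutAt_le ha hb hc _ _ _ p p)

theorem IsLeftWeight.stieltjes_eq (hA : ∀ n : ℤ, 0 ≤ n → IsUnit (w.A n))
    (hC : ∀ n : ℤ, n ≤ -1 → IsUnit (w.C n)) {K : ℝ} (ha : ∀ n, ‖rep (w.A n)‖ ≤ K)
    (hb : ∀ n, ‖w.diag n‖ ≤ K) (hc : ∀ n, ‖rep (w.C n)‖ ≤ K)
    {W : MatrixMeasure (Fin d × Fin d)} (hW : w.IsLeftWeight W) :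
    IsUnit W.mass ∧ (∀ᵐ x ∂W.base, x < 0 → W.density x = 0) ∧ ∀ r : ℝ, 3 * K < r →
      W.mass⁻¹ * W.stieltjes (-(r : ℂ)) = resolventBlock (cutAt (-1) fun n => rep (w.A n)) w.diag
        (cutAt 0 fun n => rep (w.C n)) r (-1) (-1) := by
  have hW' : W.IsOrthogonalityWeight fun x (k : ℕ) => w.leftRow x (-(k : ℤ) - 1) := by
    simp only [leftRow, intRow_neg]
    exact hW
  exact MatrixMeasure.IsOrthogonalityWeight.stieltjes_eq (norm_cutAt_le ha _) hb
    (norm_cutAt_le hc _) (isRowSolution_leftRow hA hC) (σ := fun k => -(k : ℤ) - 1)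
    (fun _ => intRow_neg _ _ _)
    (fun x j hj => by
      obtain ⟨k, rfl | rfl⟩ := Int.exists_eq_natCast_or_eq_neg j
      · exact threeTerm_zero_zero x k
      · exact absurd rfl (hj k))
    hW' (fun p => exists_norm_tsum_mul_triPow_cutAt_le ha hb hc _ _ _ p p)

/-- The Karlin-McGregor formula at the sites `0` and `-1`, where the polynomials are constant,
determines the Laplace transform of a spectral block matrix. -/
theorem IsSpectralBlockMatrix.stieltjes_eq (hRE : w.Symmetrizable R E) {K : ℝ}
    (ha : ∀ n, ‖rep (w.A n)‖ ≤ K) (hb : ∀ n, ‖w.diag n‖ ≤ K) (hc : ∀ n, ‖rep (w.C n)‖ ≤ K)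
    {W : MatrixMeasure (Fin 2 × (Fin d × Fin d))} (hW : w.IsSpectralBlockMatrix R W) :
    (∀ᵐ x ∂W.base, x < 0 → W.density x = 0) ∧ ∀ r : ℝ, 3 * K < r → ∀ α β : Fin 2,
      normalization R (site α) * (W.block α β).stieltjes (-(r : ℂ)) =
        resolventBlock (fun n => rep (w.A n)) w.diag (fun n => rep (w.C n)) r
          (site α) (site β) := by
  have hK : 0 ≤ K := (norm_nonneg _).trans (ha 0)
  let S : ℤ → Matrix (Fin d × Fin d) (Fin d × Fin d) ℂ := fun n => (R n)ᴴ * R n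
  have hu : ∀ n, IsUnit (S n).det := fun n =>
    (Matrix.isUnit_iff_isUnit_det _).1 (hRE.isSymmetrizer.posDef n).isUnit
  let T : ℕ → ℤ → ℤ → Matrix (Fin d × Fin d) (Fin d × Fin d) ℂ :=
    triPow (fun n => rep (w.A n)) w.diag (fun n => rep (w.C n))
  let h : ℕ → Matrix (Fin 2 × (Fin d × Fin d)) (Fin 2 × (Fin d × Fin d)) ℂ := fun k =>
    Matrix.of fun r s => (S (site r.1) * T k (site r.1) (site s.1)) r.2 s.2
  have hi : ∀ t : ℝ, 0 ≤ t → ∀ r s,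
      Integrable (fun x => (Real.exp (-x * t) : ℂ) * W.density x r s) W.base := by
    intro t ht r s
    have := hW.integrable (site r.1) (site s.1) t ht r.1 s.1 r.2 s.2
    simpa only [poly_site, if_true, Matrix.conjTranspose_one, one_mul, mul_one, Matrix.smul_apply,
      smul_eq_mul, MatrixMeasure.block, Matrix.of_apply] using this
  have he : ∀ t : ℝ, 0 ≤ t → ∀ r s, ∫ x, (Real.exp (-x * t) : ℂ) * W.density x r s ∂W.base =
      ∑' k : ℕ, (t : ℂ) ^ k / (k.factorial : ℂ) * h k r s := by
    intro t ht r s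
    have h1 := hW.karlinMcGregor (site r.1) (site s.1) t ht
    simp only [← Finset.mul_sum] at h1
    have h2 := congrArg (fun M => S (site r.1) * M) h1
    simp only [normalization, Matrix.mul_nonsing_inv_cancel_left (S _) _ (hu _), S] at h2
    rw [Finset.sum_eq_single r.1 (fun α _ hα => Finset.sum_eq_zero fun β _ => ?_) (by simp),
      Finset.sum_eq_single s.1 (fun β _ hβ => ?_) (by simp)] at h2
    · have h3 := Matrix.mul_tsum_apply (summable_norm_exp_triPow ha hb hc (site r.1) (site s.1) t)
        (S (site r.1)) r.2 s.2
      simp only [Matrix.mul_smul, Matrix.smul_apply, smul_eq_mul] at h3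
      simp only [h, T, Matrix.of_apply]
      rw [← h3]
      simp only [semigroupBlock, blockPow_eq_triPow] at h2
      rw [show S (site r.1) = (R (site r.1))ᴴ * R (site r.1) from rfl, h2]
      simp only [MatrixMeasure.pair, poly_site, if_true, Matrix.conjTranspose_one, one_mul,
        mul_one, Matrix.smul_apply, smul_eq_mul, MatrixMeasure.block, Matrix.of_apply]
    · ext p q
      simp [MatrixMeasure.pair, poly_site, hβ]
    · ext p q
      simp [MatrixMeasure.pair, poly_site, hα]
  obtain ⟨h0, hr⟩ := hW.isPositive.stieltjes_of_laplace (h := h) (K := 3 * K) (by positivity)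
    (fun r s => ⟨_, fun k => norm_mul_triPow_apply_le ha hb hc _ _ _ _ _ _⟩) hi he
    (fun r => exists_norm_tsum_mul_triPow_le (fun n => Or.inl rfl) (fun n => Or.inl rfl)
      ha hb hc _ _ _ _ _)
  refine ⟨h0, fun r hKr α β => ?_⟩
  have hr' : 3 * K < ‖(r : ℂ)‖ := by
    rw [Complex.norm_real]; exact hKr.trans_le (le_abs_self r)
  have e : (W.block α β).stieltjes (-(r : ℂ)) = S (site α) * resolventBlock
      (fun n => rep (w.A n)) w.diag (fun n => rep (w.C n)) r (site α) (site β) := by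
    ext p q
    rw [resolventBlock, Matrix.mul_tsum_apply (summable_norm_resolventBlock ha hb hc hr' _ _)]
    simp only [Matrix.mul_smul, Matrix.smul_apply, smul_eq_mul]
    have := hr r hKr (α, p) (β, q)
    simp only [h, T, Matrix.of_apply] at this
    rw [← this]
    simp [MatrixMeasure.stieltjes, MatrixMeasure.block]
  rw [e, normalization, Matrix.nonsing_inv_mul_cancel_left (S _) _ (hu _)]

/-- The resolvent equations for the removal of the edge between `-1` and `0`, in terms of the
Stieltjes transforms on the slit plane. -/
theorem coupled_stieltjes (hA : ∀ n : ℤ, 0 ≤ n → IsUnit (w.A n))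
    (hC : ∀ n : ℤ, n ≤ -1 → IsUnit (w.C n)) (hRE : w.Symmetrizable R E)
    {W : MatrixMeasure (Fin 2 × (Fin d × Fin d))} {Wp Wm : MatrixMeasure (Fin d × Fin d)}
    (hW : w.IsSpectralBlockMatrix R W) (hWp : w.IsRightWeight Wp) (hWm : w.IsLeftWeight Wm)
    {z : ℂ} (hz : -z ∈ Complex.slitPlane) :
    let f := Wp.mass⁻¹ * Wp.stieltjes z
    let g := Wm.mass⁻¹ * Wm.stieltjes z
    let G : Fin 2 → Fin 2 → Matrix (Fin d × Fin d) (Fin d × Fin d) ℂ :=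
      fun α β => normalization R (site α) * (W.block α β).stieltjes z
    G 0 0 = f + f * rep (w.A (-1)) * G 1 0 ∧ G 1 0 = g * rep (w.C 0) * G 0 0 ∧
      G 1 1 = g + g * rep (w.C 0) * G 0 1 ∧ G 0 1 = f * rep (w.A (-1)) * G 1 1 := by
  obtain ⟨K, hK⟩ := w.exists_norm_rep_le
  have ha := fun n => (hK n).1
  have hb := fun n => (hK n).2.1
  have hc := fun n => (hK n).2.2
  obtain ⟨h0, hr⟩ := hW.stieltjes_eq hRE ha hb hc
  obtain ⟨-, hp0, hpr⟩ := hWp.stieltjes_eq hA hC ha hb hc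
  obtain ⟨-, hm0, hmr⟩ := hWm.stieltjes_eq hA hC ha hb hc
  have : CompleteSpace (Matrix (Fin d × Fin d) (Fin d × Fin d) ℂ) := FiniteDimensional.complete ℂ _
  have df : DifferentiableOn ℂ (fun w => Wp.mass⁻¹ * Wp.stieltjes (-w)) Complex.slitPlane :=
    (MatrixMeasure.differentiableOn_stieltjes_neg hp0).const_mul _
  have dg : DifferentiableOn ℂ (fun w => Wm.mass⁻¹ * Wm.stieltjes (-w)) Complex.slitPlane :=
    (MatrixMeasure.differentiableOn_stieltjes_neg hm0).const_mul _
  have dG : ∀ α β, DifferentiableOn ℂ (fun w => normalization R (site α) *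
      (W.block α β).stieltjes (-w)) Complex.slitPlane := fun α β =>
    (MatrixMeasure.differentiableOn_stieltjes_neg (W := W.block α β)
      (h0.mono fun x hx hx' => by ext p q; simp [MatrixMeasure.block, hx hx'])).const_mul _
  -- the resolvent identity, after omission of the vanishing blocks of the decoupled resolvent
  have hres : ∀ r : ℝ, 3 * K < r → ∀ j i : ℤ, _ := fun r hKr =>
    resolventBlock_eq_cutAt ha hb hc (w := (r : ℂ))
      (by rw [Complex.norm_real]; exact hKr.trans_le (le_abs_self r))
  have hz' : ∀ r : ℝ, resolventBlock (cutAt (-1) fun n => rep (w.A n)) w.diag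
        (cutAt 0 fun n => rep (w.C n)) r 0 (-1) = 0 ∧
      resolventBlock (cutAt (-1) fun n => rep (w.A n)) w.diag
        (cutAt 0 fun n => rep (w.C n)) r (-1) 0 = 0 := fun r =>
    ⟨resolventBlock_cutAt_eq_zero _ (by decide), resolventBlock_cutAt_eq_zero _ (by decide)⟩
  have s0 : site 0 = 0 := rfl
  have s1 : site 1 = -1 := rfl
  have r₀₀ := fun r h => hr r h 0 0
  have r₀₁ := fun r h => hr r h 0 1
  have r₁₀ := fun r h => hr r h 1 0
  have r₁₁ := fun r h => hr r h 1 1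
  simp only [s0, s1] at r₀₀ r₀₁ r₁₀ r₁₁
  have e₀₀ := eqOn_slitPlane_of_eq_ofReal (K := 3 * K) (dG 0 0)
    (df.add ((df.mul_const (rep (w.A (-1)))).mul (dG 1 0))) fun r hKr => by
      have := hres r hKr 0 0
      simp only [(hz' r).1, zero_mul, add_zero] at this
      simpa only [Pi.add_apply, Pi.mul_apply,
        r₀₀ r hKr, r₁₀ r hKr, hpr r hKr, s0, s1] using this
  have e₁₀ := eqOn_slitPlane_of_eq_ofReal (K := 3 * K) (dG 1 0)
    ((dg.mul_const (rep (w.C 0))).mul (dG 0 0)) fun r hKr => by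
      have := hres r hKr (-1) 0
      simp only [(hz' r).2, zero_mul, zero_add] at this
      simpa only [Pi.add_apply, Pi.mul_apply,
        r₀₀ r hKr, r₁₀ r hKr, hmr r hKr, s0, s1] using this
  have e₁₁ := eqOn_slitPlane_of_eq_ofReal (K := 3 * K) (dG 1 1)
    (dg.add ((dg.mul_const (rep (w.C 0))).mul (dG 0 1))) fun r hKr => by
      have := hres r hKr (-1) (-1)
      simp only [(hz' r).2, zero_mul, zero_add] at this
      simpa only [Pi.add_apply, Pi.mul_apply,
        r₁₁ r hKr, r₀₁ r hKr, hmr r hKr, s0, s1] using this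
  have e₀₁ := eqOn_slitPlane_of_eq_ofReal (K := 3 * K) (dG 0 1)
    ((df.mul_const (rep (w.A (-1)))).mul (dG 1 1)) fun r hKr => by
      have := hres r hKr 0 (-1)
      simp only [(hz' r).1, zero_mul, zero_add, add_zero] at this
      simpa only [Pi.add_apply, Pi.mul_apply,
        r₁₁ r hKr, r₀₁ r hKr, hpr r hKr, s0, s1] using this
  have := And.intro (e₀₀ hz) (And.intro (e₁₀ hz) (And.intro (e₁₁ hz) (e₀₁ hz)))
  simpa only [Pi.add_apply, Pi.mul_apply, neg_neg] using this

end TridiagonalCTOQW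

end Transforms

end

/-! ### The identities for the Stieltjes transforms -/

theorem mainTheorem1 {d : ℕ} (w : TridiagonalCTOQW d)
    (hA : ∀ n : ℤ, 0 ≤ n → IsUnit (w.A n)) (hC : ∀ n : ℤ, n ≤ -1 → IsUnit (w.C n))
    (R E : ℤ → Matrix (Fin d × Fin d) (Fin d × Fin d) ℂ) (hRE : w.Symmetrizable R E) :
    (∃ W, w.IsSpectralBlockMatrix R W) ∧ (∃ Wp, w.IsRightWeight Wp) ∧ (∃ Wm, w.IsLeftWeight Wm) ∧
    ∀ (W : MatrixMeasure (Fin 2 × (Fin d × Fin d))) (Wp Wm : MatrixMeasure (Fin d × Fin d)),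
      w.IsSpectralBlockMatrix R W → w.IsRightWeight Wp → w.IsLeftWeight Wm →
    ∀ P₀ P₁ Pp Pm a c : Matrix (Fin d × Fin d) (Fin d × Fin d) ℂ,
      P₀ = TridiagonalCTOQW.normalization R 0 → P₁ = TridiagonalCTOQW.normalization R (-1) →
      Pp = Wp.mass⁻¹ → Pm = Wm.mass⁻¹ →
      a = rep (w.A (-1)) → c = rep (w.C 0) →
    ∀ z : ℂ, z.re < 0 ∨ z.im ≠ 0 →
      -- all the transforms and all the inverses below exist
      (W.StieltjesIntegrable z ∧ Wp.StieltjesIntegrable z ∧ Wm.StieltjesIntegrable z ∧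
        IsUnit P₀ ∧ IsUnit P₁ ∧ IsUnit Wp.mass ∧ IsUnit Wm.mass ∧
        IsUnit (1 - a * Pm * Wm.stieltjes z * c * Pp * Wp.stieltjes z) ∧
        IsUnit (1 - c * Pp * Wp.stieltjes z * a * Pm * Wm.stieltjes z)) ∧
      -- the identities
      (P₀ * (W.block 0 0).stieltjes z = Pp * Wp.stieltjes z *
          (1 - a * Pm * Wm.stieltjes z * c * Pp * Wp.stieltjes z)⁻¹ ∧
        P₁ * (W.block 1 1).stieltjes z = Pm * Wm.stieltjes z *
          (1 - c * Pp * Wp.stieltjes z * a * Pm * Wm.stieltjes z)⁻¹ ∧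
        P₀ * (W.block 0 1).stieltjes z = Pp * Wp.stieltjes z *
          (1 - a * Pm * Wm.stieltjes z * c * Pp * Wp.stieltjes z)⁻¹ * a * Pm * Wm.stieltjes z ∧
        P₁ * (W.block 1 0).stieltjes z = Pm * Wm.stieltjes z *
          (1 - c * Pp * Wp.stieltjes z * a * Pm * Wm.stieltjes z)⁻¹ * c * Pp * Wp.stieltjes z) ∧
      -- the same identities for the transform with kernel `1 / (z - x)`
      (P₀ * (W.block 0 0).stieltjesOpp z = Pp * Wp.stieltjesOpp z *
          (1 - a * Pm * Wm.stieltjesOpp z * c * Pp * Wp.stieltjesOpp z)⁻¹ ∧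
        P₁ * (W.block 1 1).stieltjesOpp z = Pm * Wm.stieltjesOpp z *
          (1 - c * Pp * Wp.stieltjesOpp z * a * Pm * Wm.stieltjesOpp z)⁻¹ ∧
        P₀ * (W.block 0 1).stieltjesOpp z = -(Pp * Wp.stieltjesOpp z *
          (1 - a * Pm * Wm.stieltjesOpp z * c * Pp * Wp.stieltjesOpp z)⁻¹ *
            a * Pm * Wm.stieltjesOpp z) ∧
        P₁ * (W.block 1 0).stieltjesOpp z = -(Pm * Wm.stieltjesOpp z *
          (1 - c * Pp * Wp.stieltjesOpp z * a * Pm * Wm.stieltjesOpp z)⁻¹ *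
            c * Pp * Wp.stieltjesOpp z)) ∧
      -- the special case of trivial normalizations
      (P₀ = 1 → P₁ = 1 → Pp = 1 → Pm = 1 →
        (W.block 0 0).stieltjes z = Wp.stieltjes z *
          (1 - a * Wm.stieltjes z * c * Wp.stieltjes z)⁻¹ ∧
        (W.block 1 1).stieltjes z = Wm.stieltjes z *
          (1 - c * Wp.stieltjes z * a * Wm.stieltjes z)⁻¹ ∧
        (W.block 0 1).stieltjes z = Wp.stieltjes z *
          (1 - a * Wm.stieltjes z * c * Wp.stieltjes z)⁻¹ * a * Wm.stieltjes z ∧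
        (W.block 1 0).stieltjes z = Wm.stieltjes z *
          (1 - c * Wp.stieltjes z * a * Wm.stieltjes z)⁻¹ * c * Wp.stieltjes z) := by
  refine ⟨hRE.exists_isSpectralBlockMatrix hA hC, hRE.exists_isRightWeight hA hC,
    hRE.exists_isLeftWeight hA hC, ?_⟩
  rintro W Wp Wm hW hWp hWm P₀ P₁ Pp Pm a c rfl rfl rfl rfl rfl rfl z hz
  -- `ℂ \ [0, ∞)` is the reflected slit plane
  have hz' : -z ∈ Complex.slitPlane := by
    rw [Complex.mem_slitPlane_iff]
    simpa using hz
  obtain ⟨K, hK⟩ := w.exists_norm_rep_le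
  have ha := fun n => (hK n).1
  have hb := fun n => (hK n).2.1
  have hc := fun n => (hK n).2.2
  have hs := (hW.stieltjes_eq hRE ha hb hc).1
  obtain ⟨hup, hsp, -⟩ := hWp.stieltjes_eq hA hC ha hb hc
  obtain ⟨hum, hsm, -⟩ := hWm.stieltjes_eq hA hC ha hb hc
  have hP : ∀ n, IsUnit (TridiagonalCTOQW.normalization R n) := fun n =>
    Matrix.isUnit_nonsing_inv_iff.2 (hRE.isSymmetrizer.posDef n).isUnit
  obtain ⟨g₀₀, g₁₀, g₁₁, g₀₁⟩ := TridiagonalCTOQW.coupled_stieltjes hA hC hRE hW hWp hWm hz'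
  obtain ⟨⟨u₀, u₁⟩, h₀₀, h₁₁, h₀₁, h₁₀⟩ := isUnit_and_eq_of_coupled g₀₀ g₁₀ g₁₁ g₀₁
  simp only [← mul_assoc] at u₀ u₁ h₀₀ h₁₁ h₀₁ h₁₀
  have hint : ∀ {κ : Type} {V : MatrixMeasure κ}, (∀ᵐ x ∂V.base, x < 0 → V.density x = 0) →
      V.StieltjesIntegrable z := fun h => by
    simpa using MatrixMeasure.stieltjesIntegrable_of_nonneg h hz'
  refine ⟨⟨hint hs, hint hsp, hint hsm, hP 0, hP (-1), hup, hum, u₀, u₁⟩,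
    ⟨h₀₀, h₁₁, h₀₁, h₁₀⟩, ?_, fun e₀ e₁ ep em => ?_⟩
  · simp only [MatrixMeasure.stieltjesOpp_eq_neg, mul_neg, neg_mul, neg_neg]
    exact ⟨congrArg Neg.neg h₀₀, congrArg Neg.neg h₁₁, congrArg Neg.neg h₀₁, congrArg Neg.neg h₁₀⟩
  · simp only [TridiagonalCTOQW.site, if_true, one_ne_zero, if_false, e₀, e₁, ep, em, one_mul,
      mul_one] at h₀₀ h₁₁ h₀₁ h₁₀
    exact ⟨h₀₀, h₁₁, h₀₁, h₁₀⟩
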